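/- Let $(M^{2n},\omega)$ be a smooth (Hausdorff) symplectic manifold of dimension $2n$ and let $0\le k<n$. Let $F_1,\dots,F_k:M\to\mathbb R$ be smooth functions in involution, $\omega(JdF_i,JdF_j)=0$, where $J:T_m^*M\to T_mM$ is given by $\omega(x,Ja)=a(x)$. Assume that each Hamiltonian system $\dot x=JdF_j(x)$ has a global phase flow $(g_j^t)_{t\in\mathbb R}$, a smooth one-parameter group of diffeomorphisms of $M$, and put $g^{t}=g_1^{t_1}\circ\dots\circ g_k^{t_k}$ for $t\in\mathbb R^k$. Let $\Lambda\subset M$ be an embedded isotropic $k$-dimensional torus, diffeomorphic to $(S^1)^k$, with $g_j^t(\Lambda)=\Lambda$ for all $j$ and $t$, and assume that $dF_1,\dots,dF_k$ are linearly independent at each point of $\Lambda$. A subspace of a complexified symplectic space carries the complex bilinear extension $[\cdot,\cdot]$ of the symplectic form. A *complex germ* on $\Lambda$ invariant with respect to the Hamiltonian systems $(M,\omega,F_j)$, $j=1,\dots,k$, is a smooth family $m\mapsto r(m)$, $m\in\Lambda$, of $n$-dimensional complex subspaces $r(m)\subset T_mM\otimes\mathbb C$ such that for every $m\in\Lambda$: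 (i) $[x,y]=0$ for all $x,y\in r(m)$; (ii) $T_m\Lambda\otimes\mathbb C\subset r(m)$; (iii) $\frac1{2i}[x,\bar x]>0$ for all $x\in r(m)\setminus(T_m\Lambda\otimes\mathbb C)$; (iv) the complexified derivative of $g_j^t$ at $m$ maps $r(m)$ onto $r(g_j^tm)$ for all $j$ and all $t\in\mathbb R$. Fix $m\in\Lambda$ and let $T_1,\dots,T_k\in\mathbb R^k$ be linearly independent generators of the group $G=\{t\in\mathbb R^k: g^{t}m=m\}$. Let $T_m\Sigma=\bigcap_j\ker dF_j(m)$ be the tangent space of the common level set of the $F_j$ through $m$, and let $\Gamma_m=T_m\Sigma/T_m\Lambda$ with the symplectic form induced by $\omega$. The *reduced monodromy operators* are the symplectic maps $\Xi_j:\Gamma_m\to\Gamma_m$, $\Xi_j[\theta]=[dg^{T_j}(m)\,\theta]$, $j=1,\dots,k$. A linear map $A$ of a finite-dimensional real vector space is *stable* if for every $\varepsilon>0$ there is $\delta>0$ such that $|x|<\delta$ implies $|A^Nx|<\varepsilon$ for all $N\ge1$; a symplectic map is *strongly stable* if it is stable and all (real) symplectic maps sufficiently close to it are stable. **Theorem.**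 If all the reduced monodromy operators $\Xi_1,\dots,\Xi_k$ are stable and at least one of them is strongly stable, then there exists exactly one complex germ on $\Lambda$ invariant with respect to the Hamiltonian systems $(M,\omega,F_j)$, $j=1,\dots,k$. -/

import Mathlib

open scoped Manifold ContDiff TensorProduct Topology

noncomputable section

namespace ComplexGerm

/-! ### Stable and strongly stable linear maps, complexification -/

section LinearAlgebra

variable {V : Type*} [AddCommGroup V] [Module ℝ V]

/-- The maximum norm of the coordinates of `x` in a fixed basis of `V`. -/
def coordNorm [FiniteDimensional ℝ V] (x : V) : ℝ :=
  ‖(Module.finBasis ℝ V).equivFun x‖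

/-- Stability: for every `ε > 0` there is `δ > 0` such that `|x| < δ` implies `|A^N x| < ε` for
all `N > 0`. -/
def IsStable [FiniteDimensional ℝ V] (A : V →ₗ[ℝ] V) : Prop :=
  ∀ ε > 0, ∃ δ > 0, ∀ x : V, coordNorm x < δ → ∀ N : ℕ, 0 < N → coordNorm ((A ^ N) x) < ε

/-- The linear map `A` preserves the bilinear form `B`. -/
def IsSymplecticMap (B : LinearMap.BilinForm ℝ V) (A : V →ₗ[ℝ] V) : Prop :=
  ∀ x y, B (A x) (A y) = B x y

/-- Strong stability: `A` is stable, and so is every symplectic map whose matrix in a fixed basis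
is entrywise close enough to that of `A`. -/
def IsStronglyStable [FiniteDimensional ℝ V] (B : LinearMap.BilinForm ℝ V)
    (A : V →ₗ[ℝ] V) : Prop :=
  IsStable A ∧ ∃ ε > 0, ∀ A' : V →ₗ[ℝ] V, IsSymplecticMap B A' →
    (∀ i j, |LinearMap.toMatrix (Module.finBasis ℝ V) (Module.finBasis ℝ V) A i j -
      LinearMap.toMatrix (Module.finBasis ℝ V) (Module.finBasis ℝ V) A' i j| ≤ ε) → IsStable A'

/-- Complex conjugation on the complexification `ℂ ⊗ V` of a real vector space. -/
def conjugate : ℂ ⊗[ℝ] V →ₗ[ℝ] ℂ ⊗[ℝ] V :=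
  LinearMap.rTensor V Complex.conjAe.toLinearMap

end LinearAlgebra

/-! ### Symplectic manifolds of dimension `2n` -/

section Symplectic

variable {n : ℕ} {M : Type*} [TopologicalSpace M] [ChartedSpace (EuclideanSpace ℝ (Fin (2 * n))) M]

/-- The expression of a 2-form `η` on `M` in the coordinates of the preferred chart at `x`,
i.e. its pullback under the inverse of that chart. -/
def formInChart (η : (m : M) → TangentSpace (𝓡 (2 * n)) m [⋀^Fin 2]→L[ℝ] ℝ) (x : M)
    (y : EuclideanSpace ℝ (Fin (2 * n))) : EuclideanSpace ℝ (Fin (2 * n)) [⋀^Fin 2]→L[ℝ] ℝ :=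
  (η ((extChartAt (𝓡 (2 * n)) x).symm y)).compContinuousLinearMap
    (mfderiv 𝓘(ℝ, EuclideanSpace ℝ (Fin (2 * n))) (𝓡 (2 * n)) (extChartAt (𝓡 (2 * n)) x).symm y)

variable (n M) in
/-- A symplectic structure: a smooth, closed, non-degenerate 2-form on `M`. -/
structure SymplecticForm where
  form : (m : M) → TangentSpace (𝓡 (2 * n)) m [⋀^Fin 2]→L[ℝ] ℝ
  smooth : ∀ x : M, ContDiffOn ℝ ∞ (formInChart form x) (extChartAt (𝓡 (2 * n)) x).target
  closed : ∀ x : M, ∀ y ∈ (extChartAt (𝓡 (2 * n)) x).target, extDeriv (formInChart form x) y = 0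
  nondegenerate : ∀ (m : M) (y : TangentSpace (𝓡 (2 * n)) m),
    (∀ x : TangentSpace (𝓡 (2 * n)) m, form m ![x, y] = 0) → y = 0

instance (m : M) : FiniteDimensional ℝ (TangentSpace (𝓡 (2 * n)) m) :=
  inferInstanceAs (FiniteDimensional ℝ (EuclideanSpace ℝ (Fin (2 * n))))

namespace SymplecticForm

variable (Ω : SymplecticForm n M)

/-- The bilinear form `(x, y) ↦ Ω(x, y)` on the tangent space at `m`. -/
def bilin (m : M) : LinearMap.BilinForm ℝ (TangentSpace (𝓡 (2 * n)) m) :=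
  have e0 : ∀ x y z : TangentSpace (𝓡 (2 * n)) m, Function.update ![x, y] 0 z = ![z, y] :=
    fun x y z => by funext i; fin_cases i <;> rfl
  have e1 : ∀ x y z : TangentSpace (𝓡 (2 * n)) m, Function.update ![x, y] 1 z = ![x, z] :=
    fun x y z => by funext i; fin_cases i <;> rfl
  LinearMap.mk₂ ℝ (fun x y => Ω.form m ![x, y])
    (fun x x' y => by
      have h := (Ω.form m).map_update_add ![x, y] 0 x x'
      rwa [e0, e0, e0] at h)
    (fun c x y => by
      have h := (Ω.form m).map_update_smul ![x, y] 0 c x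
      rwa [e0, e0] at h)
    (fun x y y' => by
      have h := (Ω.form m).map_update_add ![x, y] 1 y y'
      rwa [e1, e1, e1] at h)
    (fun c x y => by
      have h := (Ω.form m).map_update_smul ![x, y] 1 c y
      rwa [e1, e1] at h)

theorem bilin_self (m : M) (x : TangentSpace (𝓡 (2 * n)) m) : Ω.bilin m x x = 0 :=
  (Ω.form m).map_eq_zero_of_eq ![x, x] (i := 0) (j := 1) rfl (by decide)

theorem bilin_neg (m : M) (x y : TangentSpace (𝓡 (2 * n)) m) :
    -Ω.bilin m x y = Ω.bilin m y x :=
  LinearMap.IsAlt.neg (Ω.bilin_self m) x y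

/-- The map `v ↦ Ω(·, v)` from the tangent to the cotangent space at `m`. -/
def toCotangent (m : M) :
    TangentSpace (𝓡 (2 * n)) m →ₗ[ℝ] Module.Dual ℝ (TangentSpace (𝓡 (2 * n)) m) :=
  (Ω.bilin m).flip

theorem toCotangent_injective (m : M) : Function.Injective (Ω.toCotangent m) := by
  rw [← LinearMap.ker_eq_bot, LinearMap.ker_eq_bot']
  intro y hy
  exact Ω.nondegenerate m y fun x => LinearMap.congr_fun hy x

/-- The isomorphism `J` from the cotangent to the tangent space at `m`,
characterized by `Ω(x, J a) = a(x)`. -/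
def J (m : M) :
    Module.Dual ℝ (TangentSpace (𝓡 (2 * n)) m) ≃ₗ[ℝ] TangentSpace (𝓡 (2 * n)) m :=
  (LinearEquiv.ofInjectiveOfFinrankEq (Ω.toCotangent m) (Ω.toCotangent_injective m)
    Subspace.dual_finrank_eq.symm).symm

theorem bilin_J (m : M) (a : Module.Dual ℝ (TangentSpace (𝓡 (2 * n)) m))
    (x : TangentSpace (𝓡 (2 * n)) m) : Ω.bilin m x (Ω.J m a) = a x :=
  LinearMap.congr_fun ((LinearEquiv.ofInjectiveOfFinrankEq (Ω.toCotangent m)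
    (Ω.toCotangent_injective m) Subspace.dual_finrank_eq.symm).apply_symm_apply a) x

/-- The differential of a function at `m`, as an element of the cotangent space. -/
def _root_.ComplexGerm.differential (F : M → ℝ) (m : M) :
    Module.Dual ℝ (TangentSpace (𝓡 (2 * n)) m) :=
  (mfderiv (𝓡 (2 * n)) 𝓘(ℝ, ℝ) F m).toLinearMap

/-- The Hamiltonian vector field `J dF`. -/
def hamiltonianField (F : M → ℝ) (m : M) : TangentSpace (𝓡 (2 * n)) m :=
  Ω.J m (differential F m)

/-- The Poisson bracket `[F, G] = Ω(J dF, J dG)`. -/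
def poissonBracket (F G : M → ℝ) (m : M) : ℝ :=
  Ω.bilin m (Ω.hamiltonianField F m) (Ω.hamiltonianField G m)

/-- `g` is the global phase flow of the Hamiltonian system with Hamilton function `H`: a smooth
map `(t, m) ↦ g t m` on `ℝ × M` (a one-parameter group of diffeomorphisms) such that `t ↦ g t m` is the solution of `ẋ = J dH(x)` starting
at `m`. -/
structure IsPhaseFlow (H : M → ℝ) (g : ℝ → M → M) : Prop where
  smooth : ContMDiff (𝓘(ℝ, ℝ).prod (𝓡 (2 * n))) (𝓡 (2 * n)) ∞ (fun p : ℝ × M => g p.1 p.2)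
  zero : ∀ m, g 0 m = m
  solution : ∀ m, IsMIntegralCurve (I := 𝓡 (2 * n)) (fun t => g t m) (Ω.hamiltonianField H)

end SymplecticForm

/-- The tangent space at `m` to a submanifold `Λ` of `M`: the velocities at `m` of the smooth
curves of `M` that lie in `Λ`. -/
def tangentTo (Λ : Set M) (m : M) : Submodule ℝ (TangentSpace (𝓡 (2 * n)) m) :=
  Submodule.span ℝ {v | ∃ γ : ℝ → M, ContMDiff 𝓘(ℝ, ℝ) (𝓡 (2 * n)) ∞ γ ∧ (∀ t, γ t ∈ Λ) ∧
    γ 0 = m ∧ mfderiv 𝓘(ℝ, ℝ) (𝓡 (2 * n)) γ 0 (1 : ℝ) = v}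

/-- The tangent space at `m` to the common level set `Σ` of the functions `F j` through `m`:
the common kernel of the differentials (linearly independent where this is used). -/
def levelTangent {k : ℕ} (F : Fin k → M → ℝ) (m : M) : Submodule ℝ (TangentSpace (𝓡 (2 * n)) m) :=
  ⨅ j, LinearMap.ker (differential (F j) m)

/-- `τ` induces a smooth embedding in `M` of the torus `ℝ^k / ℤ^k`
(an injective immersion of a compact manifold is an embedding). -/
structure IsTorusEmbedding {k : ℕ} (τ : (Fin k → ℝ) → M) : Prop where
  smooth : ContMDiff 𝓘(ℝ, Fin k → ℝ) (𝓡 (2 * n)) ∞ τ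
  immersion : ∀ s, Function.Injective (mfderiv 𝓘(ℝ, Fin k → ℝ) (𝓡 (2 * n)) τ s)
  eq_iff : ∀ s t, τ s = τ t ↔ ∃ z : Fin k → ℤ, ∀ i, s i - t i = z i

/-! ### Isotropic tori invariant under Hamilton functions in involution -/

/-- `k < n` Hamilton functions in involution with global phase flows, and an isotropic
`k`-dimensional torus, invariant under these flows, on which their differentials are linearly
independent. -/
structure InvariantTorus (Ω : SymplecticForm n M) (k : ℕ) where
  k_lt_n : k < n
  F : Fin k → M → ℝ
  smooth_F : ∀ j, ContMDiff (𝓡 (2 * n)) 𝓘(ℝ, ℝ) ∞ (F j)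
  involution : ∀ i j m, Ω.poissonBracket (F i) (F j) m = 0
  flow : Fin k → ℝ → M → M
  isPhaseFlow : ∀ j, Ω.IsPhaseFlow (F j) (flow j)
  τ : (Fin k → ℝ) → M
  embedding : IsTorusEmbedding (n := n) τ
  isotropic : ∀ m ∈ Set.range τ, ∀ x ∈ tangentTo (n := n) (Set.range τ) m,
    ∀ y ∈ tangentTo (n := n) (Set.range τ) m, Ω.bilin m x y = 0
  invariant : ∀ j t, flow j t '' Set.range τ = Set.range τ
  independent : ∀ m ∈ Set.range τ, LinearIndependent ℝ fun j => differential (n := n) (F j) m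

namespace InvariantTorus

variable {Ω : SymplecticForm n M} {k : ℕ} (S : InvariantTorus Ω k)

/-- The torus, as a subset of `M`. -/
def torus : Set M := Set.range S.τ

/-- The action `g^t = g_1^{t_1} ∘ ⋯ ∘ g_k^{t_k}` of `t ∈ ℝ^k` on `M`. -/
def action (t : Fin k → ℝ) : M → M :=
  (List.ofFn fun j => S.flow j (t j)).foldr (fun f g => f ∘ g) id

theorem flow_mem (j : Fin k) (t : ℝ) {m : M} (hm : m ∈ S.torus) : S.flow j t m ∈ S.torus := by
  unfold torus at *
  rw [← S.invariant j t]
  exact Set.mem_image_of_mem _ hm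

theorem action_induction {P : (M → M) → Prop} (h_id : P id)
    (h_comp : ∀ f g, P f → P g → P (f ∘ g)) (h_flow : ∀ j t, P (S.flow j t)) (t : Fin k → ℝ) :
    P (S.action t) := by
  have key : ∀ l : List (M → M), (∀ f ∈ l, P f) → P (l.foldr (fun f g => f ∘ g) id) := by
    intro l
    induction l with
    | nil => exact fun _ => h_id
    | cons a l ih =>
      intro h
      exact h_comp a (l.foldr (fun f g => f ∘ g) id) (h a (by simp)) (ih fun f hf => h f (by simp [hf]))
  refine key _ fun f hf => ?_
  obtain ⟨j, rfl⟩ := (List.mem_ofFn' _ _).1 hf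
  exact h_flow j _

theorem action_mem (t : Fin k → ℝ) : ∀ m ∈ S.torus, S.action t m ∈ S.torus :=
  S.action_induction (P := fun f => ∀ m ∈ S.torus, f m ∈ S.torus) (fun _ h => h)
    (fun _ _ hf hg m hm => hf _ (hg m hm)) (fun j t _ hm => S.flow_mem j t hm) t

theorem smooth_action (t : Fin k → ℝ) : ContMDiff (𝓡 (2 * n)) (𝓡 (2 * n)) ∞ (S.action t) :=
  S.action_induction (P := fun f => ContMDiff (𝓡 (2 * n)) (𝓡 (2 * n)) ∞ f) contMDiff_id
    (fun _ _ hf hg => hf.comp hg)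
    (fun j _ => (S.isPhaseFlow j).smooth.comp (contMDiff_const.prodMk contMDiff_id)) t

theorem F_flow (i j : Fin k) (t : ℝ) (m : M) : S.F i (S.flow j t m) = S.F i m := by
  have hd : ∀ t : ℝ, HasDerivAt (fun t => S.F i (S.flow j t m)) 0 t := by
    intro t
    have h1 := (S.isPhaseFlow j).solution m t
    have h2 := ((S.smooth_F i).mdifferentiable (by simp) (S.flow j t m)).hasMFDerivAt
    have h3 : HasFDerivAt (fun t => S.F i (S.flow j t m)) (_ : ℝ →L[ℝ] ℝ) t :=
      (h2.comp t h1).hasFDerivAt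
    have h4 : differential (S.F i) (S.flow j t m) (Ω.hamiltonianField (S.F j) (S.flow j t m))
        = 0 := by
      rw [← Ω.bilin_J]
      exact S.involution j i _
    refine h3.hasDerivAt.congr_deriv ?_
    refine Eq.trans ?_ h4
    exact congrArg (mfderiv (𝓡 (2 * n)) 𝓘(ℝ, ℝ) (S.F i) (S.flow j t m)) (one_smul ℝ _)
  have := is_const_of_deriv_eq_zero (fun t => (hd t).differentiableAt) (fun t => (hd t).deriv) t 0
  simpa [(S.isPhaseFlow j).zero m] using this

theorem F_action (i : Fin k) (t : Fin k → ℝ) : ∀ m, S.F i (S.action t m) = S.F i m :=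
  S.action_induction (P := fun f => ∀ m, S.F i (f m) = S.F i m) (fun _ => rfl)
    (fun _ _ hf hg m => (hf _).trans (hg m)) (fun j t m => S.F_flow i j t m) t

/-- The group `G = {t ∈ ℝ^k : g^t m = m}` is generated by the linearly independent
periods `T_1, …, T_k`. -/
def IsPeriodBasis (m : M) (T : Fin k → Fin k → ℝ) : Prop :=
  LinearIndependent ℝ T ∧
    ∀ t : Fin k → ℝ, S.action t m = m ↔ ∃ l : Fin k → ℤ, t = ∑ j, (l j : ℝ) • T j

theorem IsPeriodBasis.action_eq {S : InvariantTorus Ω k} {m : M} {T : Fin k → Fin k → ℝ}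
    (hT : S.IsPeriodBasis m T) (j : Fin k) : S.action (T j) m = m :=
  (hT.2 _).2 ⟨Pi.single j 1, by
    rw [Finset.sum_eq_single j] <;> simp +contextual⟩

/-- For `t` with `g^t m = m`, the monodromy operator: the derivative of `g^t` at `m`, as an
endomorphism of the tangent space at `m = g^t m`. -/
def monodromy (m : M) (t : Fin k → ℝ) :
    TangentSpace (𝓡 (2 * n)) m →ₗ[ℝ] TangentSpace (𝓡 (2 * n)) m :=
  (mfderiv (𝓡 (2 * n)) (𝓡 (2 * n)) (S.action t) m).toLinearMap

theorem monodromy_levelTangent {m : M} {t : Fin k → ℝ} (ht : S.action t m = m) :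
    levelTangent S.F m ≤ (levelTangent S.F m).comap (S.monodromy m t) := by
  intro v hv
  simp only [levelTangent, Submodule.mem_iInf, Submodule.mem_comap, LinearMap.mem_ker] at hv ⊢
  intro i
  have hF := (S.smooth_F i).mdifferentiable (by simp)
  have hg := (S.smooth_action t).mdifferentiable (by simp)
  have hc : S.F i ∘ S.action t = S.F i := funext (S.F_action i t)
  have h := mfderiv_comp m (hF (S.action t m)) (hg m)
  rw [hc, ht] at h
  refine Eq.trans ?_ (hv i)
  exact (DFunLike.congr_fun h v).symm

theorem monodromy_tangentTo {m : M} {t : Fin k → ℝ} (ht : S.action t m = m) :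
    tangentTo S.torus m ≤ (tangentTo S.torus m).comap (S.monodromy m t) := by
  refine Submodule.span_le.2 ?_
  rintro _ ⟨γ, hγ, hΛ, rfl, rfl⟩
  refine Submodule.subset_span ⟨S.action t ∘ γ, (S.smooth_action t).comp hγ,
    fun u => S.action_mem t _ (hΛ u), ht, ?_⟩
  rw [mfderiv_comp 0 ((S.smooth_action t).mdifferentiable (by simp) (γ 0))
    (hγ.mdifferentiable (by simp) 0)]
  rfl

/-- The real vector space `Γ_m`, the quotient of the tangent space of `Σ` by that of the torus. -/
abbrev Gam (m : M) : Type :=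
  levelTangent (n := n) S.F m ⧸
    (tangentTo (n := n) S.torus m).submoduleOf (levelTangent (n := n) S.F m)

/-- The reduced monodromy operator `[θ] ↦ [g^t_* θ]` of `Γ_m`. -/
def reducedMonodromy (m : M) (t : Fin k → ℝ) (ht : S.action t m = m) : S.Gam m →ₗ[ℝ] S.Gam m :=
  Submodule.mapQ _ _ ((S.monodromy m t).restrict (S.monodromy_levelTangent ht))
    fun _ hv => S.monodromy_tangentTo ht hv

/-- The symplectic form of `Γ_m`, evaluated on representatives (a linear choice of them; the value
does not depend on it, as the tangent space of the torus is orthogonal to that of `Σ`). -/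
def reducedForm (m : M) : LinearMap.BilinForm ℝ (S.Gam m) :=
  let s : S.Gam m →ₗ[ℝ] levelTangent (n := n) S.F m :=
    (LinearMap.exists_rightInverse_of_surjective (Submodule.mkQ
      ((tangentTo (n := n) S.torus m).submoduleOf (levelTangent (n := n) S.F m)))
      (Submodule.range_mkQ _)).choose
  (Ω.bilin m).compl₁₂ (Submodule.subtype _ ∘ₗ s) (Submodule.subtype _ ∘ₗ s)

variable [IsManifold (𝓡 (2 * n)) ∞ M] in
/-- A complex germ on the torus, invariant under the phase flows of all the Hamilton functions. -/
structure IsComplexGerm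
    (r : (m : S.torus) → Submodule ℂ (ℂ ⊗[ℝ] TangentSpace (𝓡 (2 * n)) (m : M))) : Prop where
  /-- Smoothness: `r` is locally spanned by `n` smooth complex vector fields along the torus,
  with real parts `X i` and imaginary parts `Y i`. -/
  smooth : ∀ s₀ : Fin k → ℝ, ∃ U ∈ 𝓝 s₀,
    ∃ X Y : Fin n → (s : Fin k → ℝ) → TangentSpace (𝓡 (2 * n)) (S.τ s),
      (∀ i, ContMDiffOn 𝓘(ℝ, Fin k → ℝ) (𝓡 (2 * n)).tangent ∞
        (fun s => (⟨S.τ s, X i s⟩ : TangentBundle (𝓡 (2 * n)) M)) U) ∧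
      (∀ i, ContMDiffOn 𝓘(ℝ, Fin k → ℝ) (𝓡 (2 * n)).tangent ∞
        (fun s => (⟨S.τ s, Y i s⟩ : TangentBundle (𝓡 (2 * n)) M)) U) ∧
      ∀ s ∈ U, r ⟨S.τ s, Set.mem_range_self s⟩ =
        Submodule.span ℂ (Set.range fun i => (1 : ℂ) ⊗ₜ[ℝ] X i s + Complex.I ⊗ₜ[ℝ] Y i s)
  finrank_eq : ∀ m, Module.finrank ℂ (r m) = n
  isotropic : ∀ m, ∀ x ∈ r m, ∀ y ∈ r m, (Ω.bilin m).baseChange ℂ x y = 0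
  tangent_le : ∀ m : S.torus, (tangentTo (n := n) S.torus (m : M)).baseChange ℂ ≤ r m
  /-- The number `(1/2i)[x, x̄]` is always real. -/
  dissipative : ∀ m : S.torus, ∀ x ∈ r m, x ∉ (tangentTo (n := n) S.torus (m : M)).baseChange ℂ →
    0 < (1 / (2 * Complex.I) * (Ω.bilin m).baseChange ℂ x (conjugate x)).re
  invariant : ∀ j t m,
    (r m).map ((mfderiv (𝓡 (2 * n)) (𝓡 (2 * n)) (S.flow j t) (m : M)).toLinearMap.baseChange ℂ) =
      r ⟨S.flow j t m, S.flow_mem j t m.2⟩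

end InvariantTorus

end Symplectic

end ComplexGerm

end

/-! The proof has a dynamical and a linear half.

Dynamics. The Hamiltonian flows are symplectic and commute, because each of them preserves the other
Hamilton functions. The resulting action of `ℝ^k` is transitive on the torus, since orbits are open
and closed in it (`exists_action_eq`). An invariant germ is therefore determined by its value at
`m`. Conversely, a subspace `r₀` at `m` that is fixed by `dg^t` whenever `g^t m = m` spreads to a
well-defined invariant family. That family is smooth because `t` can be chosen smoothly near each
point of the torus (`exists_local_section`). The pointwise conditions are transported because `dg^t`
preserves the form (`pairing_action`) and the fields `J dF_j`, which span the tangent space of the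
torus (`span_hamiltonianField`).

Reduction. Put `L = T_mΛ`. Since `L` is spanned by the `J dF_j`, its skew-orthogonal complement is
`T_mΣ`. A Lagrangian subspace containing `L` lies in the complexification of this complement, so it
is the preimage of a Lagrangian subspace `R` of the complexified `Γ_m`, and the germ condition
becomes positivity of `(1/2i)[z, z̄]` on all of `R \ 0` (`isGermAt_liftGerm`, `eq_liftGerm`). What
remains is to find the positive Lagrangian subspaces invariant under the reduced monodromy.

Krein theory. A stable symplectic map is diagonalizable over `ℂ` with spectrum on the unit circle
(`PowerBounded.iSup_eigenspace`, `PowerBounded.norm_eigenvalue`). If it is strongly stable, no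
eigenvector satisfies `[z, z̄] = 0`: otherwise an explicit symplectic perturbation would have
linearly growing powers (`IsStronglyStable.eigenvector_definite`). Each eigenspace is then definite.
The sum of the positive ones is Lagrangian, and it is the only positive invariant subspace of half
dimension (`eq_positivePart`). The other reduced monodromy operators commute with this one, so they
carry this subspace to another one of the same kind, that is, to itself (`map_positivePart`). -/

namespace ComplexGerm

section LinearAlgebra

variable {V : Type*} [AddCommGroup V] [Module ℝ V]

/-! ### Real and imaginary parts in a complexification -/

/-- The real part of a vector of the complexification. -/
noncomputable def rePart : ℂ ⊗[ℝ] V →ₗ[ℝ] V :=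
  (TensorProduct.lid ℝ V).toLinearMap ∘ₗ LinearMap.rTensor V Complex.reLm

/-- The imaginary part of a vector of the complexification. -/
noncomputable def imPart : ℂ ⊗[ℝ] V →ₗ[ℝ] V :=
  (TensorProduct.lid ℝ V).toLinearMap ∘ₗ LinearMap.rTensor V Complex.imLm

@[simp] theorem rePart_tmul (c : ℂ) (v : V) : rePart (c ⊗ₜ[ℝ] v) = c.re • v := by
  simp [rePart]

@[simp] theorem imPart_tmul (c : ℂ) (v : V) : imPart (c ⊗ₜ[ℝ] v) = c.im • v := by
  simp [imPart]

theorem rePart_add_imPart (z : ℂ ⊗[ℝ] V) :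
    (1 : ℂ) ⊗ₜ[ℝ] rePart z + Complex.I ⊗ₜ[ℝ] imPart z = z := by
  induction z with
  | zero => simp
  | tmul c v =>
    rw [rePart_tmul, imPart_tmul, ← TensorProduct.smul_tmul, ← TensorProduct.smul_tmul,
      ← TensorProduct.add_tmul]
    congr 1
    apply Complex.ext <;> simp
  | add x y hx hy =>
    nth_rewrite 3 [← hx]
    nth_rewrite 3 [← hy]
    simp only [map_add, TensorProduct.tmul_add]
    abel

theorem complexification_ext {z w : ℂ ⊗[ℝ] V} (h₁ : rePart z = rePart w)
    (h₂ : imPart z = imPart w) : z = w := by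
  rw [← rePart_add_imPart z, ← rePart_add_imPart w, h₁, h₂]

theorem rePart_smul (c : ℂ) (z : ℂ ⊗[ℝ] V) :
    rePart (c • z) = c.re • rePart z - c.im • imPart z := by
  induction z with
  | zero => simp
  | tmul d v => simp [TensorProduct.smul_tmul', sub_smul, mul_smul]
  | add x y hx hy => simp only [smul_add, map_add, hx, hy]; abel

theorem imPart_smul (c : ℂ) (z : ℂ ⊗[ℝ] V) :
    imPart (c • z) = c.re • imPart z + c.im • rePart z := by
  induction z with
  | zero => simp
  | tmul d v => simp [TensorProduct.smul_tmul', add_smul, mul_smul]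
  | add x y hx hy => simp only [smul_add, map_add, hx, hy]; abel

theorem rePart_conjugate (z : ℂ ⊗[ℝ] V) : rePart (conjugate z) = rePart z := by
  induction z with
  | zero => simp
  | tmul d v => simp [conjugate]
  | add x y hx hy => simp only [map_add, hx, hy]

theorem imPart_conjugate (z : ℂ ⊗[ℝ] V) : imPart (conjugate z) = -imPart z := by
  induction z with
  | zero => simp
  | tmul d v => simp [conjugate]
  | add x y hx hy => simp only [map_add, hx, hy]; abel

theorem conjugate_smul (c : ℂ) (z : ℂ ⊗[ℝ] V) :
    conjugate (c • z) = (starRingEnd ℂ c) • conjugate z := by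
  apply complexification_ext <;>
  simp only [rePart_conjugate, imPart_conjugate, rePart_smul, imPart_smul, Complex.conj_re,
    Complex.conj_im] <;> module

theorem conjugate_conjugate (z : ℂ ⊗[ℝ] V) : conjugate (conjugate z) = z := by
  apply complexification_ext <;> simp [rePart_conjugate, imPart_conjugate]

variable {W : Type*} [AddCommGroup W] [Module ℝ W]

theorem rePart_baseChange (A : V →ₗ[ℝ] W) (z : ℂ ⊗[ℝ] V) :
    rePart (A.baseChange ℂ z) = A (rePart z) := by
  induction z with
  | zero => simp
  | tmul d v => simp
  | add x y hx hy => simp only [map_add, hx, hy]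

theorem imPart_baseChange (A : V →ₗ[ℝ] W) (z : ℂ ⊗[ℝ] V) :
    imPart (A.baseChange ℂ z) = A (imPart z) := by
  induction z with
  | zero => simp
  | tmul d v => simp
  | add x y hx hy => simp only [map_add, hx, hy]

theorem conjugate_baseChange (A : V →ₗ[ℝ] W) (z : ℂ ⊗[ℝ] V) :
    conjugate (A.baseChange ℂ z) = A.baseChange ℂ (conjugate z) := by
  apply complexification_ext <;>
  simp [rePart_conjugate, imPart_conjugate, rePart_baseChange, imPart_baseChange]

theorem mem_baseChange_iff (L : Submodule ℝ V) (z : ℂ ⊗[ℝ] V) :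
    z ∈ L.baseChange ℂ ↔ rePart z ∈ L ∧ imPart z ∈ L := by
  constructor
  · intro h
    rw [Submodule.baseChange_eq_span] at h
    induction h using Submodule.span_induction with
    | mem x hx =>
      obtain ⟨v, hv, rfl⟩ := hx
      simpa using hv
    | zero => simp
    | add x y _ _ hx hy =>
      rw [map_add, map_add]
      exact ⟨L.add_mem hx.1 hy.1, L.add_mem hx.2 hy.2⟩
    | smul c x _ hx =>
      rw [rePart_smul, imPart_smul]
      exact ⟨L.sub_mem (L.smul_mem _ hx.1) (L.smul_mem _ hx.2),
        L.add_mem (L.smul_mem _ hx.2) (L.smul_mem _ hx.1)⟩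
  · rintro ⟨h₁, h₂⟩
    rw [← rePart_add_imPart z]
    exact add_mem (Submodule.tmul_mem_baseChange_of_mem _ h₁)
      (Submodule.tmul_mem_baseChange_of_mem _ h₂)

theorem baseChange_form_apply (B : LinearMap.BilinForm ℝ V) (z w : ℂ ⊗[ℝ] V) :
    B.baseChange ℂ z w =
      ((B (rePart z) (rePart w) - B (imPart z) (imPart w) : ℝ) : ℂ) +
      ((B (rePart z) (imPart w) + B (imPart z) (rePart w) : ℝ) : ℂ) * Complex.I := by
  nth_rewrite 1 [← rePart_add_imPart z, ← rePart_add_imPart w]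
  simp only [map_add, LinearMap.add_apply, LinearMap.BilinForm.baseChange_tmul, one_mul, mul_one,
    Complex.I_mul_I]
  apply Complex.ext <;> simp <;> ring

/-- Alternation kills the two diagonal terms and makes the cross terms equal. Hence `(1/2i)[z, z̄]`
is the real number `B (imPart z) (rePart z)`, the form in which positivity is used from here on. -/
theorem baseChange_form_conjugate {B : LinearMap.BilinForm ℝ V} (hB : B.IsAlt) (z : ℂ ⊗[ℝ] V) :
    B.baseChange ℂ z (conjugate z) = ((2 * B (imPart z) (rePart z) : ℝ) : ℂ) * Complex.I := by
  rw [baseChange_form_apply, rePart_conjugate, imPart_conjugate, map_neg, map_neg,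
    hB (rePart z), hB (imPart z), LinearMap.IsAlt.neg hB (rePart z) (imPart z)]
  push_cast
  ring

theorem baseChange_form_conjugate_re {B : LinearMap.BilinForm ℝ V} (hB : B.IsAlt)
    (z : ℂ ⊗[ℝ] V) :
    (1 / (2 * Complex.I) * B.baseChange ℂ z (conjugate z)).re = B (imPart z) (rePart z) := by
  rw [baseChange_form_conjugate hB]
  have : 1 / (2 * Complex.I) * (((2 * B (imPart z) (rePart z) : ℝ) : ℂ) * Complex.I) =
      ((B (imPart z) (rePart z) : ℝ) : ℂ) := by
    push_cast
    field_simp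
  rw [this, Complex.ofReal_re]

theorem baseChange_form_map {B : LinearMap.BilinForm ℝ V} {B' : LinearMap.BilinForm ℝ W}
    {A : V →ₗ[ℝ] W} (hA : ∀ x y, B' (A x) (A y) = B x y) (z w : ℂ ⊗[ℝ] V) :
    B'.baseChange ℂ (A.baseChange ℂ z) (A.baseChange ℂ w) = B.baseChange ℂ z w := by
  simp only [baseChange_form_apply, rePart_baseChange, imPart_baseChange, hA]

theorem baseChange_form_eq_zero {B : LinearMap.BilinForm ℝ V}
    (hB : ∀ x, (∀ y, B x y = 0) → x = 0) (z : ℂ ⊗[ℝ] V)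
    (hz : ∀ w, B.baseChange ℂ z w = 0) : z = 0 := by
  have key : ∀ y, B (rePart z) y = 0 ∧ B (imPart z) y = 0 := by
    intro y
    have h := hz (1 ⊗ₜ y)
    rw [baseChange_form_apply] at h
    have h1 := congrArg Complex.re h
    have h2 := congrArg Complex.im h
    simp at h1 h2
    exact ⟨h1, h2⟩
  apply complexification_ext
  · simpa using hB _ fun y => (key y).1
  · simpa using hB _ fun y => (key y).2

/-! ### Power bounded maps -/

/-- All matrix coefficients of the powers of `A` are bounded. -/
def PowerBounded (A : V →ₗ[ℝ] V) : Prop :=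
  ∀ (v : V) (f : Module.Dual ℝ V), ∃ C, ∀ N : ℕ, |f ((A ^ N) v)| ≤ C

theorem abs_dual_le_coordNorm [FiniteDimensional ℝ V] (f : Module.Dual ℝ V) :
    ∃ C, 0 ≤ C ∧ ∀ v, |f v| ≤ C * coordNorm v := by
  set b := Module.finBasis ℝ V
  refine ⟨∑ i, |f (b i)|, Finset.sum_nonneg fun i _ => abs_nonneg _, fun v => ?_⟩
  have h : f v = ∑ i, b.equivFun v i * f (b i) := by
    conv_lhs => rw [← b.sum_equivFun v, map_sum]
    simp only [map_smul, smul_eq_mul]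
  rw [h, Finset.sum_mul]
  refine (Finset.abs_sum_le_sum_abs _ _).trans (Finset.sum_le_sum fun i _ => ?_)
  rw [abs_mul, mul_comm]
  exact mul_le_mul_of_nonneg_left (norm_le_pi_norm (b.equivFun v) i) (abs_nonneg _)

/-- By linearity, any vector can be scaled into the `δ`-ball, where the orbit stays below `1`, and
scaled back. -/
theorem IsStable.powerBounded [FiniteDimensional ℝ V] {A : V →ₗ[ℝ] V} (hA : IsStable A) :
    PowerBounded A := by
  intro v f
  obtain ⟨δ, hδ, h⟩ := hA 1 one_pos
  obtain ⟨C, hC, hf⟩ := abs_dual_le_coordNorm f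
  have hv : 0 ≤ coordNorm v := norm_nonneg _
  set c : ℝ := δ / (2 * (coordNorm v + 1)) with hc
  have hcpos : 0 < c := by positivity
  have hsmul : ∀ (a : ℝ) (w : V), 0 ≤ a → coordNorm (a • w) = a * coordNorm w := by
    intro a w ha
    simp only [coordNorm, map_smul, norm_smul, Real.norm_of_nonneg ha]
  have hlt : coordNorm (c • v) < δ := by
    rw [hsmul _ _ hcpos.le, hc, div_mul_eq_mul_div, div_lt_iff₀ (by positivity)]
    nlinarith
  -- Stability only speaks of positive powers, so `N = 0` is covered by the first entry of the
  -- maximum.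
  refine ⟨max |f v| (C * (1 / c)), fun N => ?_⟩
  rcases Nat.eq_zero_or_pos N with rfl | hN
  · simp
  · refine le_max_of_le_right ((hf _).trans (mul_le_mul_of_nonneg_left ?_ hC))
    have := h (c • v) hlt N hN
    rw [map_smul, hsmul _ _ hcpos.le] at this
    rw [le_div_iff₀ hcpos]
    linarith

theorem PowerBounded.bilin [FiniteDimensional ℝ V] {A A' : V →ₗ[ℝ] V} (hA : PowerBounded A)
    (hA' : PowerBounded A') (B : LinearMap.BilinForm ℝ V) (v w : V) :
    ∃ C, ∀ N : ℕ, |B ((A ^ N) v) ((A' ^ N) w)| ≤ C := by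
  set b := Module.finBasis ℝ V
  choose C hC using fun i => hA v (B.flip (b i))
  choose D hD using fun i => hA' w (b.coord i)
  refine ⟨∑ i, D i * C i, fun N => ?_⟩
  have h : B ((A ^ N) v) ((A' ^ N) w) =
      ∑ i, b.coord i ((A' ^ N) w) * B ((A ^ N) v) (b i) := by
    conv_lhs => rw [← b.sum_repr ((A' ^ N) w), map_sum]
    simp only [map_smul, smul_eq_mul, Module.Basis.coord_apply]
  rw [h]
  refine (Finset.abs_sum_le_sum_abs _ _).trans (Finset.sum_le_sum fun i _ => ?_)
  rw [abs_mul]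
  exact mul_le_mul (hD i N) (hC i N) (abs_nonneg _) ((abs_nonneg _).trans (hD i 0))

theorem baseChange_pow_apply (A : V →ₗ[ℝ] V) (N : ℕ) (z : ℂ ⊗[ℝ] V) :
    ((A.baseChange ℂ : Module.End ℂ (ℂ ⊗[ℝ] V)) ^ N) z = (A ^ N).baseChange ℂ z := by
  induction N generalizing z with
  | zero => simp
  | succ N ih =>
    rw [pow_succ, pow_succ, Module.End.mul_apply, ih]
    apply complexification_ext <;> simp [rePart_baseChange, imPart_baseChange]

theorem PowerBounded.complex {A : V →ₗ[ℝ] V} (hA : PowerBounded A) (z : ℂ ⊗[ℝ] V)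
    (f : Module.Dual ℂ (ℂ ⊗[ℝ] V)) :
    ∃ C, ∀ N : ℕ, ‖f (((A.baseChange ℂ : Module.End ℂ (ℂ ⊗[ℝ] V)) ^ N) z)‖ ≤ C := by
  have key : ∀ v : V, ∃ C, ∀ N : ℕ, ‖f (1 ⊗ₜ (A ^ N) v)‖ ≤ C := by
    intro v
    set g : V →ₗ[ℝ] ℂ := f.restrictScalars ℝ ∘ₗ TensorProduct.mk ℝ ℂ V 1
    obtain ⟨C, hC⟩ := hA v (Complex.reLm ∘ₗ g)
    obtain ⟨D, hD⟩ := hA v (Complex.imLm ∘ₗ g)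
    exact ⟨C + D, fun N => (Complex.norm_le_abs_re_add_abs_im (g ((A ^ N) v))).trans
      (add_le_add (hC N) (hD N))⟩
  obtain ⟨C, hC⟩ := key (rePart z)
  obtain ⟨D, hD⟩ := key (imPart z)
  refine ⟨C + D, fun N => ?_⟩
  have h : (A ^ N).baseChange ℂ z =
      1 ⊗ₜ (A ^ N) (rePart z) + Complex.I • (1 : ℂ) ⊗ₜ (A ^ N) (imPart z) := by
    rw [← rePart_add_imPart ((A ^ N).baseChange ℂ z), rePart_baseChange, imPart_baseChange,
      TensorProduct.smul_tmul', smul_eq_mul, mul_one]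
  rw [baseChange_pow_apply, h, map_add, map_smul]
  refine (norm_add_le _ _).trans (add_le_add (hC N) ?_)
  rw [norm_smul, Complex.norm_I, one_mul]
  exact hD N

end LinearAlgebra

/-! ### Krein theory: the spectrum of stable and strongly stable symplectic maps -/

section Krein

variable {V : Type*} [AddCommGroup V] [Module ℝ V]

/-- The complexification of an endomorphism, as an endomorphism. -/
noncomputable abbrev complexEnd (A : V →ₗ[ℝ] V) : Module.End ℂ (ℂ ⊗[ℝ] V) :=
  A.baseChange ℂ

/-! ### Eigenvectors of power bounded symplectic maps -/

theorem hasEigenvector_pow {K E : Type*} [Field K] [AddCommGroup E] [Module K E]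
    {f : Module.End K E} {a : K} {x : E} (hx : f x = a • x) (N : ℕ) : (f ^ N) x = a ^ N • x := by
  induction N with
  | zero => simp
  | succ N ih => rw [pow_succ', Module.End.mul_apply, ih, map_smul, hx, smul_smul, pow_succ]

theorem IsSymplecticMap.pow {B : LinearMap.BilinForm ℝ V} {A : V →ₗ[ℝ] V}
    (hA : IsSymplecticMap B A) (N : ℕ) : IsSymplecticMap B (A ^ N) := by
  induction N with
  | zero => intro x y; simp
  | succ N ih => intro x y; rw [pow_succ, Module.End.mul_apply, Module.End.mul_apply, ih, hA]

theorem IsSymplecticMap.mul {B : LinearMap.BilinForm ℝ V} {A A' : V →ₗ[ℝ] V}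
    (hA : IsSymplecticMap B A) (hA' : IsSymplecticMap B A') : IsSymplecticMap B (A * A') := by
  intro x y
  rw [Module.End.mul_apply, Module.End.mul_apply, hA, hA']

/-- An eigenvalue outside the unit disc contradicts boundedness. For one inside, `[x, w] = [A^N x,
A^N w] = a^N [x, A^N w]` tends to `0`, so `x` would lie in the radical of the form. -/
theorem PowerBounded.norm_eigenvalue {A : V →ₗ[ℝ] V} (hA : PowerBounded A)
    {B : LinearMap.BilinForm ℝ V} (hB : ∀ x, (∀ y, B x y = 0) → x = 0)
    (hs : IsSymplecticMap B A) [FiniteDimensional ℝ V] {a : ℂ} {x : ℂ ⊗[ℝ] V}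
    (hx : complexEnd A x = a • x) (hx0 : x ≠ 0) : ‖a‖ = 1 := by
  refine le_antisymm ?_ ?_
  · by_contra! h
    apply hx0
    rw [← Module.forall_dual_apply_eq_zero_iff ℂ]
    intro f
    obtain ⟨C, hC⟩ := hA.complex x f
    by_contra hf
    have hpos : 0 < ‖f x‖ := norm_pos_iff.2 hf
    obtain ⟨N, hN⟩ := pow_unbounded_of_one_lt (C / ‖f x‖) h
    have h1 := hC N
    rw [hasEigenvector_pow hx, map_smul, norm_smul, norm_pow] at h1
    rw [div_lt_iff₀ hpos] at hN
    linarith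
  · by_contra! h
    apply hx0
    apply baseChange_form_eq_zero hB
    intro w
    obtain ⟨C, hC⟩ := hA.complex w (B.baseChange ℂ x)
    have h1 : ∀ N : ℕ, ‖B.baseChange ℂ x w‖ ≤ ‖a‖ ^ N * C := by
      intro N
      rw [← baseChange_form_map (hs.pow N) x w, ← baseChange_pow_apply, ← baseChange_pow_apply,
        hasEigenvector_pow hx, map_smul, LinearMap.smul_apply, norm_smul, norm_pow]
      exact mul_le_mul_of_nonneg_left (hC N) (by positivity)
    have h2 : Filter.Tendsto (fun N : ℕ => ‖a‖ ^ N * C) Filter.atTop (𝓝 (0 * C)) :=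
      (tendsto_pow_atTop_nhds_zero_of_lt_one (norm_nonneg _) h).mul_const C
    rw [zero_mul] at h2
    exact norm_le_zero_iff.1 (ge_of_tendsto' h2 h1)

theorem eq_zero_of_forall_nat_mul_le {a C : ℝ} (h : ∀ N : ℕ, (N : ℝ) * |a| ≤ C) : a = 0 := by
  by_contra ha
  have hpos : 0 < |a| := abs_pos.2 ha
  obtain ⟨N, hN⟩ := exists_nat_gt (C / |a|)
  rw [div_lt_iff₀ hpos] at hN
  linarith [h N]

/-- A Jordan block of size two would make the powers grow linearly: `A^N x = a^N x + N a^(N-1) y`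
with `|a| = 1`. -/
theorem PowerBounded.eigenspace_of_sq {A : V →ₗ[ℝ] V} (hA : PowerBounded A)
    {B : LinearMap.BilinForm ℝ V} (hB : ∀ x, (∀ y, B x y = 0) → x = 0)
    (hs : IsSymplecticMap B A) [FiniteDimensional ℝ V] {a : ℂ} {x y : ℂ ⊗[ℝ] V}
    (hxy : complexEnd A x = a • x + y) (hy : complexEnd A y = a • y) : y = 0 := by
  by_contra hy0
  have ha := hA.norm_eigenvalue hB hs hy hy0
  apply hy0
  rw [← Module.forall_dual_apply_eq_zero_iff ℂ]
  intro f
  -- Multiplying through by `a` avoids the exponent `N - 1`.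
  have hpow : ∀ N : ℕ, a • (complexEnd A ^ N) x = (a ^ (N + 1)) • x + (N * a ^ N : ℂ) • y := by
    intro N
    induction N with
    | zero => simp
    | succ N ih =>
      rw [pow_succ' (complexEnd A), Module.End.mul_apply, ← map_smul, ih, map_add, map_smul,
        map_smul, hxy, hy]
      push_cast
      module
  obtain ⟨C, hC⟩ := hA.complex x f
  have key : ∀ N : ℕ, (N : ℝ) * |‖f y‖| ≤ C + ‖f x‖ := by
    intro N
    have h := congrArg f (hpow N)
    rw [map_add, map_smul, map_smul, map_smul] at h
    have h' : (N * a ^ N : ℂ) • f y = a • f ((complexEnd A ^ N) x) - a ^ (N + 1) • f x := by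
      rw [h]; ring
    have h'' := congrArg norm h'
    rw [norm_smul, norm_mul, norm_pow, ha, one_pow, mul_one, Complex.norm_natCast] at h''
    rw [abs_norm, h'']
    refine (norm_sub_le _ _).trans ?_
    rw [norm_smul, norm_smul, norm_pow, ha, one_pow, one_mul, one_mul]
    exact add_le_add (hC N) le_rfl
  exact norm_eq_zero.1 (eq_zero_of_forall_nat_mul_le key)

theorem PowerBounded.iSup_eigenspace {A : V →ₗ[ℝ] V} (hA : PowerBounded A)
    {B : LinearMap.BilinForm ℝ V} (hB : ∀ x, (∀ y, B x y = 0) → x = 0)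
    (hs : IsSymplecticMap B A) [FiniteDimensional ℝ V] :
    ⨆ a, (complexEnd A).eigenspace a = ⊤ := by
  rw [eq_top_iff, ← Module.End.iSup_maxGenEigenspace_eq_top (complexEnd A)]
  refine iSup_mono fun a x hx => ?_
  rw [Module.End.mem_maxGenEigenspace] at hx
  obtain ⟨N, hN⟩ := hx
  rw [Module.End.eigenspace_def, LinearMap.mem_ker]
  induction N with
  | zero => rw [pow_zero, Module.End.one_apply] at hN; rw [hN, map_zero]
  | succ N ih =>
    rcases N with _ | N
    · simpa using hN
    · refine ih ?_
      -- If `D^(N+2) x = 0`, then `D^N x` and `D^(N+1) x` form a Jordan chain of length two, whose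
      -- last vector vanishes by `eigenspace_of_sq`. Thus one power of `D` can be removed.
      set D : Module.End ℂ (ℂ ⊗[ℝ] V) := complexEnd A - a • 1 with hD
      have hDx : ∀ z, complexEnd A z = a • z + D z := fun z => by simp [hD]
      rw [pow_succ', Module.End.mul_apply]
      refine hA.eigenspace_of_sq hB hs (a := a) (hDx _) ?_
      rw [hDx, ← Module.End.mul_apply, ← Module.End.mul_apply, ← mul_assoc, mul_assoc,
        ← pow_succ', ← pow_succ', hN, add_zero]

/-! ### Definiteness of the eigenspaces of strongly stable maps -/

/-- The operator `v ↦ [v, a] a + [v, b] b`. -/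
noncomputable def rankTwo (B : LinearMap.BilinForm ℝ V) (a b : V) : V →ₗ[ℝ] V :=
  (B.flip a).smulRight a + (B.flip b).smulRight b

theorem rankTwo_apply (B : LinearMap.BilinForm ℝ V) (a b v : V) :
    rankTwo B a b v = B v a • a + B v b • b := rfl

/-- The operator `K = rankTwo B a b` is infinitesimally symplectic, `[Kx, y] + [x, Ky] = 0`. The
quadratic term `[Kx, Ky]` vanishes because `a` and `b` span an isotropic subspace. -/
theorem symplectic_one_add_rankTwo {B : LinearMap.BilinForm ℝ V} (hB : B.IsAlt) {a b : V}
    (hab : B a b = 0) (c : ℝ) : IsSymplecticMap B (1 + c • rankTwo B a b) := by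
  intro x y
  have hba : B b a = 0 := by rw [← LinearMap.IsAlt.neg hB, hab, neg_zero]
  simp only [LinearMap.add_apply, Module.End.one_apply, LinearMap.smul_apply, rankTwo_apply,
    map_add, map_smul, smul_eq_mul, hB a, hB b, hab, hba]
  rw [← LinearMap.IsAlt.neg hB y a, ← LinearMap.IsAlt.neg hB y b]
  ring

theorem rankTwo_rankTwo {B : LinearMap.BilinForm ℝ V} (hB : B.IsAlt) {a b : V}
    (hab : B a b = 0) (v : V) : rankTwo B a b (rankTwo B a b v) = 0 := by
  have hba : B b a = 0 := by rw [← LinearMap.IsAlt.neg hB, hab, neg_zero]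
  simp [rankTwo_apply, hB a, hB b, hab, hba]

/-- `A` acts on the pair `(a, b)` by a rotation, and `[v, a] a + [v, b] b` is unchanged when `(a,
b)` is replaced by a rotated pair. -/
theorem rankTwo_commute {B : LinearMap.BilinForm ℝ V} {A : V →ₗ[ℝ] V}
    (hs : IsSymplecticMap B A) {a b : V} {p q : ℝ} (hpq : p ^ 2 + q ^ 2 = 1)
    (ha : A a = p • a - q • b) (hb : A b = p • b + q • a) :
    Commute A (rankTwo B a b) := by
  refine LinearMap.ext fun v => ?_
  simp only [Module.End.mul_apply, rankTwo_apply, map_add, map_smul]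
  rw [← hs v a, ← hs v b, ha, hb]
  simp only [map_add, map_sub, map_smul, smul_eq_mul]
  have e1 : (p * B (A v) a - q * B (A v) b) • (p • a - q • b) +
      (p * B (A v) b + q * B (A v) a) • (p • b + q • a) =
      ((p ^ 2 + q ^ 2) * B (A v) a) • a + ((p ^ 2 + q ^ 2) * B (A v) b) • b := by module
  rw [e1, hpq, one_mul, one_mul]

/-- Suppose `[x, x̄] = 0`, and let `a`, `b` be the real and imaginary parts of `x`. Then `K =
rankTwo B a b` has square zero and commutes with `A`, so the nearby symplectic map `A (1 + d K)` has
powers `A^N (1 + N d K)`. These are unbounded unless `K = 0`, and `K = 0` forces `x = 0`. -/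
theorem IsStronglyStable.eigenvector_definite [FiniteDimensional ℝ V]
    {B : LinearMap.BilinForm ℝ V} (hB : B.IsAlt) (hB' : ∀ x, (∀ y, B x y = 0) → x = 0)
    {A : V →ₗ[ℝ] V} (hs : IsSymplecticMap B A) (hA : IsStronglyStable B A) {c : ℂ}
    {x : ℂ ⊗[ℝ] V} (hx : complexEnd A x = c • x) (hx0 : x ≠ 0) :
    B (imPart x) (rePart x) ≠ 0 := by
  intro h0
  obtain ⟨hst, ε, hε, hA'⟩ := hA
  have hpb := hst.powerBounded
  have hc := hpb.norm_eigenvalue hB' hs hx hx0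
  set a := rePart x with ha
  set b := imPart x with hb
  have hab : B a b = 0 := by rw [← LinearMap.IsAlt.neg hB, h0, neg_zero]
  have hpq : c.re ^ 2 + c.im ^ 2 = 1 := by
    have := Complex.sq_norm c
    rw [hc, Complex.normSq_apply] at this
    linarith
  have hAa : A a = c.re • a - c.im • b := by
    rw [ha, ← rePart_baseChange, hx, rePart_smul]
  have hAb : A b = c.re • b + c.im • a := by
    rw [hb, ← imPart_baseChange, hx, imPart_smul]
  set K := rankTwo B a b with hK
  have hcomm : Commute A K := rankTwo_commute hs hpq hAa hAb
  set μ := LinearMap.toMatrix (Module.finBasis ℝ V) (Module.finBasis ℝ V) (A * K)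
  set m : ℝ := ∑ i, ∑ j, |μ i j|
  have hm : 0 ≤ m := Finset.sum_nonneg fun i _ => Finset.sum_nonneg fun j _ => abs_nonneg _
  -- With this `d`, every entry of `d • (A * K)` is at most `ε`; the `+ 1` keeps the denominator
  -- positive.
  set d : ℝ := ε / (m + 1)
  have hd : 0 < d := by positivity
  have hsym : IsSymplecticMap B (A * (1 + d • K)) :=
    hs.mul (symplectic_one_add_rankTwo hB hab d)
  have hstab := hA' (A * (1 + d • K)) hsym (by
    intro i j
    have e : A * (1 + d • K) = A + d • (A * K) := by
      rw [mul_add, mul_one, mul_smul_comm]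
    rw [e, map_add, map_smul, Matrix.add_apply, Matrix.smul_apply, smul_eq_mul,
      sub_add_cancel_left, abs_neg, abs_mul, abs_of_pos hd]
    have h1 : |μ i j| ≤ m :=
      (Finset.single_le_sum (f := fun j => |μ i j|) (fun j _ => abs_nonneg _)
        (Finset.mem_univ j)).trans
      (Finset.single_le_sum (f := fun i => ∑ j, |μ i j|)
        (fun i _ => Finset.sum_nonneg fun j _ => abs_nonneg _) (Finset.mem_univ i))
    change d * |μ i j| ≤ ε
    calc d * |μ i j| ≤ d * (m + 1) := by gcongr; linarith
      _ = ε := div_mul_cancel₀ _ (by positivity))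
  have hpb' := hstab.powerBounded
  have hKK : ∀ v, K (K v) = 0 := rankTwo_rankTwo hB hab
  have hpow1 : ∀ (N : ℕ) (v : V), ((1 + d • K) ^ N) v = v + (N * d) • K v := by
    intro N
    induction N with
    | zero => intro v; simp
    | succ N ih =>
      intro v
      rw [pow_succ', Module.End.mul_apply, ih]
      simp only [LinearMap.add_apply, Module.End.one_apply, LinearMap.smul_apply, map_add,
        map_smul, hKK]
      push_cast
      module
  have hcomm' : Commute A (1 + d • K) := (Commute.one_right A).add_right (hcomm.smul_right d)
  -- Pairing the `N`-th power of the perturbed map with `A^N w` cancels `A^N` and leaves `[v, w] + N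
  -- d [Kv, w]`, which has to stay bounded.
  have hKzero : ∀ v w, B (K v) w = 0 := by
    intro v w
    obtain ⟨C, hC⟩ := hpb'.bilin hpb B v w
    have key : ∀ N : ℕ, (N : ℝ) * |d * B (K v) w| ≤ C + |B v w| := by
      intro N
      have h := hC N
      rw [hcomm'.mul_pow, Module.End.mul_apply, hs.pow N, hpow1, map_add, LinearMap.add_apply,
        map_smul, LinearMap.smul_apply, smul_eq_mul, mul_assoc] at h
      calc (N : ℝ) * |d * B (K v) w| = |(N : ℝ) * (d * B (K v) w)| := by
            rw [abs_mul (N : ℝ), Nat.abs_cast]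
        _ = |(B v w + N * (d * B (K v) w)) - B v w| := by rw [add_sub_cancel_left]
        _ ≤ _ := (abs_sub _ _).trans (add_le_add h le_rfl)
    exact (mul_eq_zero.1 (eq_zero_of_forall_nat_mul_le key)).resolve_left hd.ne'
  -- Taking `w = v` gives `[Kv, v] = -([v, a]² + [v, b]²)`.
  have hzero : ∀ v, B v a = 0 ∧ B v b = 0 := by
    intro v
    have h := hKzero v v
    rw [hK, rankTwo_apply, map_add, map_smul, map_smul, LinearMap.add_apply, LinearMap.smul_apply,
      LinearMap.smul_apply, smul_eq_mul, smul_eq_mul, ← LinearMap.IsAlt.neg hB v a,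
      ← LinearMap.IsAlt.neg hB v b] at h
    constructor <;> nlinarith [sq_nonneg (B v a), sq_nonneg (B v b)]
  apply hx0
  apply complexification_ext
  · rw [map_zero]
    exact hB' _ fun y => by rw [← LinearMap.IsAlt.neg hB, (hzero y).1, neg_zero]
  · rw [map_zero]
    exact hB' _ fun y => by rw [← LinearMap.IsAlt.neg hB, (hzero y).2, neg_zero]

end Krein

/-! ### The positive Lagrangian subspace of a definite symplectic map -/

section Lagrangian

variable {V : Type*} [AddCommGroup V] [Module ℝ V]

/-- An isotropic subspace lies in its orthogonal complement, which has complementary dimension. -/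
theorem finrank_isotropic_le {K E : Type*} [Field K] [AddCommGroup E] [Module K E]
    [FiniteDimensional K E] {B : LinearMap.BilinForm K E} (hB : ∀ x, (∀ y, B x y = 0) → x = 0)
    {R : Submodule K E} (hR : ∀ x ∈ R, ∀ y ∈ R, B x y = 0) :
    2 * Module.finrank K R ≤ Module.finrank K E := by
  have h1 := LinearMap.BilinForm.finrank_add_finrank_orthogonal' (B := B) R
  have hker : LinearMap.ker B = ⊥ := by
    rw [LinearMap.ker_eq_bot']
    exact fun x hx => hB x fun y => by rw [hx, LinearMap.zero_apply]
  rw [hker, inf_bot_eq, finrank_bot, add_zero] at h1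
  have h2 : R ≤ B.orthogonal R := fun x hx y hy => hR y hy x hx
  have h3 := Submodule.finrank_mono h2
  omega

theorem conjugate_eigenvector {A : V →ₗ[ℝ] V} {a : ℂ} {x : ℂ ⊗[ℝ] V}
    (hx : complexEnd A x = a • x) :
    complexEnd A (conjugate x) = (starRingEnd ℂ a) • conjugate x := by
  rw [complexEnd, ← conjugate_baseChange, hx, conjugate_smul]

/-- The eigenvalues of the complexification of `A` that have an eigenvector `z` with
`(1/2i)[z, z̄] > 0`. -/
def positiveEigenvalues (B : LinearMap.BilinForm ℝ V) (A : V →ₗ[ℝ] V) : Set ℂ :=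
  {a | ∃ x, complexEnd A x = a • x ∧ 0 < B (imPart x) (rePart x)}

/-- The sum of the eigenspaces of the complexification of `A` on which `(1/2i)[z, z̄]` takes
positive values. -/
noncomputable def positivePart (B : LinearMap.BilinForm ℝ V) (A : V →ₗ[ℝ] V) :
    Submodule ℂ (ℂ ⊗[ℝ] V) :=
  ⨆ a : positiveEigenvalues B A, (complexEnd A).eigenspace a

/-- A symplectic map that is diagonalizable over `ℂ` with eigenvalues on the unit circle, without
eigenvectors `z` such that `[z, z̄] = 0`. -/
structure IsDefinite (B : LinearMap.BilinForm ℝ V) (A : V →ₗ[ℝ] V) : Prop where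
  alt : B.IsAlt
  nondegenerate : ∀ x, (∀ y, B x y = 0) → x = 0
  symplectic : IsSymplecticMap B A
  iSup_eigenspace : ⨆ a, (complexEnd A).eigenspace a = ⊤
  norm_eigenvalue : ∀ (a : ℂ) x, complexEnd A x = a • x → x ≠ 0 → ‖a‖ = 1
  ne_zero : ∀ (a : ℂ) x, complexEnd A x = a • x → x ≠ 0 → B (imPart x) (rePart x) ≠ 0

theorem IsStronglyStable.isDefinite [FiniteDimensional ℝ V]
    {B : LinearMap.BilinForm ℝ V} (hB : B.IsAlt) (hB' : ∀ x, (∀ y, B x y = 0) → x = 0)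
    {A : V →ₗ[ℝ] V} (hs : IsSymplecticMap B A) (hA : IsStronglyStable B A) : IsDefinite B A where
  alt := hB
  nondegenerate := hB'
  symplectic := hs
  iSup_eigenspace := hA.1.powerBounded.iSup_eigenspace hB' hs
  norm_eigenvalue _ _ := hA.1.powerBounded.norm_eigenvalue hB' hs
  ne_zero _ _ := hA.eigenvector_definite hB hB' hs

namespace IsDefinite

variable {B : LinearMap.BilinForm ℝ V} {A : V →ₗ[ℝ] V}

/-- This lets `positivePart (-B) A` serve as the negative part, so that every result on the positive
part applies to it. -/
theorem neg (h : IsDefinite B A) : IsDefinite (-B) A where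
  alt x := by rw [LinearMap.neg_apply, LinearMap.neg_apply, h.alt, neg_zero]
  nondegenerate x hx := h.nondegenerate x fun y => neg_eq_zero.1 (hx y)
  symplectic x y := congrArg Neg.neg (h.symplectic x y)
  iSup_eigenspace := h.iSup_eigenspace
  norm_eigenvalue := h.norm_eigenvalue
  ne_zero a x hx hx0 := by
    rw [LinearMap.neg_apply, LinearMap.neg_apply]
    exact neg_ne_zero.2 (h.ne_zero a x hx hx0)

/-- If the sign changed within one eigenspace, the segment from `x` to `y` would contain a null
vector by the intermediate value theorem. Definiteness forces this vector to be `0`, so `x` and `y`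
are real multiples of each other and cannot have opposite signs. -/
theorem pos_of_pos (h : IsDefinite B A) {a : ℂ} {x y : ℂ ⊗[ℝ] V}
    (hx : complexEnd A x = a • x) (hy : complexEnd A y = a • y)
    (hpos : 0 < B (imPart x) (rePart x)) (hy0 : y ≠ 0) : 0 < B (imPart y) (rePart y) := by
  by_contra! hle
  have hlt : B (imPart y) (rePart y) < 0 := lt_of_le_of_ne hle (h.ne_zero a y hy hy0)
  set z : ℝ → ℂ ⊗[ℝ] V := fun s => ((1 - s : ℝ) : ℂ) • x + (s : ℂ) • y with hz
  set q : ℝ → ℝ := fun s => B (imPart (z s)) (rePart (z s)) with hq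
  have hqs : ∀ s, q s = (1 - s) * ((1 - s) * B (imPart x) (rePart x)) +
      s * ((1 - s) * B (imPart y) (rePart x)) + ((1 - s) * (s * B (imPart x) (rePart y)) +
      s * (s * B (imPart y) (rePart y))) := by
    intro s
    simp only [hq, hz, map_add, rePart_smul, imPart_smul, Complex.ofReal_re, Complex.ofReal_im,
      zero_smul, sub_zero, add_zero, map_smul, LinearMap.add_apply, LinearMap.smul_apply,
      smul_eq_mul]
    ring
  have hcont : Continuous q := by
    rw [funext hqs]
    fun_prop
  have h0 : 0 < q 0 := by rw [hqs]; simpa using hpos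
  have h1 : q 1 < 0 := by rw [hqs]; simpa using hlt
  obtain ⟨s, -, hs⟩ : (0 : ℝ) ∈ q '' Set.Icc 0 1 :=
    intermediate_value_Icc' zero_le_one hcont.continuousOn ⟨h1.le, h0.le⟩
  have hzs : complexEnd A (z s) = a • z s := by
    simp only [hz, map_add, map_smul, hx, hy]
    module
  have hz0 : z s = 0 := by
    by_contra hne
    exact h.ne_zero a _ hzs hne hs
  have hyx : (s : ℂ) • y = ((s - 1 : ℝ) : ℂ) • x := by
    have : ((s - 1 : ℝ) : ℂ) • x + z s = (s : ℂ) • y := by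
      simp only [hz]
      push_cast
      module
    rw [← this, hz0, add_zero]
  have hh : s * (s * B (imPart y) (rePart y)) = (s - 1) * ((s - 1) * B (imPart x) (rePart x)) := by
    have := congrArg (fun w => B (imPart w) (rePart w)) hyx
    simpa only [rePart_smul, imPart_smul, Complex.ofReal_re, Complex.ofReal_im,
      zero_smul, sub_zero, add_zero, map_smul, LinearMap.smul_apply, smul_eq_mul] using this
  have e1 : 0 ≤ s * s := mul_self_nonneg s
  have e2 : 0 ≤ (s - 1) * (s - 1) := mul_self_nonneg _
  have e3 : s * s * B (imPart y) (rePart y) ≤ 0 := mul_nonpos_of_nonneg_of_nonpos e1 hlt.le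
  have e4 : 0 ≤ (s - 1) * (s - 1) * B (imPart x) (rePart x) := mul_nonneg e2 hpos.le
  have e5 : s * s * B (imPart y) (rePart y) = 0 := by linarith
  have e6 : (s - 1) * (s - 1) * B (imPart x) (rePart x) = 0 := by linarith
  have e7 : s = 0 := by simpa [hlt.ne] using e5
  have e8 : s - 1 = 0 := by simpa [hpos.ne'] using e6
  linarith

theorem pos_of_mem (h : IsDefinite B A) {a : ℂ} (ha : a ∈ positiveEigenvalues B A)
    {y : ℂ ⊗[ℝ] V} (hy : complexEnd A y = a • y) (hy0 : y ≠ 0) :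
    0 < B (imPart y) (rePart y) := by
  obtain ⟨x, hx, hpos⟩ := ha
  exact h.pos_of_pos hx hy hpos hy0

theorem norm_of_mem (h : IsDefinite B A) {a : ℂ} (ha : a ∈ positiveEigenvalues B A) :
    ‖a‖ = 1 := by
  obtain ⟨x, hx, hpos⟩ := ha
  refine h.norm_eigenvalue a x hx ?_
  rintro rfl
  simp at hpos

/-- Invariance of the form gives `[x, y] = ab [x, y]`. -/
theorem form_eq_zero (h : IsDefinite B A) {a b : ℂ} {x y : ℂ ⊗[ℝ] V}
    (hx : complexEnd A x = a • x) (hy : complexEnd A y = b • y) (hab : a * b ≠ 1) :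
    B.baseChange ℂ x y = 0 := by
  have h1 := baseChange_form_map (B := B) (B' := B) h.symplectic x y
  rw [show A.baseChange ℂ x = a • x from hx, show A.baseChange ℂ y = b • y from hy, map_smul,
    map_smul, LinearMap.smul_apply, smul_eq_mul, smul_eq_mul] at h1
  have h2 : (a * b - 1) * B.baseChange ℂ x y = 0 := by linear_combination h1
  exact (mul_eq_zero.1 h2).resolve_left (sub_ne_zero.2 hab)

/-- Two positive eigenspaces can pair nontrivially only if `ab = 1`, that is, `a = b̄`. Then the
conjugate of a positive eigenvector for `b` is a negative eigenvector for `a`, although the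
eigenspace of `a` is positive. -/
theorem positivePart_isotropic (h : IsDefinite B A) :
    ∀ x ∈ positivePart B A, ∀ y ∈ positivePart B A, B.baseChange ℂ x y = 0 := by
  intro x hx y hy
  induction hx using Submodule.iSup_induction' with
  | zero => simp
  | add x x' _ _ ihx ihx' => rw [map_add, LinearMap.add_apply, ihx, ihx', add_zero]
  | mem a x hx =>
    induction hy using Submodule.iSup_induction' with
    | zero => simp
    | add x x' _ _ ihx ihx' => rw [map_add, ihx, ihx', add_zero]
    | mem b y hy =>
      rw [Module.End.mem_eigenspace_iff] at hx hy
      by_cases hx0 : x = 0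
      · rw [hx0, map_zero, LinearMap.zero_apply]
      refine h.form_eq_zero hx hy fun hab => ?_
      obtain ⟨z, hz, hpos⟩ := b.2
      have hb : (starRingEnd ℂ (b : ℂ)) = a := by
        have hb1 := h.norm_of_mem b.2
        have hb0 : (b : ℂ) ≠ 0 := fun h0 => by rw [h0, norm_zero] at hb1; exact zero_ne_one hb1
        have := Complex.mul_conj (b : ℂ)
        rw [Complex.normSq_eq_norm_sq, hb1] at this
        apply mul_left_cancel₀ hb0
        rw [this, mul_comm, hab]
        simp
      have hz' := conjugate_eigenvector hz
      rw [hb] at hz'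
      have hz0 : conjugate z ≠ 0 := by
        intro h0
        have := congrArg conjugate h0
        rw [conjugate_conjugate, map_zero] at this
        rw [this] at hpos
        simp at hpos
      have := h.pos_of_mem a.2 hz' hz0
      rw [rePart_conjugate, imPart_conjugate, map_neg, LinearMap.neg_apply] at this
      linarith

/-- Distinct eigenspaces are orthogonal for `[z, w̄]`, because `a b̄ = 1` with `|b| = 1` means `a =
b`. The value on a sum of eigenvectors is therefore the sum of the values. -/
theorem positivePart_pos (h : IsDefinite B A) {x : ℂ ⊗[ℝ] V} (hx : x ∈ positivePart B A)
    (hx0 : x ≠ 0) : 0 < B (imPart x) (rePart x) := by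
  obtain ⟨f, hf, rfl⟩ := (Submodule.mem_iSup_iff_exists_finsupp _ _).1 hx
  simp only [Module.End.mem_eigenspace_iff] at hf
  have hsum : B (imPart (f.sum fun _ z => z)) (rePart (f.sum fun _ z => z)) =
      ∑ a ∈ f.support, B (imPart (f a)) (rePart (f a)) := by
    have key : B.baseChange ℂ (f.sum fun _ z => z) (conjugate (f.sum fun _ z => z)) =
        ∑ a ∈ f.support, B.baseChange ℂ (f a) (conjugate (f a)) := by
      rw [Finsupp.sum, map_sum, map_sum, LinearMap.sum_apply]
      refine Finset.sum_congr rfl fun a ha => ?_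
      rw [map_sum, Finset.sum_eq_single_of_mem a ha]
      intro b _ hba
      refine h.form_eq_zero (hf a) (conjugate_eigenvector (hf b)) fun hab => hba ?_
      have hb1 := h.norm_of_mem b.2
      have hb := Complex.mul_conj (b : ℂ)
      rw [Complex.normSq_eq_norm_sq, hb1] at hb
      have hb0 : starRingEnd ℂ (b : ℂ) ≠ 0 := fun h0 => by
        rw [h0, mul_zero] at hab
        exact zero_ne_one hab
      apply Subtype.ext
      apply mul_right_cancel₀ hb0
      rw [hb, hab]
      simp
    simp only [baseChange_form_conjugate h.alt] at key
    rw [← Finset.sum_mul, mul_left_inj' Complex.I_ne_zero, ← Complex.ofReal_sum,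
      Complex.ofReal_inj, ← Finset.mul_sum] at key
    linarith
  rw [hsum]
  refine Finset.sum_pos (fun a ha => h.pos_of_mem a.2 (hf a) (Finsupp.mem_support_iff.1 ha)) ?_
  rw [Finsupp.support_nonempty_iff]
  rintro rfl
  simp at hx0

theorem mem_positivePart_invariant {x : ℂ ⊗[ℝ] V} (hx : x ∈ positivePart B A) :
    complexEnd A x ∈ positivePart B A := by
  induction hx using Submodule.iSup_induction' with
  | zero => simp
  | add x x' _ _ ihx ihx' => rw [map_add]; exact add_mem ihx ihx'
  | mem a x hx =>
    have hx' := Module.End.mem_eigenspace_iff.1 hx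
    rw [hx']
    exact Submodule.smul_mem _ _ (Submodule.mem_iSup_of_mem a hx)

theorem positivePart_sup_neg (h : IsDefinite B A) :
    positivePart B A ⊔ positivePart (-B) A = ⊤ := by
  rw [eq_top_iff, ← h.iSup_eigenspace]
  refine iSup_le fun a x hx => ?_
  by_cases hx0 : x = 0
  · rw [hx0]; exact zero_mem _
  have hx' := Module.End.mem_eigenspace_iff.1 hx
  rcases lt_or_gt_of_ne (h.ne_zero a x hx' hx0) with hlt | hgt
  · refine Submodule.mem_sup_right (Submodule.mem_iSup_of_mem ⟨a, x, hx', ?_⟩ hx)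
    rw [LinearMap.neg_apply, LinearMap.neg_apply]
    linarith
  · exact Submodule.mem_sup_left (Submodule.mem_iSup_of_mem ⟨a, x, hx', hgt⟩ hx)

/-- The positive and negative parts are isotropic, so neither exceeds half the dimension, and
together they span everything. -/
theorem two_mul_finrank_positivePart [FiniteDimensional ℝ V] (h : IsDefinite B A) :
    2 * Module.finrank ℂ (positivePart B A) = Module.finrank ℝ V := by
  have hE : Module.finrank ℂ (ℂ ⊗[ℝ] V) = Module.finrank ℝ V := Module.finrank_baseChange
  have h1 := finrank_isotropic_le (baseChange_form_eq_zero h.nondegenerate) h.positivePart_isotropic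
  have h2 := finrank_isotropic_le (baseChange_form_eq_zero h.neg.nondegenerate)
    h.neg.positivePart_isotropic
  have h3 := Submodule.finrank_add_le_finrank_add_finrank (positivePart B A) (positivePart (-B) A)
  rw [h.positivePart_sup_neg, finrank_top] at h3
  omega

/-- An invariant subspace of a diagonalizable map is the sum of its intersections with the
eigenspaces. Positivity admits only positive eigenvectors, and equality follows by dimension. -/
theorem eq_positivePart [FiniteDimensional ℝ V] (h : IsDefinite B A)
    {R : Submodule ℂ (ℂ ⊗[ℝ] V)} (hdim : 2 * Module.finrank ℂ R = Module.finrank ℝ V)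
    (hpos : ∀ x ∈ R, x ≠ 0 → 0 < B (imPart x) (rePart x))
    (hinv : ∀ x ∈ R, complexEnd A x ∈ R) : R = positivePart B A := by
  have hle : R ≤ positivePart B A := by
    have h1 := Submodule.inf_iSup_genEigenspace (p := R) (f := complexEnd A) hinv 1
    have h2 : ⨆ a, (complexEnd A).genEigenspace a 1 = ⊤ := h.iSup_eigenspace
    rw [h2, inf_top_eq] at h1
    rw [h1]
    refine iSup_le fun a x hx => ?_
    by_cases hx0 : x = 0
    · rw [hx0]; exact zero_mem _
    have hx' : x ∈ (complexEnd A).eigenspace a := hx.2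
    exact Submodule.mem_iSup_of_mem
      ⟨a, x, Module.End.mem_eigenspace_iff.1 hx', hpos x hx.1 hx0⟩ hx'
  refine Submodule.eq_of_le_of_finrank_eq hle ?_
  have := h.two_mul_finrank_positivePart
  omega

/-- A symplectic map that commutes with `A` preserves the positive part. -/
theorem map_positivePart [FiniteDimensional ℝ V] (h : IsDefinite B A) {C : V →ₗ[ℝ] V}
    (hC : IsSymplecticMap B C) (hAC : ∀ x, C (A x) = A (C x)) :
    (positivePart B A).map (complexEnd C) = positivePart B A := by
  have hinj : Function.Injective (complexEnd C) := by
    rw [← LinearMap.ker_eq_bot, LinearMap.ker_eq_bot']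
    intro z hz
    refine baseChange_form_eq_zero h.nondegenerate z fun w => ?_
    rw [← baseChange_form_map (B := B) (B' := B) hC, show C.baseChange ℂ z = 0 from hz, map_zero,
      LinearMap.zero_apply]
  -- The image has the same dimension, is positive because `C` is symplectic, and is `A`-invariant
  -- because `C` commutes with `A`.
  apply h.eq_positivePart
  · rw [← (Submodule.equivMapOfInjective _ hinj _).finrank_eq, h.two_mul_finrank_positivePart]
  · rintro _ ⟨x, hx, rfl⟩ hx0
    rw [imPart_baseChange, rePart_baseChange, hC]
    exact h.positivePart_pos hx fun h0 => hx0 (by rw [h0, map_zero])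
  · rintro _ ⟨x, hx, rfl⟩
    refine ⟨complexEnd A x, mem_positivePart_invariant hx, ?_⟩
    apply complexification_ext <;>
    simp only [complexEnd, imPart_baseChange, rePart_baseChange, hAC]

end IsDefinite

end Lagrangian

/-! ### Linear symplectic reduction by an isotropic subspace -/

section Reduction

theorem finrank_comap_of_surjective {K E F : Type*} [Field K] [AddCommGroup E] [Module K E]
    [FiniteDimensional K E] [AddCommGroup F] [Module K F] {f : E →ₗ[K] F}
    (hf : Function.Surjective f) (R : Submodule K F) :
    Module.finrank K (R.comap f) = Module.finrank K R + Module.finrank K (LinearMap.ker f) := by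
  have h := LinearMap.finrank_range_add_finrank_ker (f.domRestrict (R.comap f))
  have h1 : LinearMap.range (f.domRestrict (R.comap f)) = R := by
    rw [LinearMap.range_domRestrict, Submodule.map_comap_eq_of_surjective hf]
  have hle : LinearMap.ker f ≤ R.comap f := by
    intro x hx
    rw [Submodule.mem_comap, LinearMap.mem_ker.1 hx]
    exact zero_mem _
  have h2 : Module.finrank K (LinearMap.ker (f.domRestrict (R.comap f))) =
      Module.finrank K (LinearMap.ker f) := by
    rw [LinearMap.ker_domRestrict]
    exact (Submodule.submoduleOfEquivOfLe hle).finrank_eq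
  rw [h1, h2] at h
  exact h.symm

variable {V : Type*} [AddCommGroup V] [Module ℝ V]

/-- The conditions on the value of a complex germ at a point: a complex Lagrangian subspace `r`
that contains `L` and is positive outside of `L`. -/
structure IsGermAt (B : LinearMap.BilinForm ℝ V) (L : Submodule ℝ V)
    (r : Submodule ℂ (ℂ ⊗[ℝ] V)) : Prop where
  two_mul_finrank : 2 * Module.finrank ℂ r = Module.finrank ℝ V
  isotropic : ∀ x ∈ r, ∀ y ∈ r, B.baseChange ℂ x y = 0
  le : L.baseChange ℂ ≤ r
  pos : ∀ x ∈ r, x ∉ L.baseChange ℂ → 0 < B (imPart x) (rePart x)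

/-- `Br` is the form on `N / L` induced by the symplectic form `B`, where `N` is the orthogonal
complement of the isotropic subspace `L`. -/
structure IsReduction (B : LinearMap.BilinForm ℝ V) (L N : Submodule ℝ V)
    (Br : LinearMap.BilinForm ℝ (N ⧸ L.submoduleOf N)) : Prop where
  alt : B.IsAlt
  nondegenerate : ∀ x, (∀ y, B x y = 0) → x = 0
  le : L ≤ N
  mem_iff : ∀ v, v ∈ N ↔ ∀ l ∈ L, B l v = 0
  form : ∀ x y : N, Br (Submodule.Quotient.mk x) (Submodule.Quotient.mk y) = B x y

/-- The preimage in `ℂ ⊗ V` of a subspace of the complexification of `N / L`. -/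
noncomputable def liftGerm {L N : Submodule ℝ V}
    (R : Submodule ℂ (ℂ ⊗[ℝ] (N ⧸ L.submoduleOf N))) : Submodule ℂ (ℂ ⊗[ℝ] V) :=
  (R.comap ((L.submoduleOf N).mkQ.baseChange ℂ)).map (N.subtype.baseChange ℂ)

theorem mkQ_baseChange_surjective (L N : Submodule ℝ V) :
    Function.Surjective ((L.submoduleOf N).mkQ.baseChange ℂ) :=
  LinearMap.lTensor_surjective _ (Submodule.mkQ_surjective _)

theorem subtype_baseChange_injective (N : Submodule ℝ V) :
    Function.Injective (N.subtype.baseChange ℂ) := by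
  intro z w h
  apply complexification_ext
  · apply Subtype.ext
    have := congrArg rePart h
    rwa [rePart_baseChange, rePart_baseChange] at this
  · apply Subtype.ext
    have := congrArg imPart h
    rwa [imPart_baseChange, imPart_baseChange] at this

theorem mem_ker_mkQ_baseChange (L N : Submodule ℝ V) (z : ℂ ⊗[ℝ] N) :
    z ∈ LinearMap.ker ((L.submoduleOf N).mkQ.baseChange ℂ) ↔
      N.subtype.baseChange ℂ z ∈ L.baseChange ℂ := by
  rw [mem_baseChange_iff, rePart_baseChange, imPart_baseChange, LinearMap.mem_ker]
  constructor
  · intro h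
    have h1 := congrArg rePart h
    have h2 := congrArg imPart h
    rw [rePart_baseChange, map_zero, Submodule.mkQ_apply, Submodule.Quotient.mk_eq_zero] at h1
    rw [imPart_baseChange, map_zero, Submodule.mkQ_apply, Submodule.Quotient.mk_eq_zero] at h2
    exact ⟨h1, h2⟩
  · rintro ⟨h1, h2⟩
    apply complexification_ext
    · rw [rePart_baseChange, map_zero, Submodule.mkQ_apply, Submodule.Quotient.mk_eq_zero]
      exact h1
    · rw [imPart_baseChange, map_zero, Submodule.mkQ_apply, Submodule.Quotient.mk_eq_zero]
      exact h2

theorem exists_subtype_baseChange_eq {N : Submodule ℝ V} {z : ℂ ⊗[ℝ] V} (hre : rePart z ∈ N)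
    (him : imPart z ∈ N) : ∃ w, N.subtype.baseChange ℂ w = z := by
  refine ⟨(1 : ℂ) ⊗ₜ ⟨_, hre⟩ + Complex.I ⊗ₜ ⟨_, him⟩, ?_⟩
  rw [map_add, LinearMap.baseChange_tmul, LinearMap.baseChange_tmul]
  exact rePart_add_imPart z

namespace IsReduction

variable {B : LinearMap.BilinForm ℝ V} {L N : Submodule ℝ V}
  {Br : LinearMap.BilinForm ℝ (N ⧸ L.submoduleOf N)}

theorem reduced_alt (h : IsReduction B L N Br) : Br.IsAlt := by
  intro x
  obtain ⟨x, rfl⟩ := Submodule.Quotient.mk_surjective _ x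
  rw [h.form, h.alt]

theorem nondegenerate' (h : IsReduction B L N Br) : B.Nondegenerate :=
  ⟨h.nondegenerate, fun x hx => h.nondegenerate x fun y => by
    rw [← LinearMap.IsAlt.neg h.alt, hx, neg_zero]⟩

theorem orthogonal_eq (h : IsReduction B L N Br) : B.orthogonal L = N := by
  ext v
  rw [h.mem_iff]
  rfl

/-- The radical of the form on `N = L^⊥` is `N ∩ N^⊥`, and `N^⊥ = L^⊥⊥ = L`. -/
theorem reduced_nondegenerate [FiniteDimensional ℝ V] (h : IsReduction B L N Br) :
    ∀ x, (∀ y, Br x y = 0) → x = 0 := by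
  intro x hx
  obtain ⟨x, rfl⟩ := Submodule.Quotient.mk_surjective _ x
  rw [Submodule.Quotient.mk_eq_zero]
  change (x : V) ∈ L
  rw [← LinearMap.BilinForm.orthogonal_orthogonal h.nondegenerate' h.alt.isRefl L, h.orthogonal_eq]
  intro y hy
  have := hx (Submodule.Quotient.mk ⟨y, hy⟩)
  rw [h.form] at this
  exact h.alt.isRefl _ _ this

theorem finrank_add [FiniteDimensional ℝ V] (h : IsReduction B L N Br) :
    Module.finrank ℝ N + Module.finrank ℝ L = Module.finrank ℝ V := by
  have h1 := LinearMap.BilinForm.finrank_orthogonal h.nondegenerate' L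
  rw [h.orthogonal_eq] at h1
  have := Submodule.finrank_le L
  omega

theorem finrank_quotient [FiniteDimensional ℝ V] (h : IsReduction B L N Br) :
    Module.finrank ℝ (N ⧸ L.submoduleOf N) + Module.finrank ℝ L = Module.finrank ℝ N := by
  rw [← (Submodule.submoduleOfEquivOfLe h.le).finrank_eq]
  exact Submodule.finrank_quotient_add_finrank _

theorem finrank_liftGerm [FiniteDimensional ℝ V] (h : IsReduction B L N Br)
    (R : Submodule ℂ (ℂ ⊗[ℝ] (N ⧸ L.submoduleOf N))) :
    Module.finrank ℂ (liftGerm R) = Module.finrank ℂ R + Module.finrank ℝ L := by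
  have hs := mkQ_baseChange_surjective L N
  rw [liftGerm, ← (Submodule.equivMapOfInjective _ (subtype_baseChange_injective N) _).finrank_eq,
    finrank_comap_of_surjective hs]
  have h1 := LinearMap.finrank_range_add_finrank_ker ((L.submoduleOf N).mkQ.baseChange ℂ)
  rw [LinearMap.range_eq_top.2 hs, finrank_top, Module.finrank_baseChange,
    Module.finrank_baseChange] at h1
  have h2 := h.finrank_quotient
  omega

/-- Lifting adds `dim L`, while `dim (N / L) = dim V - 2 dim L`; half-dimensional subspaces thus
correspond to each other. -/
theorem two_mul_finrank_iff [FiniteDimensional ℝ V] (h : IsReduction B L N Br)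
    (R : Submodule ℂ (ℂ ⊗[ℝ] (N ⧸ L.submoduleOf N))) :
    2 * Module.finrank ℂ (liftGerm R) = Module.finrank ℝ V ↔
      2 * Module.finrank ℂ R = Module.finrank ℝ (N ⧸ L.submoduleOf N) := by
  have h1 := h.finrank_liftGerm R
  have h2 := h.finrank_quotient
  have h3 := h.finrank_add
  omega

theorem form_mkQ (h : IsReduction B L N Br) (z w : ℂ ⊗[ℝ] N) :
    Br.baseChange ℂ ((L.submoduleOf N).mkQ.baseChange ℂ z)
      ((L.submoduleOf N).mkQ.baseChange ℂ w) =
    B.baseChange ℂ (N.subtype.baseChange ℂ z) (N.subtype.baseChange ℂ w) := by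
  simp only [baseChange_form_apply, rePart_baseChange, imPart_baseChange, Submodule.mkQ_apply,
    h.form, Submodule.subtype_apply]

theorem form_mkQ_im_re (h : IsReduction B L N Br) (z : ℂ ⊗[ℝ] N) :
    Br (imPart ((L.submoduleOf N).mkQ.baseChange ℂ z))
      (rePart ((L.submoduleOf N).mkQ.baseChange ℂ z)) =
    B (imPart (N.subtype.baseChange ℂ z)) (rePart (N.subtype.baseChange ℂ z)) := by
  simp only [rePart_baseChange, imPart_baseChange, Submodule.mkQ_apply,
    h.form, Submodule.subtype_apply]

theorem isGermAt_liftGerm [FiniteDimensional ℝ V] (h : IsReduction B L N Br)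
    {A : (N ⧸ L.submoduleOf N) →ₗ[ℝ] (N ⧸ L.submoduleOf N)} (hA : IsDefinite Br A) :
    IsGermAt B L (liftGerm (positivePart Br A)) where
  two_mul_finrank := (h.two_mul_finrank_iff _).2 hA.two_mul_finrank_positivePart
  isotropic := by
    rintro _ ⟨z, hz, rfl⟩ _ ⟨w, hw, rfl⟩
    rw [← h.form_mkQ]
    exact hA.positivePart_isotropic _ hz _ hw
  le := by
    intro z hz
    obtain ⟨h1, h2⟩ := (mem_baseChange_iff L z).1 hz
    obtain ⟨w, rfl⟩ := exists_subtype_baseChange_eq (h.le h1) (h.le h2)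
    refine ⟨w, ?_, rfl⟩
    rw [SetLike.mem_coe, Submodule.mem_comap,
      LinearMap.mem_ker.1 ((mem_ker_mkQ_baseChange L N w).2 hz)]
    exact zero_mem _
  pos := by
    rintro _ ⟨z, hz, rfl⟩ hz0
    rw [← h.form_mkQ_im_re]
    exact hA.positivePart_pos hz fun h0 => hz0 ((mem_ker_mkQ_baseChange L N z).1 h0)

/-- An isotropic subspace containing `L` is orthogonal to `L`. Testing against real vectors of `L`
separates real and imaginary parts. -/
theorem mem_of_isGermAt (h : IsReduction B L N Br) {r : Submodule ℂ (ℂ ⊗[ℝ] V)}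
    (hr : IsGermAt B L r) {z : ℂ ⊗[ℝ] V} (hz : z ∈ r) : rePart z ∈ N ∧ imPart z ∈ N := by
  have key : ∀ l ∈ L, B l (rePart z) = 0 ∧ B l (imPart z) = 0 := by
    intro l hl
    have h0 := hr.isotropic (1 ⊗ₜ l) (hr.le (Submodule.tmul_mem_baseChange_of_mem _ hl)) z hz
    rw [baseChange_form_apply] at h0
    have h1 := congrArg Complex.re h0
    have h2 := congrArg Complex.im h0
    simp at h1 h2
    exact ⟨h1, h2⟩
  exact ⟨(h.mem_iff _).2 fun l hl => (key l hl).1, (h.mem_iff _).2 fun l hl => (key l hl).2⟩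

theorem baseChange_mkQ_comm {M : V →ₗ[ℝ] V}
    (hM : ∀ x ∈ N, M x ∈ N) {C : (N ⧸ L.submoduleOf N) →ₗ[ℝ] (N ⧸ L.submoduleOf N)}
    (hC : ∀ x y : N, (y : V) = M x → C (Submodule.Quotient.mk x) = Submodule.Quotient.mk y)
    (z : ℂ ⊗[ℝ] N) : ∃ w : ℂ ⊗[ℝ] N,
      N.subtype.baseChange ℂ w = M.baseChange ℂ (N.subtype.baseChange ℂ z) ∧
      (L.submoduleOf N).mkQ.baseChange ℂ w =
        C.baseChange ℂ ((L.submoduleOf N).mkQ.baseChange ℂ z) := by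
  refine ⟨(M.restrict hM).baseChange ℂ z, ?_, ?_⟩
  · apply complexification_ext <;> simp [rePart_baseChange, imPart_baseChange]
  · apply complexification_ext
    · simp only [rePart_baseChange, Submodule.mkQ_apply]
      exact (hC _ _ rfl).symm
    · simp only [imPart_baseChange, Submodule.mkQ_apply]
      exact (hC _ _ rfl).symm

/-- Since `r` contains the complexification of `L` and lies in that of `N`, it is recovered from its
image `R` in the quotient. This `R` is invariant, positive and half-dimensional, so uniqueness of
the positive part applies. -/
theorem eq_liftGerm [FiniteDimensional ℝ V] (h : IsReduction B L N Br)
    {A : (N ⧸ L.submoduleOf N) →ₗ[ℝ] (N ⧸ L.submoduleOf N)} (hA : IsDefinite Br A)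
    {M : V →ₗ[ℝ] V} (hM : ∀ x ∈ N, M x ∈ N)
    (hAM : ∀ x y : N, (y : V) = M x → A (Submodule.Quotient.mk x) = Submodule.Quotient.mk y)
    {r : Submodule ℂ (ℂ ⊗[ℝ] V)} (hr : IsGermAt B L r) (hinv : ∀ x ∈ r, M.baseChange ℂ x ∈ r) :
    r = liftGerm (positivePart Br A) := by
  set q := (L.submoduleOf N).mkQ.baseChange ℂ with hq
  set ι := N.subtype.baseChange ℂ with hι
  set R := (r.comap ι).map q with hR
  have hker : LinearMap.ker q ≤ r.comap ι := fun z hz =>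
    hr.le ((mem_ker_mkQ_baseChange L N z).1 hz)
  have hcomap : R.comap q = r.comap ι := by
    rw [hR, Submodule.comap_map_eq, sup_eq_left.2 hker]
  have hrange : r ≤ LinearMap.range ι := fun z hz =>
    exists_subtype_baseChange_eq (h.mem_of_isGermAt hr hz).1 (h.mem_of_isGermAt hr hz).2
  have hlift : liftGerm R = r := by
    rw [liftGerm, ← hq, ← hι, hcomap, Submodule.map_comap_eq, inf_eq_right.2 hrange]
  have hRpos : R = positivePart Br A := by
    apply hA.eq_positivePart
    · rw [← h.two_mul_finrank_iff, hlift, hr.two_mul_finrank]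
    · rintro _ ⟨z, hz, rfl⟩ hz0
      rw [h.form_mkQ_im_re]
      exact hr.pos _ hz fun hzL => hz0 ((mem_ker_mkQ_baseChange L N z).2 hzL)
    · rintro _ ⟨z, hz, rfl⟩
      obtain ⟨w, hw1, hw2⟩ := baseChange_mkQ_comm hM hAM z
      refine ⟨w, ?_, hw2⟩
      rw [SetLike.mem_coe, Submodule.mem_comap, hw1]
      exact hinv _ hz
  rw [← hRpos, hlift]

theorem map_liftGerm [FiniteDimensional ℝ V] (h : IsReduction B L N Br)
    {A C : (N ⧸ L.submoduleOf N) →ₗ[ℝ] (N ⧸ L.submoduleOf N)} (hA : IsDefinite Br A)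
    {M : V →ₗ[ℝ] V} (hs : IsSymplecticMap B M) (hM : ∀ x ∈ N, M x ∈ N)
    (hCM : ∀ x y : N, (y : V) = M x → C (Submodule.Quotient.mk x) = Submodule.Quotient.mk y)
    (hAC : ∀ x, C (A x) = A (C x)) :
    ∀ x ∈ liftGerm (positivePart Br A), M.baseChange ℂ x ∈ liftGerm (positivePart Br A) := by
  have hC : IsSymplecticMap Br C := by
    intro x y
    obtain ⟨x, rfl⟩ := Submodule.Quotient.mk_surjective _ x
    obtain ⟨y, rfl⟩ := Submodule.Quotient.mk_surjective _ y
    rw [hCM x ⟨_, hM _ x.2⟩ rfl, hCM y ⟨_, hM _ y.2⟩ rfl, h.form, h.form]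
    exact hs _ _
  rintro _ ⟨z, hz, rfl⟩
  obtain ⟨w, hw1, hw2⟩ := baseChange_mkQ_comm hM hCM z
  refine ⟨w, ?_, hw1⟩
  rw [SetLike.mem_coe, Submodule.mem_comap, hw2, ← hA.map_positivePart hC hAC]
  exact Submodule.mem_map_of_mem hz

end IsReduction

end Reduction

/-! ### Infinitesimal invariance of a closed 2-form under a Hamiltonian flow -/

section Calculus

variable {E : Type*} [NormedAddCommGroup E] [NormedSpace ℝ E]

theorem hasDerivAt_alternating_apply {η : ℝ → E [⋀^Fin 2]→L[ℝ] ℝ} {η' : E [⋀^Fin 2]→L[ℝ] ℝ}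
    {a b : ℝ → E} {a' b' : E} {t : ℝ} (hη : HasDerivAt η η' t) (ha : HasDerivAt a a' t)
    (hb : HasDerivAt b b' t) :
    HasDerivAt (fun t => η t ![a t, b t])
      (η' ![a t, b t] + (η t ![a', b t] + η t ![a t, b'])) t := by
  have hg : ∀ i, HasFDerivAt (fun t => ![a t, b t] i)
      (ContinuousLinearMap.toSpanSingleton ℝ (![a', b'] i)) t := by
    intro i
    fin_cases i
    · exact ha.hasFDerivAt
    · exact hb.hasFDerivAt
  have h := (hη.hasFDerivAt.continuousAlternatingMap_apply hg).hasDerivAt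
  have hvec : (fun i => ![a t, b t] i) = ![a t, b t] := rfl
  have e0 : ∀ z, Function.update ![a t, b t] 0 z = ![z, b t] := fun z => by
    funext i; fin_cases i <;> rfl
  have e1 : ∀ z, Function.update ![a t, b t] 1 z = ![a t, z] := fun z => by
    funext i; fin_cases i <;> rfl
  have h0 : (η t).toContinuousLinearMap ![a t, b t] 0 a' = η t ![a', b t] :=
    congrArg (η t) (e0 a')
  have h1 : (η t).toContinuousLinearMap ![a t, b t] 1 b' = η t ![a t, b'] :=
    congrArg (η t) (e1 b')
  refine HasDerivAt.congr_deriv h ?_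
  simp [hvec, Fin.sum_univ_two, h0, h1]

/-- The form `η` is preserved, to first order, by a flow `φ` that is Hamiltonian for `η`. -/
theorem hasDerivAt_form_flow {η : E → E [⋀^Fin 2]→L[ℝ] ℝ} {y₀ : E}
    (hη : DifferentiableAt ℝ η y₀) (hclosed : extDeriv η y₀ = 0) {H : E → ℝ}
    (hH : ContDiffAt ℝ 2 H y₀) {φ : ℝ × E → E} (hφ : ContDiffAt ℝ 2 φ (0, y₀))
    (hφ0 : ∀ᶠ y in 𝓝 y₀, φ (0, y) = y)
    (hX : ∀ᶠ y in 𝓝 y₀, ∀ w, η y ![w, fderiv ℝ φ (0, y) (1, 0)] = fderiv ℝ H y w) (u v : E) :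
    HasDerivAt (fun t => η (φ (t, y₀)) ![fderiv ℝ φ (t, y₀) (0, u), fderiv ℝ φ (t, y₀) (0, v)])
      0 0 := by
  set X : E → E := fun y => fderiv ℝ φ (0, y) (1, 0) with hXdef
  have hφd : DifferentiableAt ℝ φ (0, y₀) := hφ.differentiableAt (by norm_num)
  have hφ1 : DifferentiableAt ℝ (fderiv ℝ φ) (0, y₀) :=
    (hφ.fderiv_right (m := 1) (by norm_num)).differentiableAt (by norm_num)
  set D2 := fderiv ℝ (fderiv ℝ φ) (0, y₀) with hD2
  have hsymm : ∀ a b, D2 a b = D2 b a := (hφ.isSymmSndFDerivAt (by simp))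
  have hHd : DifferentiableAt ℝ (fderiv ℝ H) y₀ :=
    (hH.fderiv_right (m := 1) (by norm_num)).differentiableAt (by norm_num)
  have hHsymm : ∀ a b, fderiv ℝ (fderiv ℝ H) y₀ a b = fderiv ℝ (fderiv ℝ H) y₀ b a :=
    (hH.isSymmSndFDerivAt (by simp))
  have hline : HasDerivAt (fun t : ℝ => (t, y₀)) ((1 : ℝ), (0 : E)) 0 :=
    (hasDerivAt_id (0 : ℝ)).prodMk (hasDerivAt_const (0 : ℝ) y₀)
  have hvert : ∀ y : E, HasFDerivAt (fun y : E => ((0 : ℝ), y)) (ContinuousLinearMap.inr ℝ ℝ E) y :=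
    fun y => (hasFDerivAt_const (0 : ℝ) y).prodMk (hasFDerivAt_id y)
  have hφ00 : φ (0, y₀) = y₀ := hφ0.self_of_nhds
  have hval : ∀ w, fderiv ℝ φ (0, y₀) (0, w) = w := by
    intro w
    have h1 : HasFDerivAt (fun y => φ (0, y)) _ y₀ :=
      HasFDerivAt.comp y₀ (f := fun y : E => ((0 : ℝ), y)) hφd.hasFDerivAt (hvert y₀)
    have h2 : HasFDerivAt (fun y => φ (0, y)) (ContinuousLinearMap.id ℝ E) y₀ :=
      (hasFDerivAt_id y₀).congr_of_eventuallyEq hφ0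
    exact DFunLike.congr_fun (h1.unique h2) w
  have hp : HasDerivAt (fun t => φ (t, y₀)) (X y₀) 0 :=
    HasFDerivAt.comp_hasDerivAt (0 : ℝ) (f := fun t : ℝ => (t, y₀)) hφd.hasFDerivAt hline
  have ha : ∀ w, HasDerivAt (fun t => fderiv ℝ φ (t, y₀) (0, w)) (D2 (1, 0) (0, w)) 0 := by
    intro w
    have h1 : HasDerivAt (fun t => fderiv ℝ φ (t, y₀)) (D2 (1, 0)) 0 :=
      HasFDerivAt.comp_hasDerivAt (0 : ℝ) (f := fun t : ℝ => (t, y₀)) hφ1.hasFDerivAt hline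
    simpa using h1.clm_apply (hasDerivAt_const (0 : ℝ) ((0 : ℝ), w))
  have hXd : ∀ w, HasDerivAt (fun s : ℝ => X (y₀ + s • w)) (D2 (0, w) (1, 0)) 0 := by
    intro w
    have hl : HasDerivAt (fun s : ℝ => ((0 : ℝ), y₀ + s • w)) ((0 : ℝ), w) 0 :=
      (hasDerivAt_const (0 : ℝ) (0 : ℝ)).prodMk
        (by simpa using ((hasDerivAt_id (0 : ℝ)).smul_const w).const_add y₀)
    have h1 : HasDerivAt (fun s : ℝ => fderiv ℝ φ (0, y₀ + s • w)) (D2 (0, w)) 0 := by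
      refine HasFDerivAt.comp_hasDerivAt (0 : ℝ) (f := fun s : ℝ => ((0 : ℝ), y₀ + s • w)) ?_ hl
      simpa using hφ1.hasFDerivAt
    simpa using h1.clm_apply (hasDerivAt_const (0 : ℝ) ((1 : ℝ), (0 : E)))
  have hlinew : ∀ w, HasDerivAt (fun s : ℝ => y₀ + s • w) w 0 := fun w => by
    simpa using ((hasDerivAt_id (0 : ℝ)).smul_const w).const_add y₀
  -- differentiate `η (z, X) = dH z`
  have key : ∀ w z, fderiv ℝ η y₀ w ![z, X y₀] + η y₀ ![z, D2 (1, 0) (0, w)] =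
      fderiv ℝ (fderiv ℝ H) y₀ w z := by
    intro w z
    have hη' : HasDerivAt (fun s : ℝ => η (y₀ + s • w)) (fderiv ℝ η y₀ w) 0 := by
      refine HasFDerivAt.comp_hasDerivAt (0 : ℝ) (f := fun s : ℝ => y₀ + s • w) ?_ (hlinew w)
      simpa using hη.hasFDerivAt
    have h1 := hasDerivAt_alternating_apply hη' (hasDerivAt_const (0 : ℝ) z) (hXd w)
    have h2 : HasDerivAt (fun s : ℝ => fderiv ℝ H (y₀ + s • w) z)
        (fderiv ℝ (fderiv ℝ H) y₀ w z) 0 := by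
      have h3 : HasDerivAt (fun s : ℝ => fderiv ℝ H (y₀ + s • w)) (fderiv ℝ (fderiv ℝ H) y₀ w) 0 := by
        refine HasFDerivAt.comp_hasDerivAt (0 : ℝ) (f := fun s : ℝ => y₀ + s • w) ?_ (hlinew w)
        simpa using hHd.hasFDerivAt
      simpa using h3.clm_apply (hasDerivAt_const (0 : ℝ) z)
    have hev : (fun s : ℝ => η (y₀ + s • w) ![z, X (y₀ + s • w)]) =ᶠ[𝓝 0]
        fun s : ℝ => fderiv ℝ H (y₀ + s • w) z := by
      have hc : Filter.Tendsto (fun s : ℝ => y₀ + s • w) (𝓝 0) (𝓝 y₀) := by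
        simpa using (hlinew w).continuousAt.tendsto
      filter_upwards [hc.eventually hX] with s hs using hs z
    have h4 := h1.unique (h2.congr_of_eventuallyEq hev)
    -- Symmetry of mixed derivatives: the time derivative of `dφ w` at `t = 0` is the derivative of
    -- the field `X` along `w`.
    rw [← h4, hsymm (1, 0) (0, w)]
    have hzero : η y₀ ![0, X y₀] = 0 := (η y₀).map_coord_zero 0 rfl
    simp [hzero]
  have hswap : ∀ (θ : E [⋀^Fin 2]→L[ℝ] ℝ) (a b : E), θ ![a, b] = -θ ![b, a] := by
    intro θ a b
    have := θ.toAlternatingMap.map_swap ![b, a] (i := 0) (j := 1) (by decide)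
    have e : ![b, a] ∘ Equiv.swap (0 : Fin 2) 1 = ![a, b] := by
      funext i; fin_cases i <;> simp
    rw [e] at this
    exact this
  -- This is `dη (X, u, v) = 0`.
  have hd : fderiv ℝ η y₀ (X y₀) ![u, v] - fderiv ℝ η y₀ u ![X y₀, v] +
      fderiv ℝ η y₀ v ![X y₀, u] = 0 := by
    have h := DFunLike.congr_fun hclosed ![X y₀, u, v]
    rw [extDeriv, ContinuousAlternatingMap.alternatizeUncurryFin_apply, Fin.sum_univ_three] at h
    have e0 : Fin.removeNth 0 ![X y₀, u, v] = ![u, v] := by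
      funext i; fin_cases i <;> rfl
    have e1 : Fin.removeNth 1 ![X y₀, u, v] = ![X y₀, v] := by
      funext i; fin_cases i <;> rfl
    have e2 : Fin.removeNth 2 ![X y₀, u, v] = ![X y₀, u] := by
      funext i; fin_cases i <;> rfl
    rw [e0, e1, e2] at h
    simp at h
    linarith
  have hη0 : HasDerivAt (fun t => η (φ (t, y₀))) (fderiv ℝ η y₀ (X y₀)) 0 := by
    refine HasFDerivAt.comp_hasDerivAt (0 : ℝ) (f := fun t : ℝ => φ (t, y₀)) ?_ hp
    rw [hφ00]
    exact hη.hasFDerivAt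
  have hfin := hasDerivAt_alternating_apply hη0 (ha u) (ha v)
  refine hfin.congr_deriv ?_
  rw [hφ00, hval, hval, hswap (η y₀) (D2 (1, 0) (0, u)) v]
  -- In the difference of the two instances of `key`, the second derivatives of `H` cancel by
  -- symmetry; closedness cancels the derivatives of `η`.
  have k1 := key u v
  have k2 := key v u
  rw [hHsymm] at k1
  rw [hswap (fderiv ℝ η y₀ u) (X y₀) v, hswap (fderiv ℝ η y₀ v) (X y₀) u] at hd
  linarith

end Calculus

/-! ### Phase flows on the manifold: group law and invariance of the symplectic form -/

section Flow

variable {n : ℕ} {M : Type*} [TopologicalSpace M] [ChartedSpace (EuclideanSpace ℝ (Fin (2 * n))) M]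

variable (n) in
/-- The derivative of a self-map of `M`, as an endomorphism of the model space. -/
noncomputable def modelDeriv (f : M → M) (x : M) :
    EuclideanSpace ℝ (Fin (2 * n)) →L[ℝ] EuclideanSpace ℝ (Fin (2 * n)) :=
  mfderiv (𝓡 (2 * n)) (𝓡 (2 * n)) f x

theorem modelDeriv_comp {f g : M → M} (hf : MDifferentiable (𝓡 (2 * n)) (𝓡 (2 * n)) f)
    (hg : MDifferentiable (𝓡 (2 * n)) (𝓡 (2 * n)) g) (x : M) :
    modelDeriv n (f ∘ g) x = (modelDeriv n f (g x)).comp (modelDeriv n g x) :=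
  mfderiv_comp x (hf (g x)) (hg x)

theorem modelDeriv_id (x : M) : modelDeriv n (id : M → M) x = ContinuousLinearMap.id ℝ _ :=
  mfderiv_id

namespace SymplecticForm

variable (Ω : SymplecticForm n M)

/-- The symplectic form at `m`, evaluated on vectors of the model space. -/
noncomputable def pairing (m : M) (a b : EuclideanSpace ℝ (Fin (2 * n))) : ℝ :=
  Ω.form m ![a, b]

/-- The Hamiltonian vector field, with values in the model space. -/
noncomputable def modelField (F : M → ℝ) (m : M) : EuclideanSpace ℝ (Fin (2 * n)) :=
  Ω.hamiltonianField F m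

theorem pairing_modelField (F : M → ℝ) (m : M) (a : EuclideanSpace ℝ (Fin (2 * n))) :
    Ω.pairing m a (Ω.modelField F m) = differential (n := n) F m a :=
  Ω.bilin_J m _ a

end SymplecticForm

namespace SymplecticForm.IsPhaseFlow

variable {Ω : SymplecticForm n M} {H : M → ℝ} {g : ℝ → M → M}

theorem smooth_time (h : Ω.IsPhaseFlow H g) (t : ℝ) : ContMDiff (𝓡 (2 * n)) (𝓡 (2 * n)) ∞ (g t) :=
  h.smooth.comp (contMDiff_const.prodMk contMDiff_id)

theorem mdifferentiable (h : Ω.IsPhaseFlow H g) (t : ℝ) :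
    MDifferentiable (𝓡 (2 * n)) (𝓡 (2 * n)) (g t) :=
  (h.smooth_time t).mdifferentiable (by simp)

theorem mfderiv_apply (h : Ω.IsPhaseFlow H g) (t : ℝ) (x : M) (a : ℝ)
    (v : EuclideanSpace ℝ (Fin (2 * n))) :
    (mfderiv (𝓘(ℝ, ℝ).prod (𝓡 (2 * n))) (𝓡 (2 * n)) (fun p : ℝ × M => g p.1 p.2) (t, x) (a, v) :
      EuclideanSpace ℝ (Fin (2 * n))) =
    a • Ω.modelField H (g t x) + modelDeriv n (g t) x v := by
  refine (mfderiv_prod_eq_add_apply (h.smooth.mdifferentiable (by simp) (t, x))).trans ?_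
  have h1 := (h.solution x t).mfderiv
  refine congrArg₂ _ ?_ rfl
  exact DFunLike.congr_fun h1 a

/-- The field is the time derivative of the smooth flow at `t = 0`: the image of the tangent vector
`(1, 0)` at `(0, x)` under the tangent map. This regularity gives uniqueness of integral curves. -/
theorem smooth_hamiltonianField [IsManifold (𝓡 (2 * n)) ∞ M] (h : Ω.IsPhaseFlow H g) :
    ContMDiff (𝓡 (2 * n)) (𝓡 (2 * n)).tangent 1
      (fun x => (⟨x, Ω.hamiltonianField H x⟩ : TangentBundle (𝓡 (2 * n)) M)) := by
  have h1 : ContMDiff (𝓘(ℝ, ℝ).prod (𝓡 (2 * n))).tangent (𝓡 (2 * n)).tangent 1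
      (tangentMap (𝓘(ℝ, ℝ).prod (𝓡 (2 * n))) (𝓡 (2 * n)) (fun p : ℝ × M => g p.1 p.2)) :=
    h.smooth.contMDiff_tangentMap (by norm_cast)
  have h2 : ContMDiff (𝓡 (2 * n)) (𝓘(ℝ, ℝ).prod (𝓡 (2 * n))).tangent 1
      (fun x : M => (equivTangentBundleProd 𝓘(ℝ, ℝ) ℝ (𝓡 (2 * n)) M).symm
        (⟨0, (1 : ℝ)⟩, Bundle.zeroSection _ _ x)) :=
    contMDiff_equivTangentBundleProd_symm.comp
      (contMDiff_const.prodMk (Bundle.contMDiff_zeroSection ℝ _))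
  refine (h1.comp h2).congr fun x => ?_
  have e := h.mfderiv_apply 0 x 1 0
  rw [map_zero, add_zero, one_smul] at e
  have e2 : (⟨g 0 x, Ω.modelField H (g 0 x)⟩ : TangentBundle (𝓡 (2 * n)) M) =
      ⟨x, Ω.hamiltonianField H x⟩ := by
    rw [h.zero x]
    rfl
  exact e2.symm.trans
    (congrArg (fun v => (⟨g 0 x, v⟩ : TangentBundle (𝓡 (2 * n)) M)) e.symm)

/-- Both sides, as functions of `s`, are integral curves through `g t x`. -/
theorem add [T2Space M] [IsManifold (𝓡 (2 * n)) ∞ M] (h : Ω.IsPhaseFlow H g) (s t : ℝ) (x : M) :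
    g (s + t) x = g s (g t x) := by
  have h1 : IsMIntegralCurve (I := 𝓡 (2 * n)) ((fun s => g s x) ∘ fun s => s + t)
      (Ω.hamiltonianField H) := (h.solution x).comp_add t
  have h2 := isMIntegralCurve_Ioo_eq_of_contMDiff_boundaryless (t₀ := 0)
    h.smooth_hamiltonianField h1 (h.solution (g t x)) (by simp [h.zero])
  exact congrFun h2 s

/-! ### Phase flows are symplectic -/

theorem hasDerivAt_pairing_zero [IsManifold (𝓡 (2 * n)) ∞ M] (h : Ω.IsPhaseFlow H g)
    (hH : ContMDiff (𝓡 (2 * n)) 𝓘(ℝ, ℝ) ∞ H) (x₀ : M)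
    (u v : EuclideanSpace ℝ (Fin (2 * n))) :
    HasDerivAt (fun t => Ω.pairing (g t x₀) (modelDeriv n (g t) x₀ u) (modelDeriv n (g t) x₀ v))
      0 0 := by
  set c := extChartAt (𝓡 (2 * n)) x₀ with hc
  set y₀ := c x₀ with hy₀
  have hopen : IsOpen c.target := isOpen_extChartAt_target x₀
  have hy₀t : y₀ ∈ c.target := mem_extChartAt_target x₀
  have hx₀ : c.symm y₀ = x₀ := extChartAt_to_inv x₀
  have htn : c.target ∈ 𝓝 y₀ := hopen.mem_nhds hy₀t
  have hsymm : ∀ y ∈ c.target, ContMDiffAt 𝓘(ℝ, EuclideanSpace ℝ (Fin (2 * n))) (𝓡 (2 * n)) ∞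
      c.symm y := fun y hy => (contMDiffOn_extChartAt_symm x₀).contMDiffAt (hopen.mem_nhds hy)
  have hchart : ∀ x ∈ c.source, ContMDiffAt (𝓡 (2 * n)) 𝓘(ℝ, EuclideanSpace ℝ (Fin (2 * n))) ∞
      c x := fun x hx => contMDiffAt_extChartAt' (by rwa [hc, extChartAt_source] at hx)
  set φ : ℝ × EuclideanSpace ℝ (Fin (2 * n)) → EuclideanSpace ℝ (Fin (2 * n)) :=
    fun p => c (g p.1 (c.symm p.2)) with hφ
  have hφsmooth : ∀ t : ℝ, ∀ y ∈ c.target, g t (c.symm y) ∈ c.source →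
      ContDiffAt ℝ ∞ φ (t, y) := by
    intro t y hy hgs
    rw [← contMDiffAt_iff_contDiffAt]
    have h1 : ContMDiffAt 𝓘(ℝ, ℝ × EuclideanSpace ℝ (Fin (2 * n)))
        (𝓘(ℝ, ℝ).prod (𝓡 (2 * n))) ∞ (fun p : ℝ × EuclideanSpace ℝ (Fin (2 * n)) =>
          (p.1, c.symm p.2)) (t, y) :=
      contDiff_fst.contMDiff.contMDiffAt.prodMk
        (ContMDiffAt.comp (t, y) (hsymm y hy) contDiff_snd.contMDiff.contMDiffAt)
    exact ContMDiffAt.comp (t, y) (hchart _ hgs)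
      (ContMDiffAt.comp (t, y) (h.smooth.contMDiffAt) h1)
  set S : EuclideanSpace ℝ (Fin (2 * n)) →
      EuclideanSpace ℝ (Fin (2 * n)) →L[ℝ] EuclideanSpace ℝ (Fin (2 * n)) :=
    fun y => mfderiv 𝓘(ℝ, EuclideanSpace ℝ (Fin (2 * n))) (𝓡 (2 * n)) c.symm y with hS
  -- The chain rule for `c.symm ∘ φ = g ∘ (id × c.symm)` identifies the derivative of the coordinate
  -- flow `φ` with that of `g`.
  have hder : ∀ (t : ℝ) y, y ∈ c.target → g t (c.symm y) ∈ c.source →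
      ∀ a w, S (φ (t, y)) (fderiv ℝ φ (t, y) (a, w)) =
        a • Ω.modelField H (g t (c.symm y)) + modelDeriv n (g t) (c.symm y) (S y w) := by
    intro t y hy hgs a w
    have hd : HasMFDerivAt 𝓘(ℝ, ℝ × EuclideanSpace ℝ (Fin (2 * n)))
        𝓘(ℝ, EuclideanSpace ℝ (Fin (2 * n))) φ (t, y) (fderiv ℝ φ (t, y)) :=
      ((hφsmooth t y hy hgs).differentiableAt (by simp)).hasFDerivAt.hasMFDerivAt
    have hs := ((hsymm _ (c.map_source hgs)).mdifferentiableAt (by simp)).hasMFDerivAt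
    have h1 := HasMFDerivAt.comp (t, y) (f := φ) hs hd
    have hfst : HasMFDerivAt 𝓘(ℝ, ℝ × EuclideanSpace ℝ (Fin (2 * n))) 𝓘(ℝ, ℝ)
        (fun p : ℝ × EuclideanSpace ℝ (Fin (2 * n)) => p.1) (t, y)
        (ContinuousLinearMap.fst ℝ ℝ (EuclideanSpace ℝ (Fin (2 * n)))) :=
      hasFDerivAt_fst.hasMFDerivAt
    have hsnd : HasMFDerivAt 𝓘(ℝ, ℝ × EuclideanSpace ℝ (Fin (2 * n)))
        𝓘(ℝ, EuclideanSpace ℝ (Fin (2 * n)))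
        (fun p : ℝ × EuclideanSpace ℝ (Fin (2 * n)) => p.2) (t, y)
        (ContinuousLinearMap.snd ℝ ℝ (EuclideanSpace ℝ (Fin (2 * n)))) :=
      hasFDerivAt_snd.hasMFDerivAt
    have hs' := HasMFDerivAt.comp (t, y)
      (f := fun p : ℝ × EuclideanSpace ℝ (Fin (2 * n)) => p.2)
      ((hsymm y hy).mdifferentiableAt (by simp)).hasMFDerivAt hsnd
    have h2 := HasMFDerivAt.comp (t, y)
      (h.smooth.mdifferentiable (by simp) (t, c.symm y)).hasMFDerivAt (hfst.prodMk hs')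
    have hev : (c.symm ∘ φ) =ᶠ[𝓝 (t, y)]
        (fun p : ℝ × M => g p.1 p.2) ∘
          (fun p : ℝ × EuclideanSpace ℝ (Fin (2 * n)) => (p.1, (c.symm ∘ Prod.snd) p)) := by
      have hcont : ContinuousAt ((fun p : ℝ × M => g p.1 p.2) ∘
          (fun p : ℝ × EuclideanSpace ℝ (Fin (2 * n)) => (p.1, (c.symm ∘ Prod.snd) p))) (t, y) :=
        h2.continuousAt
      filter_upwards [hcont.preimage_mem_nhds ((isOpen_extChartAt_source x₀).mem_nhds hgs)]
        with p hp
      exact c.left_inv hp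
    have h3 := (h2.congr_of_eventuallyEq hev).mfderiv
    rw [h1.mfderiv] at h3
    exact (DFunLike.congr_fun h3 (a, w)).trans (h.mfderiv_apply t (c.symm y) a (S y w))
  have hsource : ∀ y ∈ c.target, g 0 (c.symm y) ∈ c.source := fun y hy => by
    rw [h.zero]; exact c.map_target hy
  have hφ0 : ∀ y ∈ c.target, φ (0, y) = y := fun y hy => by
    simp only [hφ, h.zero]; exact c.right_inv hy
  have hform : ∀ y a b, formInChart Ω.form x₀ y ![a, b] =
      Ω.pairing (c.symm y) (S y a) (S y b) := by
    intro y a b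
    refine congrArg (Ω.form (c.symm y))
      (?_ : (fun i => S y (![a, b] i)) = ![S y a, S y b])
    funext i
    fin_cases i <;> rfl
  have hHc : ∀ y ∈ c.target, ContDiffAt ℝ ∞ (H ∘ c.symm) y := fun y hy => by
    rw [← contMDiffAt_iff_contDiffAt]
    exact ContMDiffAt.comp y hH.contMDiffAt (hsymm y hy)
  have hlem := hasDerivAt_form_flow (η := formInChart Ω.form x₀) (y₀ := y₀) (H := H ∘ c.symm)
    (φ := φ)
    (((Ω.smooth x₀).contDiffAt htn).differentiableAt (by simp)) (Ω.closed x₀ y₀ hy₀t)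
    ((hHc y₀ hy₀t).of_le (by norm_cast))
    ((hφsmooth 0 y₀ hy₀t (hsource y₀ hy₀t)).of_le (by norm_cast))
    (Filter.eventually_of_mem htn hφ0)
    (Filter.eventually_of_mem htn fun y hy w => by
      have e := hder 0 y hy (hsource y hy) 1 0
      rw [map_zero, map_zero, add_zero, one_smul, hφ0 y hy, h.zero] at e
      rw [hform, e, SymplecticForm.pairing_modelField]
      have e1 := HasMFDerivAt.comp y (hH.mdifferentiable (by simp) (c.symm y)).hasMFDerivAt
        ((hsymm y hy).mdifferentiableAt (by simp)).hasMFDerivAt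
      set D : EuclideanSpace ℝ (Fin (2 * n)) →L[ℝ] ℝ :=
        mfderiv (𝓡 (2 * n)) 𝓘(ℝ, ℝ) H (c.symm y) with hD
      have e2 : HasFDerivAt (H ∘ c.symm) (D.comp (S y)) y := e1.hasFDerivAt
      rw [e2.fderiv]
      rfl)
  -- The calculation in the chart concerns vectors of the form `S y₀ u'`; these are all vectors,
  -- because the chart has an invertible derivative.
  have hsurj : ∀ u, ∃ u', S y₀ u' = u := by
    intro u
    refine ⟨mfderiv (𝓡 (2 * n)) 𝓘(ℝ, EuclideanSpace ℝ (Fin (2 * n))) c x₀ u, ?_⟩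
    have e := mfderivWithin_extChartAt_symm_comp_mfderiv_extChartAt (I := 𝓡 (2 * n)) hy₀t
    rw [ModelWithCorners.range_eq_univ, mfderivWithin_univ] at e
    have e' := DFunLike.congr_fun e u
    have hx : ∀ z, z = x₀ → ((mfderiv 𝓘(ℝ, EuclideanSpace ℝ (Fin (2 * n))) (𝓡 (2 * n)) c.symm y₀
        (mfderiv (𝓡 (2 * n)) 𝓘(ℝ, EuclideanSpace ℝ (Fin (2 * n))) c z u :
          EuclideanSpace ℝ (Fin (2 * n)))) : EuclideanSpace ℝ (Fin (2 * n))) =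
        S y₀ (mfderiv (𝓡 (2 * n)) 𝓘(ℝ, EuclideanSpace ℝ (Fin (2 * n))) c x₀ u) := by
      rintro z rfl
      rfl
    exact (hx _ hx₀).symm.trans e'
  obtain ⟨u', rfl⟩ := hsurj u
  obtain ⟨v', rfl⟩ := hsurj v
  refine (hlem u' v').congr_of_eventuallyEq ?_
  have hcont : ContinuousAt (fun t => g t x₀) 0 := (h.solution x₀ 0).continuousAt
  have hmem : c.source ∈ 𝓝 (g 0 x₀) := by
    rw [h.zero]
    exact extChartAt_source_mem_nhds x₀
  filter_upwards [hcont.preimage_mem_nhds hmem] with t ht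
  have ht' : g t (c.symm y₀) ∈ c.source := by rwa [hx₀]
  have e1 := hder t y₀ hy₀t ht' 0 u'
  have e2 := hder t y₀ hy₀t ht' 0 v'
  have e3 : c.symm (φ (t, y₀)) = g t x₀ := by
    simp only [hφ]
    rw [c.left_inv ht', hx₀]
  rw [hform, e1, e2, e3, hx₀]
  simp only [zero_smul, zero_add]

/-- The group law reduces the derivative at time `s` to the derivative at time `0` based at `g s x`,
where it vanishes. -/
theorem pairing_map [T2Space M] [IsManifold (𝓡 (2 * n)) ∞ M] (h : Ω.IsPhaseFlow H g)
    (hH : ContMDiff (𝓡 (2 * n)) 𝓘(ℝ, ℝ) ∞ H) (t : ℝ) (x : M)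
    (u v : EuclideanSpace ℝ (Fin (2 * n))) :
    Ω.pairing (g t x) (modelDeriv n (g t) x u) (modelDeriv n (g t) x v) = Ω.pairing x u v := by
  set f : ℝ → ℝ := fun t =>
    Ω.pairing (g t x) (modelDeriv n (g t) x u) (modelDeriv n (g t) x v) with hf
  have hd : ∀ s, HasDerivAt f 0 s := by
    intro s
    have h0 := h.hasDerivAt_pairing_zero hH (g s x) (modelDeriv n (g s) x u)
      (modelDeriv n (g s) x v)
    have h1 : ∀ t, modelDeriv n (g t) (g s x) ∘L modelDeriv n (g s) x =
        modelDeriv n (g (t + s)) x := by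
      intro t
      rw [← modelDeriv_comp (h.mdifferentiable t) (h.mdifferentiable s)]
      congr 1
      funext y
      exact (h.add t s y).symm
    have h2 : (fun t => Ω.pairing (g t (g s x)) (modelDeriv n (g t) (g s x)
        (modelDeriv n (g s) x u)) (modelDeriv n (g t) (g s x) (modelDeriv n (g s) x v))) =
        fun t => f (t + s) := by
      funext t
      change _ = Ω.pairing (g (t + s) x) (modelDeriv n (g (t + s)) x u)
        (modelDeriv n (g (t + s)) x v)
      rw [← h1, h.add]
      rfl
    rw [h2] at h0
    rw [← sub_self s] at h0
    simpa using h0.comp_sub_const s s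
  have hc := is_const_of_deriv_eq_zero (fun s => (hd s).differentiableAt) (fun s => (hd s).deriv) t 0
  refine hc.trans ?_
  have hid : g 0 = id := funext h.zero
  simp only [hf, hid, modelDeriv_id]
  rfl

theorem modelDeriv_injective [T2Space M] [IsManifold (𝓡 (2 * n)) ∞ M] (h : Ω.IsPhaseFlow H g)
    (t : ℝ) (x : M) : Function.Injective (modelDeriv n (g t) x) := by
  have h1 : (modelDeriv n (g (-t)) (g t x)).comp (modelDeriv n (g t) x) =
      ContinuousLinearMap.id ℝ _ := by
    rw [← modelDeriv_comp (h.mdifferentiable _) (h.mdifferentiable t), ← modelDeriv_id (n := n) x]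
    congr 1
    funext y
    rw [Function.comp_apply, ← h.add, neg_add_cancel, h.zero]
    rfl
  exact Function.LeftInverse.injective fun v => DFunLike.congr_fun h1 v

end SymplecticForm.IsPhaseFlow

end Flow

/-! ### Commuting phase flows and the action they generate -/

section Action

variable {n : ℕ} {M : Type*} [TopologicalSpace M] [ChartedSpace (EuclideanSpace ℝ (Fin (2 * n))) M]

namespace SymplecticForm

theorem pairing_nondegenerate (Ω : SymplecticForm n M) (m : M)
    (a : EuclideanSpace ℝ (Fin (2 * n))) (h : ∀ b, Ω.pairing m b a = 0) : a = 0 :=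
  Ω.nondegenerate m a h

theorem pairing_sub (Ω : SymplecticForm n M) (m : M) (a b c : EuclideanSpace ℝ (Fin (2 * n))) :
    Ω.pairing m a (b - c) = Ω.pairing m a b - Ω.pairing m a c :=
  (Ω.bilin m a).map_sub b c

namespace IsPhaseFlow

variable {Ω : SymplecticForm n M} {H K : M → ℝ} {g f : ℝ → M → M} [T2Space M]
  [IsManifold (𝓡 (2 * n)) ∞ M]

/-- A phase flow preserves the Hamiltonian fields of the functions that it preserves. -/
theorem map_modelField (h : Ω.IsPhaseFlow H g) (hH : ContMDiff (𝓡 (2 * n)) 𝓘(ℝ, ℝ) ∞ H)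
    (hK : ContMDiff (𝓡 (2 * n)) 𝓘(ℝ, ℝ) ∞ K) (hinv : ∀ t x, K (g t x) = K x) (t : ℝ) (x : M) :
    modelDeriv n (g t) x (Ω.modelField K x) = Ω.modelField K (g t x) := by
  rw [← sub_eq_zero]
  refine Ω.pairing_nondegenerate (g t x) _ fun w => ?_
  -- It suffices to pair with vectors `dg_t w`: invariance of the form turns the first pairing into
  -- `dK(w)`, and `K ∘ g_t = K` does the same for the second.
  obtain ⟨w, rfl⟩ := (LinearMap.injective_iff_surjective
    (f := (modelDeriv n (g t) x).toLinearMap)).1 (h.modelDeriv_injective t x) w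
  rw [Ω.pairing_sub, ContinuousLinearMap.coe_coe, h.pairing_map hH, Ω.pairing_modelField,
    Ω.pairing_modelField, sub_eq_zero]
  have h1 := mfderiv_comp x (hK.mdifferentiable (by simp) (g t x)) (h.mdifferentiable t x)
  have h2 : K ∘ g t = K := funext (hinv t)
  rw [h2] at h1
  exact DFunLike.congr_fun h1 w

/-- Since `g t` preserves the Hamiltonian field of `K`, it maps integral curves of that field to
integral curves, and these are unique. -/
theorem commute (h : Ω.IsPhaseFlow H g) (hH : ContMDiff (𝓡 (2 * n)) 𝓘(ℝ, ℝ) ∞ H)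
    (h' : Ω.IsPhaseFlow K f) (hK : ContMDiff (𝓡 (2 * n)) 𝓘(ℝ, ℝ) ∞ K)
    (hinv : ∀ t x, K (g t x) = K x) (s t : ℝ) (x : M) : g t (f s x) = f s (g t x) := by
  have h1 : IsMIntegralCurve (I := 𝓡 (2 * n)) (fun s => g t (f s x)) (Ω.hamiltonianField K) := by
    intro s
    have h2 := HasMFDerivAt.comp s (h.mdifferentiable t (f s x)).hasMFDerivAt (h'.solution x s)
    refine h2.congr_mfderiv ?_
    refine ContinuousLinearMap.ext fun a => ?_
    have h3 := h.map_modelField hH hK hinv t (f s x)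
    exact ((modelDeriv n (g t) (f s x)).map_smul a (Ω.modelField K (f s x))).trans
      (congrArg (fun v : EuclideanSpace ℝ (Fin (2 * n)) => (show ℝ from a) • v) h3)
  have h2 := isMIntegralCurve_Ioo_eq_of_contMDiff_boundaryless (t₀ := 0)
    h'.smooth_hamiltonianField h1 (h'.solution (g t x)) (by simp [h'.zero])
  exact congrFun h2 s

end IsPhaseFlow

end SymplecticForm

/-! ### Compositions of finite families of maps -/

theorem foldr_comp_commute {α : Type*} {l : List (α → α)} {b : α → α}
    (h : ∀ a ∈ l, ∀ x, a (b x) = b (a x)) (x : α) :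
    l.foldr (fun f g => f ∘ g) id (b x) = b (l.foldr (fun f g => f ∘ g) id x) := by
  induction l with
  | nil => rfl
  | cons a l ih =>
    simp only [List.foldr_cons, Function.comp_apply]
    rw [ih fun c hc => h c (List.mem_cons_of_mem _ hc), h a List.mem_cons_self]

theorem foldr_ofFn_comp {α : Type*} {k : ℕ} (a b : Fin k → α → α)
    (h : ∀ i j x, a i (b j x) = b j (a i x)) :
    (List.ofFn fun j => a j ∘ b j).foldr (fun f g => f ∘ g) id =
      (List.ofFn a).foldr (fun f g => f ∘ g) id ∘ (List.ofFn b).foldr (fun f g => f ∘ g) id := by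
  induction k with
  | zero => simp
  | succ k ih =>
    funext x
    simp only [List.ofFn_succ, List.foldr_cons, Function.comp_apply]
    rw [ih (fun j => a j.succ) (fun j => b j.succ) fun i j => h _ _, foldr_comp_commute]
    · rfl
    · intro c hc
      obtain ⟨i, rfl⟩ := (List.mem_ofFn' _ _).1 hc
      exact h _ _

theorem foldr_ofFn_single {α : Type*} {k : ℕ} (a : Fin k → α → α) (j : Fin k)
    (h : ∀ i, i ≠ j → a i = id) : (List.ofFn a).foldr (fun f g => f ∘ g) id = a j := by
  induction k with
  | zero => exact j.elim0
  | succ k ih =>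
    simp only [List.ofFn_succ, List.foldr_cons]
    have hid : ∀ c : Fin k → α → α, (∀ i, c i = id) →
        (List.ofFn c).foldr (fun f g => f ∘ g) id = id := by
      intro c hc
      have : ∀ l : List (α → α), (∀ f ∈ l, f = id) → l.foldr (fun f g => f ∘ g) id = id := by
        intro l
        induction l with
        | nil => intro _; rfl
        | cons f l ih =>
          intro hl
          rw [List.foldr_cons, ih fun g hg => hl g (List.mem_cons_of_mem _ hg),
            hl f List.mem_cons_self]
          rfl
      refine this _ fun f hf => ?_
      obtain ⟨i, rfl⟩ := (List.mem_ofFn' _ _).1 hf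
      exact hc i
    refine Fin.cases (fun h => ?_) (fun j h => ?_) j h
    · rw [hid _ fun i => h _ (Fin.succ_ne_zero i)]
      rfl
    · rw [h 0 (Fin.succ_ne_zero j).symm, ih _ j fun i hi => h _ fun e => hi (Fin.succ_injective _ e)]
      rfl

/-! ### The action of `ℝ^k` -/

namespace InvariantTorus

variable {Ω : SymplecticForm n M} {k : ℕ} (S : InvariantTorus Ω k)

theorem mdifferentiable_action (t : Fin k → ℝ) :
    MDifferentiable (𝓡 (2 * n)) (𝓡 (2 * n)) (S.action t) :=
  (S.smooth_action t).mdifferentiable (by simp)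

theorem smooth_joint_action :
    ContMDiff (𝓘(ℝ, Fin k → ℝ).prod (𝓡 (2 * n))) (𝓡 (2 * n)) ∞
      (fun p : (Fin k → ℝ) × M => S.action p.1 p.2) := by
  -- The induction runs over lists of indices rather than maps, so that the times remain variables.
  have key : ∀ l : List (Fin k), ContMDiff (𝓘(ℝ, Fin k → ℝ).prod (𝓡 (2 * n))) (𝓡 (2 * n)) ∞
      (fun p : (Fin k → ℝ) × M =>
        (l.map fun j => S.flow j (p.1 j)).foldr (fun f g => f ∘ g) id p.2) := by
    intro l
    induction l with
    | nil => exact contMDiff_snd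
    | cons j l ih =>
      have h1 : ContMDiff (𝓘(ℝ, Fin k → ℝ).prod (𝓡 (2 * n))) 𝓘(ℝ, ℝ) ∞
          (fun p : (Fin k → ℝ) × M => p.1 j) :=
        ContMDiff.comp (contDiff_apply ℝ ℝ j).contMDiff contMDiff_fst
      exact (S.isPhaseFlow j).smooth.comp (h1.prodMk ih)
  have h := key (List.finRange k)
  simp only [← List.ofFn_eq_map] at h
  exact h

theorem action_single (j : Fin k) (t : ℝ) : S.action (Pi.single j t) = S.flow j t := by
  unfold action
  rw [foldr_ofFn_single _ j, Pi.single_eq_same]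
  intro i hi
  rw [Pi.single_eq_of_ne hi]
  exact funext (S.isPhaseFlow i).zero

theorem action_zero (x : M) : S.action 0 x = x := by
  have key : ∀ l : List (M → M), (∀ f ∈ l, f = id) → l.foldr (fun f g => f ∘ g) id = id := by
    intro l
    induction l with
    | nil => intro _; rfl
    | cons f l ih =>
      intro hl
      rw [List.foldr_cons, ih fun g hg => hl g (List.mem_cons_of_mem _ hg),
        hl f List.mem_cons_self]
      rfl
  have h := key (List.ofFn fun j => S.flow j 0) fun f hf => by
    obtain ⟨i, rfl⟩ := (List.mem_ofFn' _ _).1 hf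
    exact funext (S.isPhaseFlow i).zero
  exact congrFun h x

theorem modelDeriv_action_zero (x : M) :
    modelDeriv n (S.action 0) x = ContinuousLinearMap.id ℝ _ := by
  rw [← modelDeriv_id (n := n) x]
  congr 1
  exact funext S.action_zero

variable [T2Space M] [IsManifold (𝓡 (2 * n)) ∞ M]

theorem flow_commute (i j : Fin k) (s t : ℝ) (x : M) :
    S.flow i t (S.flow j s x) = S.flow j s (S.flow i t x) :=
  (S.isPhaseFlow i).commute (S.smooth_F i) (S.isPhaseFlow j) (S.smooth_F j)
    (fun t x => S.F_flow j i t x) s t x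

theorem action_add (s t : Fin k → ℝ) (x : M) : S.action (s + t) x = S.action s (S.action t x) := by
  have h : (fun j => S.flow j ((s + t) j)) = fun j => S.flow j (s j) ∘ S.flow j (t j) := by
    funext j x
    exact (S.isPhaseFlow j).add _ _ _
  unfold action
  rw [h, foldr_ofFn_comp (fun j => S.flow j (s j)) (fun j => S.flow j (t j))
    fun i j x => S.flow_commute i j _ _ x]
  rfl

theorem action_neg (t : Fin k → ℝ) (x : M) : S.action (-t) (S.action t x) = x := by
  rw [← S.action_add, neg_add_cancel, S.action_zero]

theorem pairing_action (t : Fin k → ℝ) : ∀ x u v, Ω.pairing (S.action t x)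
    (modelDeriv n (S.action t) x u) (modelDeriv n (S.action t) x v) = Ω.pairing x u v := by
  refine (S.action_induction (P := fun f => MDifferentiable (𝓡 (2 * n)) (𝓡 (2 * n)) f ∧
    ∀ x u v, Ω.pairing (f x) (modelDeriv n f x u) (modelDeriv n f x v) = Ω.pairing x u v)
    ?_ ?_ ?_ t).2
  · refine ⟨mdifferentiable_id, fun x u v => ?_⟩
    rw [modelDeriv_id]
    rfl
  · rintro f g ⟨hf, hf'⟩ ⟨hg, hg'⟩
    refine ⟨hf.comp hg, fun x u v => ?_⟩
    rw [modelDeriv_comp hf hg, Function.comp_apply, ContinuousLinearMap.comp_apply,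
      ContinuousLinearMap.comp_apply, hf', hg']
  · exact fun j t => ⟨(S.isPhaseFlow j).mdifferentiable t,
      (S.isPhaseFlow j).pairing_map (S.smooth_F j) t⟩

theorem modelDeriv_action_modelField (i : Fin k) (t : Fin k → ℝ) :
    ∀ x, modelDeriv n (S.action t) x (Ω.modelField (S.F i) x) =
      Ω.modelField (S.F i) (S.action t x) := by
  refine (S.action_induction (P := fun f => MDifferentiable (𝓡 (2 * n)) (𝓡 (2 * n)) f ∧
    ∀ x, modelDeriv n f x (Ω.modelField (S.F i) x) = Ω.modelField (S.F i) (f x))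
    ?_ ?_ ?_ t).2
  · refine ⟨mdifferentiable_id, fun x => ?_⟩
    rw [modelDeriv_id]
    rfl
  · rintro f g ⟨hf, hf'⟩ ⟨hg, hg'⟩
    refine ⟨hf.comp hg, fun x => ?_⟩
    rw [modelDeriv_comp hf hg, Function.comp_apply, ContinuousLinearMap.comp_apply, hg', hf']
  · exact fun j t => ⟨(S.isPhaseFlow j).mdifferentiable t,
      (S.isPhaseFlow j).map_modelField (S.smooth_F j) (S.smooth_F i) (fun t x => S.F_flow i j t x) t⟩

theorem modelDeriv_action_add (s t : Fin k → ℝ) (x : M) :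
    modelDeriv n (S.action (s + t)) x =
      (modelDeriv n (S.action s) (S.action t x)).comp (modelDeriv n (S.action t) x) := by
  rw [← modelDeriv_comp (S.mdifferentiable_action s) (S.mdifferentiable_action t)]
  congr 1
  funext y
  exact S.action_add s t y

theorem modelDeriv_action_neg (t : Fin k → ℝ) (x : M) (v : EuclideanSpace ℝ (Fin (2 * n))) :
    modelDeriv n (S.action (-t)) (S.action t x) (modelDeriv n (S.action t) x v) = v := by
  have h := S.modelDeriv_action_add (-t) t x
  rw [neg_add_cancel, S.modelDeriv_action_zero] at h
  exact (DFunLike.congr_fun h v).symm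

/-- The derivative of the orbit map of a point. -/
theorem hasMFDerivAt_orbit (x : M) (t : Fin k → ℝ) :
    ∃ D : (Fin k → ℝ) →L[ℝ] EuclideanSpace ℝ (Fin (2 * n)),
      HasMFDerivAt 𝓘(ℝ, Fin k → ℝ) (𝓡 (2 * n)) (fun t => S.action t x) t D ∧
      ∀ v, D v = ∑ j, v j • Ω.modelField (S.F j) (S.action t x) := by
  have hsm : ContMDiff 𝓘(ℝ, Fin k → ℝ) (𝓡 (2 * n)) ∞ (fun t => S.action t x) :=
    S.smooth_joint_action.comp (contMDiff_id.prodMk contMDiff_const)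
  have hd := (hsm.mdifferentiable (by simp) t).hasMFDerivAt
  set D : (Fin k → ℝ) →L[ℝ] EuclideanSpace ℝ (Fin (2 * n)) :=
    mfderiv 𝓘(ℝ, Fin k → ℝ) (𝓡 (2 * n)) (fun t => S.action t x) t with hD
  refine ⟨D, hd, fun v => ?_⟩
  have hj : ∀ j, D (Pi.single j 1) = Ω.modelField (S.F j) (S.action t x) := by
    intro j
    have hl : HasFDerivAt (fun s : ℝ => Pi.single j s + t)
        (ContinuousLinearMap.single ℝ (fun _ : Fin k => ℝ) j) 0 :=
      (ContinuousLinearMap.single ℝ (fun _ : Fin k => ℝ) j).hasFDerivAt.add_const t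
    have hd' : HasMFDerivAt 𝓘(ℝ, Fin k → ℝ) (𝓡 (2 * n)) (fun t => S.action t x)
        (Pi.single j (0 : ℝ) + t) D := by
      rw [Pi.single_zero, zero_add]
      exact hd
    have h1 := HasMFDerivAt.comp (0 : ℝ) hd' hl.hasMFDerivAt
    have h2 := (S.isPhaseFlow j).solution (S.action t x) 0
    -- The derivative along the `j`-th axis at `t` is the velocity of the `j`-th flow started at
    -- `g^t x`.
    have he : (fun s => S.flow j s (S.action t x)) =
        (fun t => S.action t x) ∘ fun s : ℝ => Pi.single j s + t := by
      funext s
      rw [Function.comp_apply, S.action_add, S.action_single]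
    rw [he] at h2
    have h3 := DFunLike.congr_fun (hasMFDerivAt_unique h1 h2) (1 : ℝ)
    have h4 : (1 : ℝ) • Ω.modelField (S.F j) (S.action (Pi.single j (0 : ℝ) + t) x) =
        Ω.modelField (S.F j) (S.action t x) := by
      rw [one_smul, Pi.single_zero, zero_add]
    exact h3.trans h4
  conv_lhs => rw [← Finset.univ_sum_single v]
  rw [map_sum]
  refine Finset.sum_congr rfl fun j _ => ?_
  rw [← hj, ← map_smul, ← Pi.single_smul, smul_eq_mul, mul_one]

end InvariantTorus

end Action

/-! ### Smooth local inverses -/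

theorem exists_equiv_of_injective {F : Type*} [NormedAddCommGroup F] [NormedSpace ℝ F]
    [FiniteDimensional ℝ F] {L : F →L[ℝ] F} (hL : Function.Injective L) :
    ∃ e : F ≃L[ℝ] F, (e : F →L[ℝ] F) = L := by
  refine ⟨(LinearEquiv.ofInjectiveEndo L.toLinearMap hL).toContinuousLinearEquiv, ?_⟩
  ext x
  rfl

/-- The inverse function theorem in finite dimension, with a smooth inverse defined on an open
set. -/
theorem exists_smooth_local_inverse {F : Type*} [NormedAddCommGroup F] [NormedSpace ℝ F]
    [FiniteDimensional ℝ F] {q : F → F} {U : Set F} (hU : IsOpen U) {s₀ : F} (hs₀ : s₀ ∈ U)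
    (hq : ContDiffOn ℝ ∞ q U) (hinj : Function.Injective (fderiv ℝ q s₀)) :
    ∃ (ψ : F → F) (W : Set F), IsOpen W ∧ q s₀ ∈ W ∧ ContDiffOn ℝ ∞ ψ W ∧ ψ (q s₀) = s₀ ∧
      (∀ y ∈ W, ψ y ∈ U ∧ q (ψ y) = y) ∧ ∀ᶠ s in 𝓝 s₀, q s ∈ W ∧ ψ (q s) = s := by
  have : CompleteSpace F := FiniteDimensional.complete ℝ F
  have hqa : ∀ s ∈ U, ContDiffAt ℝ ∞ q s := fun s hs => hq.contDiffAt (hU.mem_nhds hs)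
  obtain ⟨e₀, he₀⟩ := exists_equiv_of_injective hinj
  have hd : HasFDerivAt q (e₀ : F →L[ℝ] F) s₀ := by
    rw [he₀]
    exact ((hqa s₀ hs₀).differentiableAt (by simp)).hasFDerivAt
  set p := (hqa s₀ hs₀).toOpenPartialHomeomorph q hd (by simp) with hp
  have hpq : ∀ s, p s = q s := fun s => rfl
  have hsrc : s₀ ∈ p.source := (hqa s₀ hs₀).mem_toOpenPartialHomeomorph_source hd (by simp)
  -- Restricting to the open set where the derivative is invertible makes the inverse smooth on an
  -- open set, not only at one point.
  set O : Set F := {s ∈ U | fderiv ℝ q s ∈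
    Set.range (ContinuousLinearEquiv.toContinuousLinearMap : (F ≃L[ℝ] F) → F →L[ℝ] F)} with hO
  have hOopen : IsOpen O :=
    (hq.continuousOn_fderiv_of_isOpen hU (by simp)).isOpen_inter_preimage hU
      ContinuousLinearEquiv.isOpen
  have hs₀O : s₀ ∈ O := ⟨hs₀, e₀, he₀⟩
  refine ⟨p.symm, p.target ∩ p.symm ⁻¹' O, p.symm.isOpen_inter_preimage hOopen, ?_, ?_, ?_, ?_, ?_⟩
  · refine ⟨p.map_source hsrc, ?_⟩
    rw [Set.mem_preimage, ← hpq, p.left_inv hsrc]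
    exact hs₀O
  · rintro y ⟨hy, hyU, e, he⟩
    refine (p.contDiffAt_symm (f₀' := e) hy ?_ (hqa _ hyU)).contDiffWithinAt
    rw [he]
    exact ((hqa _ hyU).differentiableAt (by simp)).hasFDerivAt
  · exact p.left_inv hsrc
  · rintro y ⟨hy, hyO⟩
    exact ⟨hyO.1, p.right_inv hy⟩
  · filter_upwards [p.open_source.mem_nhds hsrc, hOopen.mem_nhds hs₀O] with s hs hsO
    refine ⟨⟨p.map_source hs, ?_⟩, p.left_inv hs⟩
    rw [Set.mem_preimage, ← hpq, p.left_inv hs]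
    exact hsO

/-! ### Local retractions onto the embedded torus -/

section Torus

variable {n : ℕ} {M : Type*} [TopologicalSpace M] [ChartedSpace (EuclideanSpace ℝ (Fin (2 * n))) M]

namespace IsTorusEmbedding

variable {k : ℕ} {τ : (Fin k → ℝ) → M}

theorem mdifferentiable (hτ : IsTorusEmbedding (n := n) τ) :
    MDifferentiable 𝓘(ℝ, Fin k → ℝ) (𝓡 (2 * n)) τ :=
  hτ.smooth.mdifferentiable (by simp)

/-- Points of the torus close to `τ s₀` are images of points close to `s₀`. -/
theorem eventually_mem_image [T2Space M] (hτ : IsTorusEmbedding (n := n) τ) (s₀ : Fin k → ℝ)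
    {U : Set (Fin k → ℝ)} (hU : U ∈ 𝓝 s₀) :
    ∀ᶠ x in 𝓝 (τ s₀), x ∈ Set.range τ → ∃ s ∈ U, τ s = x := by
  -- With radius `1/2` in the sup norm, the ball meets every class modulo `ℤ^k` (by rounding), yet
  -- contains only `s₀` from the class of `s₀`. Hence the compact image of `C` avoids `τ s₀`.
  set C : Set (Fin k → ℝ) := Metric.closedBall s₀ (1 / 2) \ interior U with hC
  have hCc : IsCompact C := (isCompact_closedBall s₀ (1 / 2)).diff isOpen_interior
  have hclosed : IsClosed (τ '' C) := (hCc.image hτ.smooth.continuous).isClosed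
  have hmem : τ s₀ ∈ (τ '' C)ᶜ := by
    rintro ⟨s, ⟨hs, hsU⟩, he⟩
    obtain ⟨z, hz⟩ := (hτ.eq_iff s s₀).1 he
    have hs0 : s = s₀ := by
      funext i
      have h1 : |s i - s₀ i| ≤ 1 / 2 := by
        rw [← Real.dist_eq]
        exact (dist_le_pi_dist s s₀ i).trans hs
      rw [hz i] at h1
      have h2 : |z i| < 1 := by
        have : (|z i| : ℝ) < 1 := by linarith
        exact_mod_cast this
      have h3 : z i = 0 := Int.abs_lt_one_iff.1 h2
      have h4 := hz i
      rw [h3, Int.cast_zero] at h4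
      linarith
    rw [hs0] at hsU
    exact hsU (mem_interior_iff_mem_nhds.2 hU)
  filter_upwards [hclosed.isOpen_compl.mem_nhds hmem]
  rintro x hx ⟨s, rfl⟩
  set s' : Fin k → ℝ := fun i => s i - round (s i - s₀ i) with hs'
  have he : τ s' = τ s := (hτ.eq_iff _ _).2 ⟨fun i => -round (s i - s₀ i), fun i => by
    simp [hs']⟩
  have hball : s' ∈ Metric.closedBall s₀ (1 / 2) := by
    rw [Metric.mem_closedBall, dist_pi_le_iff (by norm_num)]
    intro i
    rw [Real.dist_eq]
    have h1 : s' i - s₀ i = s i - s₀ i - round (s i - s₀ i) := sub_right_comm _ _ _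
    rw [h1]
    exact abs_sub_round _
  refine ⟨s', ?_, he⟩
  by_contra hsU
  exact hx ⟨s', ⟨hball, fun h => hsU (interior_subset h)⟩, he⟩

/-- A smooth local retraction onto the torus, in the coordinates of the torus. -/
theorem exists_retraction [T2Space M] [IsManifold (𝓡 (2 * n)) ∞ M]
    (hτ : IsTorusEmbedding (n := n) τ) (s₀ : Fin k → ℝ) :
    ∃ (π : M → Fin k → ℝ) (N : Set M), IsOpen N ∧ τ s₀ ∈ N ∧
      ContMDiffOn (𝓡 (2 * n)) 𝓘(ℝ, Fin k → ℝ) ∞ π N ∧ π (τ s₀) = s₀ ∧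
      ∀ x ∈ N, x ∈ Set.range τ → τ (π x) = x := by
  set c := extChartAt (𝓡 (2 * n)) (τ s₀) with hc
  have hsrcopen : IsOpen c.source := isOpen_extChartAt_source (τ s₀)
  have hchart : ∀ x ∈ c.source, ContMDiffAt (𝓡 (2 * n)) 𝓘(ℝ, EuclideanSpace ℝ (Fin (2 * n))) ∞
      c x := fun x hx => contMDiffAt_extChartAt' (by rwa [hc, extChartAt_source] at hx)
  have hx₀ : τ s₀ ∈ c.source := mem_extChartAt_source (τ s₀)
  set U : Set (Fin k → ℝ) := τ ⁻¹' c.source with hU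
  have hUopen : IsOpen U := hsrcopen.preimage hτ.smooth.continuous
  set f : (Fin k → ℝ) → EuclideanSpace ℝ (Fin (2 * n)) := c ∘ τ with hf
  have hfs : ∀ s ∈ U, ContDiffAt ℝ ∞ f s := fun s hs => by
    rw [← contMDiffAt_iff_contDiffAt]
    exact ContMDiffAt.comp s (hchart _ hs) hτ.smooth.contMDiffAt
  have hfinj : Function.Injective (fderiv ℝ f s₀) := by
    have h1 := HasMFDerivAt.comp s₀ ((hchart _ hx₀).mdifferentiableAt (by simp)).hasMFDerivAt
      (hτ.mdifferentiable s₀).hasMFDerivAt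
    have h2 := isInvertible_mfderiv_extChartAt (I := 𝓡 (2 * n)) hx₀
    set D : EuclideanSpace ℝ (Fin (2 * n)) →L[ℝ] EuclideanSpace ℝ (Fin (2 * n)) :=
      mfderiv (𝓡 (2 * n)) 𝓘(ℝ, EuclideanSpace ℝ (Fin (2 * n))) c (τ s₀) with hD
    set D' : (Fin k → ℝ) →L[ℝ] EuclideanSpace ℝ (Fin (2 * n)) :=
      mfderiv 𝓘(ℝ, Fin k → ℝ) (𝓡 (2 * n)) τ s₀ with hD'
    have h3 : HasFDerivAt f (D.comp D') s₀ := h1.hasFDerivAt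
    rw [h3.fderiv]
    have hDinj : Function.Injective D := h2.injective
    exact hDinj.comp (hτ.immersion s₀)
  -- Composing the immersion with a left inverse `P` of its derivative gives a local diffeomorphism
  -- `q` of the parameter space; the retraction is its inverse after `P ∘ c`.
  obtain ⟨P₀, hP₀⟩ := LinearMap.exists_leftInverse_of_injective (fderiv ℝ f s₀).toLinearMap
    (LinearMap.ker_eq_bot.2 hfinj)
  set P : EuclideanSpace ℝ (Fin (2 * n)) →L[ℝ] (Fin k → ℝ) := P₀.toContinuousLinearMap with hP
  set q : (Fin k → ℝ) → Fin k → ℝ := fun s => P (f s) with hq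
  have hqs : ContDiffOn ℝ ∞ q U := fun s hs =>
    (P.contDiff.contDiffAt.comp s (hfs s hs)).contDiffWithinAt
  have hqinj : Function.Injective (fderiv ℝ q s₀) := by
    have h1 : HasFDerivAt q (P.comp (fderiv ℝ f s₀)) s₀ :=
      P.hasFDerivAt.comp s₀ ((hfs s₀ hx₀).differentiableAt (by simp)).hasFDerivAt
    rw [h1.fderiv]
    exact Function.LeftInverse.injective (g := id) fun v => LinearMap.congr_fun hP₀ v
  obtain ⟨ψ, W, hWopen, hqW, hψ, hψ0, -, hev⟩ := exists_smooth_local_inverse hUopen hx₀ hqs hqinj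
  -- This excludes torus points near `τ s₀` that arise only from remote parameters, where `ψ ∘ q =
  -- id` is not available.
  have hmem := hτ.eventually_mem_image s₀ hev
  obtain ⟨N₁, hN₁, hN₁open, hxN₁⟩ := eventually_nhds_iff.1 hmem
  have hcont : ContinuousOn (fun x => P (c x)) c.source := fun x hx =>
    (P.continuous.continuousAt.comp (hchart x hx).continuousAt).continuousWithinAt
  refine ⟨fun x => ψ (P (c x)), (c.source ∩ (fun x => P (c x)) ⁻¹' W) ∩ N₁,
    (hcont.isOpen_inter_preimage hsrcopen hWopen).inter hN₁open, ⟨⟨hx₀, hqW⟩, hxN₁⟩, ?_, hψ0, ?_⟩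
  · rintro x ⟨⟨hx, hxW⟩, -⟩
    refine ContMDiffAt.contMDiffWithinAt ?_
    have h1 : ContMDiffAt 𝓘(ℝ, Fin k → ℝ) 𝓘(ℝ, Fin k → ℝ) ∞ ψ (P (c x)) :=
      (hψ.contDiffAt (hWopen.mem_nhds hxW)).contMDiffAt
    exact ContMDiffAt.comp x h1 (ContMDiffAt.comp x P.contDiff.contMDiff.contMDiffAt (hchart x hx))
  · rintro x ⟨-, hx⟩ hxr
    obtain ⟨s, ⟨-, hs⟩, rfl⟩ := hN₁ x hx hxr
    exact congrArg τ hs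

/-- The velocity of a curve on the torus is in the range of the derivative of `τ`. -/
theorem velocity_mem_range [T2Space M] [IsManifold (𝓡 (2 * n)) ∞ M]
    (hτ : IsTorusEmbedding (n := n) τ) (s₀ : Fin k → ℝ)
    {γ : ℝ → M} (hγ : ContMDiff 𝓘(ℝ, ℝ) (𝓡 (2 * n)) ∞ γ) (hmem : ∀ t, γ t ∈ Set.range τ)
    (h0 : γ 0 = τ s₀) :
    ∃ v : Fin k → ℝ, (mfderiv 𝓘(ℝ, ℝ) (𝓡 (2 * n)) γ 0 (1 : ℝ) :
      EuclideanSpace ℝ (Fin (2 * n))) = mfderiv 𝓘(ℝ, Fin k → ℝ) (𝓡 (2 * n)) τ s₀ v := by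
  obtain ⟨π, N, hN, hxN, hπ, hπ0, hret⟩ := hτ.exists_retraction s₀
  have hNγ : N ∈ 𝓝 (γ 0) := hN.mem_nhds (by rw [h0]; exact hxN)
  have hπd : MDifferentiableAt (𝓡 (2 * n)) 𝓘(ℝ, Fin k → ℝ) π (γ 0) :=
    (hπ.contMDiffAt hNγ).mdifferentiableAt (by simp)
  have h1 := HasMFDerivAt.comp (0 : ℝ) hπd.hasMFDerivAt
    (hγ.mdifferentiable (by simp) 0).hasMFDerivAt
  have hτd : HasMFDerivAt 𝓘(ℝ, Fin k → ℝ) (𝓡 (2 * n)) τ ((π ∘ γ) 0)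
      (mfderiv 𝓘(ℝ, Fin k → ℝ) (𝓡 (2 * n)) τ ((π ∘ γ) 0)) :=
    (hτ.mdifferentiable _).hasMFDerivAt
  have h2 := HasMFDerivAt.comp (0 : ℝ) hτd h1
  -- The retraction lifts the curve smoothly to parameter space, and the chain rule then gives the
  -- claim.
  have hev : γ =ᶠ[𝓝 0] τ ∘ (π ∘ γ) := by
    filter_upwards [hγ.continuous.continuousAt.preimage_mem_nhds hNγ] with t ht
    exact (hret _ ht (hmem t)).symm
  have h3 := (h2.congr_of_eventuallyEq hev).mfderiv
  have hs : (π ∘ γ) 0 = s₀ := by rw [Function.comp_apply, h0, hπ0]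
  have key : ∀ s, s = s₀ → ∀ v : Fin k → ℝ, (mfderiv 𝓘(ℝ, Fin k → ℝ) (𝓡 (2 * n)) τ s v :
      EuclideanSpace ℝ (Fin (2 * n))) = mfderiv 𝓘(ℝ, Fin k → ℝ) (𝓡 (2 * n)) τ s₀ v := by
    rintro s rfl v
    rfl
  exact ⟨_, (DFunLike.congr_fun h3 (1 : ℝ)).trans (key _ hs _)⟩

end IsTorusEmbedding

end Torus

namespace InvariantTorus

variable {n : ℕ} {M : Type*} [TopologicalSpace M] [ChartedSpace (EuclideanSpace ℝ (Fin (2 * n))) M]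
  {Ω : SymplecticForm n M} {k : ℕ} (S : InvariantTorus Ω k)

/-! ### The tangent space of the torus -/

theorem linearIndependent_hamiltonianField {x : M} (hx : x ∈ S.torus) :
    LinearIndependent ℝ fun j => Ω.hamiltonianField (S.F j) x :=
  (S.independent x hx).map' (Ω.J x).toLinearMap (Ω.J x).ker

theorem hamiltonianField_mem_tangentTo (j : Fin k) {x : M} (hx : x ∈ S.torus) :
    Ω.hamiltonianField (S.F j) x ∈ tangentTo (n := n) S.torus x := by
  refine Submodule.subset_span ⟨fun t => S.flow j t x, ?_, fun t => S.flow_mem j t hx,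
    (S.isPhaseFlow j).zero x, ?_⟩
  · exact (S.isPhaseFlow j).smooth.comp (contMDiff_id.prodMk contMDiff_const)
  · have h := ((S.isPhaseFlow j).solution x 0).mfderiv
    have h4 : (1 : ℝ) • Ω.modelField (S.F j) (S.flow j 0 x) = Ω.modelField (S.F j) x := by
      rw [one_smul, (S.isPhaseFlow j).zero]
    exact (DFunLike.congr_fun h (1 : ℝ)).trans h4

variable [T2Space M] [IsManifold (𝓡 (2 * n)) ∞ M]

theorem finrank_tangentTo_le {x : M} (hx : x ∈ S.torus) :
    Module.finrank ℝ (tangentTo (n := n) S.torus x) ≤ k := by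
  obtain ⟨s₀, rfl⟩ := hx
  set D : (Fin k → ℝ) →ₗ[ℝ] TangentSpace (𝓡 (2 * n)) (S.τ s₀) :=
    (mfderiv 𝓘(ℝ, Fin k → ℝ) (𝓡 (2 * n)) S.τ s₀).toLinearMap with hD
  have hle : tangentTo (n := n) S.torus (S.τ s₀) ≤ LinearMap.range D := by
    refine Submodule.span_le.2 ?_
    rintro v ⟨γ, hγ, hmem, h0, rfl⟩
    obtain ⟨w, hw⟩ := S.embedding.velocity_mem_range s₀ hγ hmem h0
    exact ⟨w, hw.symm⟩
  refine (Submodule.finrank_mono hle).trans ?_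
  exact (LinearMap.finrank_range_le D).trans (by simp)

/-- The `k` independent fields are tangent to the invariant torus, whose tangent space has dimension
at most `k`. -/
theorem span_hamiltonianField {x : M} (hx : x ∈ S.torus) :
    Submodule.span ℝ (Set.range fun j => Ω.hamiltonianField (S.F j) x) =
      tangentTo (n := n) S.torus x := by
  refine Submodule.eq_of_le_of_finrank_le ?_ ?_
  · refine Submodule.span_le.2 ?_
    rintro _ ⟨j, rfl⟩
    exact S.hamiltonianField_mem_tangentTo j hx
  · rw [finrank_span_eq_card (S.linearIndependent_hamiltonianField hx), Fintype.card_fin]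
    exact S.finrank_tangentTo_le hx

/-- Because `dF_j(v) = [v, J dF_j]` and the `J dF_j` span the tangent space of the torus, the level
set and the torus have skew-orthogonal tangent spaces. -/
theorem mem_levelTangent_iff {x : M} (hx : x ∈ S.torus) (v : TangentSpace (𝓡 (2 * n)) x) :
    v ∈ levelTangent S.F x ↔ ∀ l ∈ tangentTo (n := n) S.torus x, Ω.bilin x l v = 0 := by
  have h1 : ∀ j, differential (S.F j) x v = -Ω.bilin x (Ω.hamiltonianField (S.F j) x) v := by
    intro j
    rw [Ω.bilin_neg]
    exact (Ω.bilin_J x _ v).symm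
  simp only [levelTangent, Submodule.mem_iInf, LinearMap.mem_ker, h1, neg_eq_zero]
  rw [← S.span_hamiltonianField hx]
  constructor
  · intro h l hl
    induction hl using Submodule.span_induction with
    | mem y hy => obtain ⟨j, rfl⟩ := hy; exact h j
    | zero => rw [map_zero, LinearMap.zero_apply]
    | add y z _ _ hy hz => rw [map_add, LinearMap.add_apply, hy, hz, add_zero]
    | smul c y _ hy => rw [map_smul, LinearMap.smul_apply, hy, smul_zero]
  · intro h j
    exact h _ (Submodule.subset_span ⟨j, rfl⟩)

theorem tangentTo_le_levelTangent {x : M} (hx : x ∈ S.torus) :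
    tangentTo (n := n) S.torus x ≤ levelTangent S.F x := fun v hv =>
  (S.mem_levelTangent_iff hx v).2 fun l hl => S.isotropic x hx l hl v hv

/-- The chosen representatives differ from `u` and `v` by vectors tangent to the torus, which are
orthogonal to the level set. -/
theorem reducedForm_mk {x : M} (hx : x ∈ S.torus) (u v : levelTangent (n := n) S.F x) :
    S.reducedForm x (Submodule.Quotient.mk u) (Submodule.Quotient.mk v) = Ω.bilin x u v := by
  set L := (tangentTo (n := n) S.torus x).submoduleOf (levelTangent (n := n) S.F x) with hL
  have hex := LinearMap.exists_rightInverse_of_surjective (Submodule.mkQ L) (Submodule.range_mkQ L)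
  set s := hex.choose with hs
  have hsec : ∀ w : levelTangent (n := n) S.F x,
      ((s (Submodule.Quotient.mk w) : levelTangent (n := n) S.F x) :
        TangentSpace (𝓡 (2 * n)) x) - w ∈ tangentTo (n := n) S.torus x := by
    intro w
    have h1 : L.mkQ (s (Submodule.Quotient.mk w)) = Submodule.Quotient.mk w :=
      LinearMap.congr_fun hex.choose_spec _
    exact (Submodule.Quotient.eq L).1 h1
  have horth : ∀ l ∈ tangentTo (n := n) S.torus x, ∀ w : levelTangent (n := n) S.F x,
      Ω.bilin x l w = 0 := fun l hl w => (S.mem_levelTangent_iff hx w).1 w.2 l hl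
  change Ω.bilin x (s (Submodule.Quotient.mk u) : levelTangent (n := n) S.F x)
    (s (Submodule.Quotient.mk v) : levelTangent (n := n) S.F x) = Ω.bilin x u v
  have h1 := horth _ (hsec u) (s (Submodule.Quotient.mk v))
  have h2 := horth _ (hsec v) u
  rw [← Ω.bilin_neg, neg_eq_zero, map_sub, sub_eq_zero] at h2
  rw [map_sub, LinearMap.sub_apply, sub_eq_zero] at h1
  rw [h1, h2]

theorem isReduction {x : M} (hx : x ∈ S.torus) :
    IsReduction (Ω.bilin x) (tangentTo (n := n) S.torus x) (levelTangent (n := n) S.F x)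
      (S.reducedForm x) where
  alt := Ω.bilin_self x
  nondegenerate y hy := Ω.nondegenerate x y fun z => by
    change Ω.bilin x z y = 0
    rw [← Ω.bilin_neg, hy, neg_zero]
  le := S.tangentTo_le_levelTangent hx
  mem_iff := S.mem_levelTangent_iff hx
  form := S.reducedForm_mk hx

/-! ### Transitivity of the action on the torus -/

/-- Close to each point, the torus is parametrized smoothly by the action. -/
theorem exists_local_section (s₀ : Fin k → ℝ) :
    ∃ (θ : (Fin k → ℝ) → Fin k → ℝ) (W : Set (Fin k → ℝ)), IsOpen W ∧ s₀ ∈ W ∧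
      ContDiffOn ℝ ∞ θ W ∧ ∀ s ∈ W, S.action (θ s) (S.τ s₀) = S.τ s := by
  obtain ⟨π, N, hN, hxN, hπ, hπ0, hret⟩ := S.embedding.exists_retraction s₀
  set x := S.τ s₀ with hx
  have hxt : x ∈ S.torus := ⟨s₀, rfl⟩
  have hsm : ContMDiff 𝓘(ℝ, Fin k → ℝ) (𝓡 (2 * n)) ∞ (fun t => S.action t x) :=
    S.smooth_joint_action.comp (contMDiff_id.prodMk contMDiff_const)
  set O : Set (Fin k → ℝ) := (fun t => S.action t x) ⁻¹' N with hO
  have hOopen : IsOpen O := hN.preimage hsm.continuous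
  have h0O : (0 : Fin k → ℝ) ∈ O := by
    change S.action 0 x ∈ N
    rw [S.action_zero]
    exact hxN
  set σ : (Fin k → ℝ) → Fin k → ℝ := fun t => π (S.action t x) with hσ
  have hτσ : ∀ t ∈ O, S.τ (σ t) = S.action t x := fun t ht =>
    hret _ ht (S.action_mem t x hxt)
  have hσs : ContDiffOn ℝ ∞ σ O := fun t ht => by
    refine ContDiffAt.contDiffWithinAt ?_
    rw [← contMDiffAt_iff_contDiffAt]
    exact ContMDiffAt.comp t (hπ.contMDiffAt (hN.mem_nhds ht)) hsm.contMDiffAt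
  have hσ0 : σ 0 = s₀ := by
    change π (S.action 0 x) = s₀
    rw [S.action_zero, hπ0]
  -- The composite `τ ∘ σ` is the orbit map near `0`, whose derivative sends `v` to `∑ v_j J dF_j`;
  -- independence of the fields makes it injective.
  have hinj : Function.Injective (fderiv ℝ σ 0) := by
    obtain ⟨D, hD, hDv⟩ := S.hasMFDerivAt_orbit x 0
    have h1 : HasMFDerivAt 𝓘(ℝ, Fin k → ℝ) 𝓘(ℝ, Fin k → ℝ) σ 0 (fderiv ℝ σ 0) :=
      (((hσs.contDiffAt (hOopen.mem_nhds h0O)).differentiableAt (by simp)).hasFDerivAt).hasMFDerivAt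
    have h2 := HasMFDerivAt.comp (0 : Fin k → ℝ) (S.embedding.mdifferentiable (σ 0)).hasMFDerivAt h1
    have h3 : HasMFDerivAt 𝓘(ℝ, Fin k → ℝ) (𝓡 (2 * n)) (S.τ ∘ σ) 0 D := by
      refine hD.congr_of_eventuallyEq ?_
      filter_upwards [hOopen.mem_nhds h0O] with t ht
      exact hτσ t ht
    have h4 := hasMFDerivAt_unique h2 h3
    refine (injective_iff_map_eq_zero _).2 fun v hv => ?_
    have h5 : D v = 0 := by
      refine (DFunLike.congr_fun h4 v).symm.trans ?_
      refine (congrArg (mfderiv 𝓘(ℝ, Fin k → ℝ) (𝓡 (2 * n)) S.τ (σ 0)) hv).trans ?_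
      exact map_zero _
    rw [hDv, S.action_zero] at h5
    have h6 := Fintype.linearIndependent_iff.1 (S.linearIndependent_hamiltonianField hxt) v h5
    exact funext h6
  obtain ⟨ψ, W, hW, h0W, hψ, hψ0, hinv, -⟩ := exists_smooth_local_inverse hOopen h0O hσs hinj
  rw [hσ0] at h0W
  refine ⟨ψ, W, hW, h0W, hψ, fun s hs => ?_⟩
  rw [← hτσ _ (hinv s hs).1, (hinv s hs).2]

/-- The parameters whose torus points lie in the orbit of `x` form an open set by the local
sections. The complement is open for the same reason, and `ℝ^k` is connected. -/
theorem exists_action_eq {x y : M} (hx : x ∈ S.torus) (hy : y ∈ S.torus) :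
    ∃ t, S.action t x = y := by
  set A : Set (Fin k → ℝ) := {s | ∃ t, S.action t x = S.τ s} with hA
  have hopen : IsOpen A := by
    rw [isOpen_iff_mem_nhds]
    rintro s₀ ⟨t, ht⟩
    obtain ⟨θ, W, hW, hs₀, -, hθ⟩ := S.exists_local_section s₀
    filter_upwards [hW.mem_nhds hs₀] with s hs
    exact ⟨θ s + t, by rw [S.action_add, ht, hθ s hs]⟩
  have hclosed : IsClosed A := by
    rw [← isOpen_compl_iff, isOpen_iff_mem_nhds]
    intro s₀ hs₀A
    obtain ⟨θ, W, hW, hs₀, -, hθ⟩ := S.exists_local_section s₀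
    filter_upwards [hW.mem_nhds hs₀] with s hs
    rintro ⟨t, ht⟩
    refine hs₀A ⟨-θ s + t, ?_⟩
    rw [S.action_add, ht, ← hθ s hs, S.action_neg]
  obtain ⟨s, rfl⟩ := hx
  obtain ⟨s', rfl⟩ := hy
  have huniv := IsClopen.eq_univ ⟨hclosed, hopen⟩ ⟨s, 0, S.action_zero _⟩
  have : s' ∈ A := by rw [huniv]; trivial
  exact this

end InvariantTorus

theorem IsGermAt.map {V W : Type*} [AddCommGroup V] [Module ℝ V] [AddCommGroup W] [Module ℝ W]
    {B : LinearMap.BilinForm ℝ V} {B' : LinearMap.BilinForm ℝ W} {L : Submodule ℝ V}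
    {L' : Submodule ℝ W} {r : Submodule ℂ (ℂ ⊗[ℝ] V)} (hr : IsGermAt B L r) {D : V →ₗ[ℝ] W}
    (hD : Function.Injective D) (hB : ∀ x y, B' (D x) (D y) = B x y) (hL : L.map D = L')
    (hdim : Module.finrank ℝ V = Module.finrank ℝ W) :
    IsGermAt B' L' (r.map (D.baseChange ℂ)) where
  two_mul_finrank := by
    have hinj : Function.Injective (D.baseChange ℂ) := by
      intro z w h
      apply complexification_ext
      · apply hD
        rw [← rePart_baseChange, h, rePart_baseChange]
      · apply hD
        rw [← imPart_baseChange, h, imPart_baseChange]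
    rw [← (Submodule.equivMapOfInjective _ hinj _).finrank_eq, hr.two_mul_finrank, hdim]
  isotropic := by
    rintro _ ⟨x, hx, rfl⟩ _ ⟨y, hy, rfl⟩
    rw [baseChange_form_map hB]
    exact hr.isotropic x hx y hy
  le := by
    intro z hz
    obtain ⟨h1, h2⟩ := (mem_baseChange_iff L' z).1 hz
    rw [← hL] at h1 h2
    obtain ⟨a, ha, ha'⟩ := h1
    obtain ⟨b, hb, hb'⟩ := h2
    refine ⟨(1 : ℂ) ⊗ₜ a + Complex.I ⊗ₜ b, hr.le ?_, ?_⟩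
    · exact add_mem (Submodule.tmul_mem_baseChange_of_mem _ ha)
        (Submodule.tmul_mem_baseChange_of_mem _ hb)
    · rw [map_add, LinearMap.baseChange_tmul, LinearMap.baseChange_tmul, ha', hb',
        rePart_add_imPart]
  pos := by
    rintro _ ⟨x, hx, rfl⟩ hxL
    rw [imPart_baseChange, rePart_baseChange, hB]
    refine hr.pos x hx fun hxL' => hxL ?_
    obtain ⟨h1, h2⟩ := (mem_baseChange_iff L x).1 hxL'
    rw [mem_baseChange_iff, ← hL, rePart_baseChange, imPart_baseChange]
    exact ⟨Submodule.mem_map_of_mem h1, Submodule.mem_map_of_mem h2⟩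

/-! ### Transport of pointwise germs by the action -/

section Germ

variable {n : ℕ} {M : Type*} [TopologicalSpace M] [ChartedSpace (EuclideanSpace ℝ (Fin (2 * n))) M]

theorem finrank_tangentSpace (x : M) :
    Module.finrank ℝ (TangentSpace (𝓡 (2 * n)) x) = 2 * n :=
  finrank_euclideanSpace_fin

namespace InvariantTorus

variable {Ω : SymplecticForm n M} {k : ℕ} (S : InvariantTorus Ω k)

/-- The image under the derivative of `g^t` at `m` of a complex subspace. -/
noncomputable def pushGerm (m : M) (r : Submodule ℂ (ℂ ⊗[ℝ] EuclideanSpace ℝ (Fin (2 * n))))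
    (t : Fin k → ℝ) : Submodule ℂ (ℂ ⊗[ℝ] EuclideanSpace ℝ (Fin (2 * n))) :=
  r.map ((modelDeriv n (S.action t) m).toLinearMap.baseChange ℂ)

/-- The conditions on the value at `x` of a complex germ on the torus. -/
def IsGermOn (x : M) (r : Submodule ℂ (ℂ ⊗[ℝ] EuclideanSpace ℝ (Fin (2 * n)))) : Prop :=
  IsGermAt (V := TangentSpace (𝓡 (2 * n)) x) (Ω.bilin x) (tangentTo (n := n) S.torus x) r

theorem reducedMonodromy_mk {m : M} {t : Fin k → ℝ} (ht : S.action t m = m)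
    (x y : levelTangent (n := n) S.F m)
    (h : (y : TangentSpace (𝓡 (2 * n)) m) = S.monodromy m t x) :
    S.reducedMonodromy m t ht (Submodule.Quotient.mk x) = Submodule.Quotient.mk y :=
  congrArg Submodule.Quotient.mk (Subtype.ext h.symm)

variable [T2Space M] [IsManifold (𝓡 (2 * n)) ∞ M]

theorem modelDeriv_action_injective (t : Fin k → ℝ) (x : M) :
    Function.Injective (modelDeriv n (S.action t) x) :=
  Function.LeftInverse.injective (S.modelDeriv_action_neg t x)

theorem pushGerm_add (m : M) (r : Submodule ℂ (ℂ ⊗[ℝ] EuclideanSpace ℝ (Fin (2 * n))))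
    (s t : Fin k → ℝ) : S.pushGerm m r (s + t) = S.pushGerm (S.action t m) (S.pushGerm m r t) s := by
  rw [pushGerm, pushGerm, pushGerm, ← Submodule.map_comp, S.modelDeriv_action_add,
    ← LinearMap.baseChange_comp]
  rfl

/-- Both tangent spaces are spanned by the Hamiltonian fields, which the action preserves. -/
theorem map_tangentTo (t : Fin k → ℝ) {x : M} (hx : x ∈ S.torus) :
    (tangentTo (n := n) S.torus x).map
      (mfderiv (𝓡 (2 * n)) (𝓡 (2 * n)) (S.action t) x).toLinearMap =
    tangentTo (n := n) S.torus (S.action t x) := by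
  rw [← S.span_hamiltonianField hx, ← S.span_hamiltonianField (S.action_mem t x hx),
    Submodule.map_span, ← Set.range_comp]
  congr 2
  funext j
  exact S.modelDeriv_action_modelField j t x

theorem IsGermOn.push {m : M} (hm : m ∈ S.torus)
    {r : Submodule ℂ (ℂ ⊗[ℝ] EuclideanSpace ℝ (Fin (2 * n)))} (hr : S.IsGermOn m r)
    (t : Fin k → ℝ) : S.IsGermOn (S.action t m) (S.pushGerm m r t) :=
  IsGermAt.map (V := TangentSpace (𝓡 (2 * n)) m) (W := TangentSpace (𝓡 (2 * n)) (S.action t m))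
    hr (S.modelDeriv_action_injective t m) (S.pairing_action t m) (S.map_tangentTo t hm)
    ((finrank_tangentSpace m).trans (finrank_tangentSpace _).symm)

/-! ### The germ at the base point -/

theorem monodromy_symplectic {m : M} {t : Fin k → ℝ} (ht : S.action t m = m) :
    IsSymplecticMap (Ω.bilin m) (S.monodromy m t) := by
  intro u v
  have h := S.pairing_action t m u v
  rw [ht] at h
  exact h

theorem monodromy_commute {m : M} {s t : Fin k → ℝ} (hs : S.action s m = m)
    (ht : S.action t m = m) (v : TangentSpace (𝓡 (2 * n)) m) :
    S.monodromy m s (S.monodromy m t v) = S.monodromy m t (S.monodromy m s v) := by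
  have h1 := S.modelDeriv_action_add s t m
  have h2 := S.modelDeriv_action_add t s m
  rw [add_comm, h1, hs, ht] at h2
  exact DFunLike.congr_fun h2 v

theorem reducedMonodromy_symplectic {m : M} (hm : m ∈ S.torus) {t : Fin k → ℝ}
    (ht : S.action t m = m) : IsSymplecticMap (S.reducedForm m) (S.reducedMonodromy m t ht) := by
  intro x y
  obtain ⟨x, rfl⟩ := Submodule.Quotient.mk_surjective _ x
  obtain ⟨y, rfl⟩ := Submodule.Quotient.mk_surjective _ y
  rw [S.reducedMonodromy_mk ht x ⟨_, S.monodromy_levelTangent ht x.2⟩ rfl,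
    S.reducedMonodromy_mk ht y ⟨_, S.monodromy_levelTangent ht y.2⟩ rfl, S.reducedForm_mk hm,
    S.reducedForm_mk hm]
  exact S.monodromy_symplectic ht _ _

theorem reducedMonodromy_commute {m : M} {s t : Fin k → ℝ} (hs : S.action s m = m)
    (ht : S.action t m = m) (x : S.Gam m) :
    S.reducedMonodromy m s hs (S.reducedMonodromy m t ht x) =
      S.reducedMonodromy m t ht (S.reducedMonodromy m s hs x) := by
  obtain ⟨x, rfl⟩ := Submodule.Quotient.mk_surjective _ x
  exact congrArg Submodule.Quotient.mk (Subtype.ext (S.monodromy_commute hs ht x))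

/-- If a reduced monodromy operator is strongly stable, then there is exactly one subspace of the
complexified tangent space that satisfies the pointwise conditions on a complex germ and is
invariant under the corresponding monodromy operator, and it is invariant under all monodromy
operators. -/
theorem exists_unique_isGermOn {m : M} (hm : m ∈ S.torus) {t₀ : Fin k → ℝ}
    (ht₀ : S.action t₀ m = m)
    (hstrong : IsStronglyStable (S.reducedForm m) (S.reducedMonodromy m t₀ ht₀)) :
    ∃ r, S.IsGermOn m r ∧ (∀ t, S.action t m = m → S.pushGerm m r t = r) ∧
      ∀ r', S.IsGermOn m r' → S.pushGerm m r' t₀ = r' → r' = r := by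
  have hred := S.isReduction hm
  have hA : IsDefinite (S.reducedForm m) (S.reducedMonodromy m t₀ ht₀) :=
    IsStronglyStable.isDefinite hred.reduced_alt hred.reduced_nondegenerate
      (S.reducedMonodromy_symplectic hm ht₀) hstrong
  refine ⟨liftGerm (positivePart (S.reducedForm m) (S.reducedMonodromy m t₀ ht₀)),
    hred.isGermAt_liftGerm hA, fun t ht => ?_, fun r' hr' hinv => ?_⟩
  · have hle : S.pushGerm m (liftGerm (positivePart (S.reducedForm m)
        (S.reducedMonodromy m t₀ ht₀))) t ≤
        liftGerm (positivePart (S.reducedForm m) (S.reducedMonodromy m t₀ ht₀)) := by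
      rintro _ ⟨x, hx, rfl⟩
      exact hred.map_liftGerm hA (S.monodromy_symplectic ht)
        (fun x hx => S.monodromy_levelTangent ht hx) (S.reducedMonodromy_mk ht)
        (S.reducedMonodromy_commute ht ht₀) x hx
    refine Submodule.eq_of_le_of_finrank_eq hle ?_
    have h1 := (IsGermOn.push S hm (hred.isGermAt_liftGerm hA) t).two_mul_finrank
    have h2 := (hred.isGermAt_liftGerm hA).two_mul_finrank
    rw [finrank_tangentSpace] at h1 h2
    exact Nat.eq_of_mul_eq_mul_left two_pos (h1.trans h2.symm)
  · refine hred.eq_liftGerm hA (M := S.monodromy m t₀)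
      (fun x hx => S.monodromy_levelTangent ht₀ hx) (S.reducedMonodromy_mk ht₀) hr' ?_
    intro x hx
    have h : (modelDeriv n (S.action t₀) m).toLinearMap.baseChange ℂ x ∈ S.pushGerm m r' t₀ :=
      ⟨x, hx, rfl⟩
    rw [hinv] at h
    exact h

/-- The times `s` and `t` differ by `-t + s`, which fixes `m` and hence `r`. The transported
subspace thus depends only on the point reached. -/
theorem pushGerm_eq_of_action_eq {m : M}
    {r : Submodule ℂ (ℂ ⊗[ℝ] EuclideanSpace ℝ (Fin (2 * n)))}
    (hr : ∀ t, S.action t m = m → S.pushGerm m r t = r) {s t : Fin k → ℝ}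
    (h : S.action s m = S.action t m) : S.pushGerm m r s = S.pushGerm m r t := by
  have hu : S.action (-t + s) m = m := by rw [S.action_add, h, S.action_neg]
  have hs : s = t + (-t + s) := by abel
  rw [hs, S.pushGerm_add, hr _ hu, hu]

end InvariantTorus

end Germ

/-! ### From a germ at one point to an invariant germ on the torus -/

section Global

variable {n : ℕ} {M : Type*} [TopologicalSpace M] [ChartedSpace (EuclideanSpace ℝ (Fin (2 * n))) M]

namespace InvariantTorus

variable {Ω : SymplecticForm n M} {k : ℕ} {S : InvariantTorus Ω k} [IsManifold (𝓡 (2 * n)) ∞ M]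

theorem IsComplexGerm.isGermOn
    {r : (x : S.torus) → Submodule ℂ (ℂ ⊗[ℝ] TangentSpace (𝓡 (2 * n)) (x : M))}
    (hr : S.IsComplexGerm r) (x : S.torus) : S.IsGermOn (x : M) (r x) where
  two_mul_finrank := by
    rw [finrank_tangentSpace]
    exact congrArg (2 * ·) (hr.finrank_eq x)
  isotropic := hr.isotropic x
  le := hr.tangent_le x
  pos y hy hyL := by
    rw [← baseChange_form_conjugate_re (Ω.bilin_self (x : M))]
    exact hr.dissipative x y hy hyL

/-- Invariance under the single flows passes to their compositions by the chain rule, so the value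
at one point determines the germ along its orbit. -/
theorem IsComplexGerm.pushGerm_eq
    {r : (x : S.torus) → Submodule ℂ (ℂ ⊗[ℝ] TangentSpace (𝓡 (2 * n)) (x : M))}
    (hr : S.IsComplexGerm r) (t : Fin k → ℝ) (x : S.torus) :
    S.pushGerm (x : M) (r x) t = r ⟨S.action t x, S.action_mem t x x.2⟩ := by
  set ρ : S.torus → Submodule ℂ (ℂ ⊗[ℝ] EuclideanSpace ℝ (Fin (2 * n))) := r with hρ
  refine (S.action_induction (P := fun f => MDifferentiable (𝓡 (2 * n)) (𝓡 (2 * n)) f ∧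
    ∀ x : S.torus, ∃ h : f x ∈ S.torus,
      (ρ x).map ((modelDeriv n f x).toLinearMap.baseChange ℂ) = ρ ⟨f x, h⟩)
    ?_ ?_ ?_ t).2 x |>.choose_spec
  · refine ⟨mdifferentiable_id, fun x => ⟨x.2, ?_⟩⟩
    rw [modelDeriv_id]
    exact (congrArg (fun D => (ρ x).map D) LinearMap.baseChange_id).trans (Submodule.map_id _)
  · rintro f g ⟨hf, hf'⟩ ⟨hg, hg'⟩
    refine ⟨hf.comp hg, fun x => ?_⟩
    obtain ⟨h1, e1⟩ := hg' x
    obtain ⟨h2, e2⟩ := hf' ⟨g x, h1⟩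
    refine ⟨h2, ?_⟩
    rw [modelDeriv_comp hf hg]
    have e3 : ((modelDeriv n f (g x)).comp (modelDeriv n g x)).toLinearMap.baseChange ℂ =
        (modelDeriv n f (g x)).toLinearMap.baseChange ℂ ∘ₗ
          (modelDeriv n g x).toLinearMap.baseChange ℂ :=
      LinearMap.baseChange_comp _ _
    rw [e3, Submodule.map_comp, e1, e2]
    rfl
  · exact fun j t => ⟨(S.isPhaseFlow j).mdifferentiable t,
      fun x => ⟨S.flow_mem j t x.2, hr.invariant j t x⟩⟩

/-- The derivative of `g^t` along the orbit of a point, as a smooth section over a set of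
parameters. -/
theorem contMDiffOn_modelDeriv_action {W : Set (Fin k → ℝ)} {θ : (Fin k → ℝ) → Fin k → ℝ}
    (hθ : ContDiffOn ℝ ∞ θ W) (m : M) (a : EuclideanSpace ℝ (Fin (2 * n))) :
    ContMDiffOn 𝓘(ℝ, Fin k → ℝ) (𝓡 (2 * n)).tangent ∞
      (fun s => (⟨S.action (θ s) m, modelDeriv n (S.action (θ s)) m a⟩ :
        TangentBundle (𝓡 (2 * n)) M)) W := by
  have h1 : ContMDiff (𝓘(ℝ, Fin k → ℝ).prod (𝓡 (2 * n))).tangent (𝓡 (2 * n)).tangent ∞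
      (tangentMap (𝓘(ℝ, Fin k → ℝ).prod (𝓡 (2 * n))) (𝓡 (2 * n))
        (fun p : (Fin k → ℝ) × M => S.action p.1 p.2)) :=
    S.smooth_joint_action.contMDiff_tangentMap (by simp)
  have h2 : ContMDiff 𝓘(ℝ, Fin k → ℝ) (𝓘(ℝ, Fin k → ℝ).prod (𝓡 (2 * n))).tangent ∞
      -- The tangent vector `(0, a)` at `(t, m)` has no time component, so the tangent map of the
      -- joint action sends it to `dg^t a`.
      (fun t : Fin k → ℝ => (equivTangentBundleProd 𝓘(ℝ, Fin k → ℝ) (Fin k → ℝ) (𝓡 (2 * n)) M).symm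
        (Bundle.zeroSection _ _ t, (⟨m, a⟩ : TangentBundle (𝓡 (2 * n)) M))) :=
    contMDiff_equivTangentBundleProd_symm.comp
      ((Bundle.contMDiff_zeroSection ℝ _).prodMk contMDiff_const)
  refine ((h1.comp h2).comp_contMDiffOn hθ.contMDiffOn).congr fun s _ => ?_
  have e : (mfderiv (𝓘(ℝ, Fin k → ℝ).prod (𝓡 (2 * n))) (𝓡 (2 * n))
      (fun p : (Fin k → ℝ) × M => S.action p.1 p.2) (θ s, m)
      ((0 : Fin k → ℝ), a) : EuclideanSpace ℝ (Fin (2 * n))) = modelDeriv n (S.action (θ s)) m a := by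
    refine (mfderiv_prod_eq_add_apply
      (S.smooth_joint_action.mdifferentiable (by simp) (θ s, m))).trans ?_
    refine (congrArg₂ (· + ·) (map_zero _) rfl).trans (zero_add _)
  exact congrArg (fun v => (⟨S.action (θ s) m, v⟩ : TangentBundle (𝓡 (2 * n)) M)) e.symm

variable [T2Space M]

/-- The images of a germ under the action are locally spanned by smooth vector fields. -/
theorem exists_frame {m : M} {r₀ : Submodule ℂ (ℂ ⊗[ℝ] EuclideanSpace ℝ (Fin (2 * n)))}
    (hr₀ : Module.finrank ℂ r₀ = n)
    (hpush : ∀ t, S.action t m = m → S.pushGerm m r₀ t = r₀) {t : S.torus → Fin k → ℝ}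
    (ht : ∀ x : S.torus, S.action (t x) m = x) (s₀ : Fin k → ℝ) :
    ∃ U ∈ 𝓝 s₀,
    ∃ X Y : Fin n → (s : Fin k → ℝ) → TangentSpace (𝓡 (2 * n)) (S.τ s),
      (∀ i, ContMDiffOn 𝓘(ℝ, Fin k → ℝ) (𝓡 (2 * n)).tangent ∞
        (fun s => (⟨S.τ s, X i s⟩ : TangentBundle (𝓡 (2 * n)) M)) U) ∧
      (∀ i, ContMDiffOn 𝓘(ℝ, Fin k → ℝ) (𝓡 (2 * n)).tangent ∞
        (fun s => (⟨S.τ s, Y i s⟩ : TangentBundle (𝓡 (2 * n)) M)) U) ∧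
      ∀ s ∈ U, S.pushGerm m r₀ (t ⟨S.τ s, Set.mem_range_self s⟩) =
        Submodule.span ℂ (Set.range fun i => (1 : ℂ) ⊗ₜ[ℝ] X i s + Complex.I ⊗ₜ[ℝ] Y i s) := by
  obtain ⟨θ, W, hW, hs₀, hθ, hact⟩ := S.exists_local_section s₀
  set t₀ := t ⟨S.τ s₀, Set.mem_range_self s₀⟩ with ht₀
  set ϑ : (Fin k → ℝ) → Fin k → ℝ := fun s => θ s + t₀ with hϑ
  have hϑs : ContDiffOn ℝ ∞ ϑ W := hθ.add contDiffOn_const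
  have hϑa : ∀ s ∈ W, S.action (ϑ s) m = S.τ s := fun s hs => by
    rw [hϑ, S.action_add, ht₀, ht, hact s hs]
  set b := Module.finBasisOfFinrankEq ℂ r₀ hr₀ with hb
  have hspan : r₀ = Submodule.span ℂ (Set.range fun i => (b i : ℂ ⊗[ℝ] _)) := by
    have h1 := congrArg (Submodule.map r₀.subtype) b.span_eq
    rw [Submodule.map_span, ← Set.range_comp, Submodule.map_top, Submodule.range_subtype] at h1
    exact h1.symm
  have hbundle : ∀ (a : EuclideanSpace ℝ (Fin (2 * n))), ContMDiffOn 𝓘(ℝ, Fin k → ℝ)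
      (𝓡 (2 * n)).tangent ∞ (fun s => (⟨S.τ s, modelDeriv n (S.action (ϑ s)) m a⟩ :
        TangentBundle (𝓡 (2 * n)) M)) W := by
    intro a
    refine (contMDiffOn_modelDeriv_action (S := S) hϑs m a).congr fun s hs => ?_
    have key : ∀ x y : M, x = y → ∀ v : EuclideanSpace ℝ (Fin (2 * n)),
        (⟨x, v⟩ : TangentBundle (𝓡 (2 * n)) M) = ⟨y, v⟩ := by
      rintro x _ rfl v
      rfl
    exact key _ _ (hϑa s hs).symm _
  refine ⟨W, hW.mem_nhds hs₀, fun i s => modelDeriv n (S.action (ϑ s)) m (rePart (b i : ℂ ⊗[ℝ] _)),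
    fun i s => modelDeriv n (S.action (ϑ s)) m (imPart (b i : ℂ ⊗[ℝ] _)),
    fun i => hbundle _, fun i => hbundle _, fun s hs => ?_⟩
  -- The arbitrary time `t` may be discontinuous; it is replaced by the smooth local choice `ϑ`,
  -- which reaches the same point.
  have he : S.pushGerm m r₀ (t ⟨S.τ s, Set.mem_range_self s⟩) = S.pushGerm m r₀ (ϑ s) :=
    S.pushGerm_eq_of_action_eq hpush ((ht _).trans (hϑa s hs).symm)
  rw [he, pushGerm]
  nth_rewrite 1 [hspan]
  rw [Submodule.map_span, ← Set.range_comp]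
  refine congrArg (Submodule.span ℂ) (congrArg Set.range (funext fun i => ?_))
  rw [Function.comp_apply]
  nth_rewrite 1 [← rePart_add_imPart (b i : ℂ ⊗[ℝ] EuclideanSpace ℝ (Fin (2 * n)))]
  rw [map_add, LinearMap.baseChange_tmul, LinearMap.baseChange_tmul]
  rfl

theorem isComplexGerm_pushGerm {m : M} (hm : m ∈ S.torus)
    {r₀ : Submodule ℂ (ℂ ⊗[ℝ] EuclideanSpace ℝ (Fin (2 * n)))} (hr₀ : S.IsGermOn m r₀)
    (hpush : ∀ t, S.action t m = m → S.pushGerm m r₀ t = r₀) {t : S.torus → Fin k → ℝ}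
    (ht : ∀ x : S.torus, S.action (t x) m = x) :
    S.IsComplexGerm fun x => S.pushGerm m r₀ (t x) := by
  have hgerm : ∀ x : S.torus, S.IsGermOn (x : M) (S.pushGerm m r₀ (t x)) := by
    intro x
    have h := IsGermOn.push S hm hr₀ (t x)
    rw [ht] at h
    exact h
  have hrank : ∀ r x, S.IsGermOn x r → Module.finrank ℂ r = n := by
    intro r x hr
    have h := hr.two_mul_finrank
    rw [finrank_tangentSpace] at h
    exact Nat.eq_of_mul_eq_mul_left two_pos h
  refine ⟨fun s₀ => exists_frame (hrank r₀ m hr₀) hpush ht s₀, fun x => hrank _ x (hgerm x),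
    fun x => (hgerm x).isotropic, fun x => (hgerm x).le, fun x y hy hyL => ?_, fun j s x => ?_⟩
  · rw [baseChange_form_conjugate_re (Ω.bilin_self (x : M))]
    exact (hgerm x).pos y hy hyL
  · have h1 := S.pushGerm_add m r₀ (Pi.single j s) (t x)
    rw [ht, S.pushGerm_eq_of_action_eq hpush (t := t ⟨S.flow j s x, S.flow_mem j s x.2⟩)] at h1
    · refine Eq.trans ?_ h1.symm
      have h2 : ∀ R, S.pushGerm (x : M) R (Pi.single j s) =
          R.map ((modelDeriv n (S.flow j s) x).toLinearMap.baseChange ℂ) := fun R => by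
        rw [pushGerm, S.action_single]
      exact (h2 _).symm
    · rw [S.action_add, ht, ht, S.action_single]

end InvariantTorus

end Global

end ComplexGerm

theorem mainTheorem5 {n k : ℕ} {M : Type*} [TopologicalSpace M] [T2Space M]
    [ChartedSpace (EuclideanSpace ℝ (Fin (2 * n))) M] [IsManifold (𝓡 (2 * n)) ∞ M]
    (Ω : ComplexGerm.SymplecticForm n M) (S : ComplexGerm.InvariantTorus Ω k)
    (m : M) (_hm : m ∈ S.torus)
    (T : Fin k → Fin k → ℝ) (hT : S.IsPeriodBasis m T)
    (_h_stable : ∀ j, ComplexGerm.IsStable (S.reducedMonodromy m (T j) (hT.action_eq j)))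
    (_h_strong : ∃ j, ComplexGerm.IsStronglyStable (S.reducedForm m)
      (S.reducedMonodromy m (T j) (hT.action_eq j))) :
    ∃! r : (x : S.torus) → Submodule ℂ (TensorProduct ℝ ℂ (TangentSpace (𝓡 (2 * n)) (x : M))),
      S.IsComplexGerm r := by
  obtain ⟨j, hj⟩ := _h_strong
  obtain ⟨r₀, hr₀, hpush, huniq⟩ := S.exists_unique_isGermOn _hm (hT.action_eq j) hj
  choose t ht using fun x : S.torus => S.exists_action_eq _hm x.2
  refine ⟨fun x => S.pushGerm m r₀ (t x),
    ComplexGerm.InvariantTorus.isComplexGerm_pushGerm _hm hr₀ hpush ht,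
    fun r hr => ?_⟩
  have hρ : ∀ x y : S.torus, x = y →
      (r x : Submodule ℂ (TensorProduct ℝ ℂ (EuclideanSpace ℝ (Fin (2 * n))))) = r y := by
    rintro x _ rfl
    rfl
  -- Since `g^{T_j} m = m`, an invariant germ has a value at `m` fixed by the monodromy of `T_j`,
  -- and only `r₀` has this property.
  have h0 : (r ⟨m, _hm⟩ : Submodule ℂ (TensorProduct ℝ ℂ (EuclideanSpace ℝ (Fin (2 * n))))) = r₀ :=
    huniq _ (hr.isGermOn ⟨m, _hm⟩)
      ((hr.pushGerm_eq (T j) ⟨m, _hm⟩).trans (hρ _ _ (Subtype.ext (hT.action_eq j))))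
  funext x
  have h1 := hr.pushGerm_eq (t x) ⟨m, _hm⟩
  rw [h0] at h1
  exact (h1.trans (hρ _ _ (Subtype.ext (ht x)))).symm
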